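/- **Setting.** Let $(\mathfrak s,\langle\cdot,\cdot\rangle)$ be a finite-dimensional Euclidean vector space and $V=\Lambda^2\mathfrak s^*\otimes\mathfrak s$ the space of skew-symmetric bilinear maps $\mu:\mathfrak s\times\mathfrak s\to\mathfrak s$. Put $\operatorname{ad}_\mu X=\mu(X,\cdot)$. The group $\mathrm{GL}(\mathfrak s)$ acts on $V$ by $(h\cdot\mu)(X,Y)=h\,\mu(h^{-1}X,h^{-1}Y)$, and its Lie algebra by $(\pi(A)\mu)(X,Y)=A\mu(X,Y)-\mu(AX,Y)-\mu(X,AY)$. On $\mathfrak{gl}(\mathfrak s)$ and $V$ use the induced scalar products $\langle A,B\rangle=\operatorname{tr}(AB^t)$ and $\langle\mu,\nu\rangle=\sum_{i,j}\langle\mu(e_i,e_j),\nu(e_i,e_j)\rangle$, where $(e_i)$ is an orthonormal basis. **Curvature.** The moment map $\mathsf m(\mu)$ ($\mu\ne0$) is the symmetric endomorphism with $\langle\mathsf m(\mu),A\rangle=\langle\pi(A)\mu,\mu\rangle/\|\mu\|^2$ for all symmetric $A$; its energy is $F(\mu)=\|\mathsf m(\mu)\|^2$. Let $\mathsf M_\mu=\tfrac14\|\mu\|^2\mathsf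 m(\mu)$ (with $\mathsf M_0=0$), $\langle\mathsf B_\mu X,Y\rangle=\operatorname{tr}(\operatorname{ad}_\mu X\operatorname{ad}_\mu Y)$, $\langle H_\mu,X\rangle=\operatorname{tr}\operatorname{ad}_\mu X$, and $$\mathrm{Ric}^*_\mu=\mathsf M_\mu-\tfrac12\mathsf B_\mu,\qquad \mathrm{Ric}_\mu=\mathrm{Ric}^*_\mu-\tfrac12\big(\operatorname{ad}_\mu H_\mu+(\operatorname{ad}_\mu H_\mu)^t\big).$$ For a Lie bracket $\mu$, $\mathrm{Ric}_\mu$ is the Ricci endomorphism at the identity of the corresponding left-invariant metric. A *solvsoliton* is a bracket $\mu$ of a solvable Lie algebra such that $\mathrm{Ric}_\mu=c\,\mathrm{Id}+D$ for some $c\in\mathbb R$ and some derivation $D$ of $\mu$. **Objects attached to $\beta$.** Let $\beta=\mathsf m(\mu_C)$ for some critical point $\mu_C\neq0$ of $F$ on $V\setminus\{0\}$, and put $\beta^+=\beta+\|\beta\|^2\mathrm{Id}$. Let $V^0$ be the kernel of $\pi(\beta^+)$ and $V^{\ge0}$ the sum of its eigenspaces with eigenvalue $\geq0$. Let $\mathfrak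 g_\beta$ be the kernel of $\operatorname{ad}(\beta):A\mapsto[\beta,A]$ on $\mathfrak{gl}(\mathfrak s)$, $\mathfrak u_\beta$ the sum of the eigenspaces of $\operatorname{ad}(\beta)$ with positive eigenvalue, and $$\mathfrak q_\beta=\mathfrak g_\beta\oplus\mathfrak u_\beta,\quad \mathfrak k_\beta=\{A\in\mathfrak g_\beta:A^t=-A\},\quad \mathfrak h_\beta=\{A\in\mathfrak g_\beta:\langle A,\beta\rangle=0\},\quad \mathfrak{sl}_\beta=\mathfrak h_\beta\oplus\mathfrak u_\beta .$$ Let $K_\beta$ be the group of orthogonal maps commuting with $\beta$, $H_\beta=K_\beta\exp\{A\in\mathfrak h_\beta:A^t=A\}$, and $\mathrm{SL}_\beta=H_\beta\exp(\mathfrak u_\beta)$, a Lie group with Lie algebra $\mathfrak{sl}_\beta$. A bracket $\mu$ is *gauged correctly* with respect to $\beta$ if $\mu\in V^{\ge0}$ and its orthogonal projection $\mu_0$ to $V^0$ satisfies $0\notin\overline{H_\beta\cdot\mu_0}$. Write $A\mapsto A_{\mathfrak q_\beta}$ for the projection onto $\mathfrak q_\beta$ along its complement $\{A-A^t:A\in\mathfrak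 u_\beta\}$ in $\mathfrak{gl}(\mathfrak s)$. The $\mathrm{scal}^*$-normalized gauged bracket flow is the ODE on $V$ $$\nu'=X(\nu),\qquad X(\nu)=-\pi\big((\mathrm{Ric}^*_\nu)_{\mathfrak q_\beta}+\|\mathrm{Ric}^*_\nu\|^2\,\mathrm{Id}\big)\nu .$$ **Theorem.** Let $\bar\mu$ be a solvsoliton bracket which is gauged correctly with respect to $\beta$ and satisfies $\mathrm{Ric}^*_{\bar\mu}=\beta$. Then $X(\bar\mu)=0$, and the derivative of $X$ at $\bar\mu$ preserves the tangent space $$T=T_{\bar\mu}(\mathrm{SL}_\beta\cdot\bar\mu)=\{\pi(A)\bar\mu:A\in\mathfrak{sl}_\beta\}.$$ Its restriction $L_{\bar\mu}:T\to T$, the linearization of the flow at $\bar\mu$, has kernel $\pi(\mathfrak k_\beta)\bar\mu=\{\pi(A)\bar\mu:A\in\mathfrak k_\beta\}$, and every non-zero complex eigenvalue of $L_{\bar\mu}$ is real and negative. -/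

import Mathlib

open scoped InnerProductSpace

noncomputable section

namespace BracketFlow

set_option linter.unusedSectionVars false

variable {E : Type*} [NormedAddCommGroup E] [InnerProductSpace ℝ E] [FiniteDimensional ℝ E]

/-! ### The space of brackets and the linear actions on it -/

variable (E) in
/-- The space `V(E) = Λ²E* ⊗ E` of brackets: skew-symmetric bilinear maps `E × E → E`.
It carries the subspace topology (it is finite dimensional, so the norm is only used for limits
and derivatives); the scalar product is `bracketInner` below. -/
def brackets : Submodule ℝ (E →L[ℝ] E →L[ℝ] E) where
  carrier := {μ | ∀ x, μ x x = 0}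
  add_mem' := by
    intro μ ν hμ hν x
    simp [hμ x, hν x]
  zero_mem' := by
    intro x
    simp
  smul_mem' := by
    intro c μ hμ x
    simp [hμ x]

variable (E) in
/-- The type of brackets on `E`. -/
abbrev BracketSpace : Type _ := brackets E

/-- The adjoint map `ad_μ(x) : y ↦ μ(x, y)`. -/
abbrev ad (μ : BracketSpace E) (x : E) : E →L[ℝ] E := μ.1 x

theorem bracket_self (μ : BracketSpace E) (x : E) : μ.1 x x = 0 := μ.2 x

theorem bracket_skew (μ : BracketSpace E) (x y : E) : μ.1 x y = -μ.1 y x := by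
  have h := μ.2 (x + y)
  simp only [map_add, add_apply, bracket_self, zero_add, add_zero] at h
  exact eq_neg_of_add_eq_zero_right h

/-- The bilinear map `B(h x, h y)` followed by `g`. -/
def conj (g h : E →L[ℝ] E) (B : E →L[ℝ] E →L[ℝ] E) : E →L[ℝ] E →L[ℝ] E :=
  ((ContinuousLinearMap.compL ℝ E E E g).comp
    (((ContinuousLinearMap.compL ℝ E E E).flip h).comp B)).comp h

@[simp] theorem conj_apply (g h : E →L[ℝ] E) (B : E →L[ℝ] E →L[ℝ] E) (x y : E) :
    conj g h B x y = g (B (h x) (h y)) := rfl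

/-- The change of basis action `(h · μ)(x, y) = h μ(h⁻¹ x, h⁻¹ y)` of `GL(E)`. -/
def act (h : (E →L[ℝ] E)ˣ) (μ : BracketSpace E) : BracketSpace E :=
  ⟨conj (h : E →L[ℝ] E) ((h⁻¹ : (E →L[ℝ] E)ˣ) : E →L[ℝ] E) μ.1, by
    intro x
    simp [bracket_self]⟩

/-- `(π(A)μ)(x, y) = A μ(x, y) - μ(A x, y) - μ(x, A y)`. -/
def repFun (A : E →L[ℝ] E) (μ : BracketSpace E) : BracketSpace E :=
  ⟨(ContinuousLinearMap.compL ℝ E E E A).comp μ.1 - μ.1.comp A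
      - ((ContinuousLinearMap.compL ℝ E E E).flip A).comp μ.1, by
    intro x
    have h1 : μ.1 x x = 0 := bracket_self μ x
    have h2 : μ.1 x (A x) = -μ.1 (A x) x := bracket_skew μ x (A x)
    simp [h1, h2]⟩

@[simp] theorem repFun_apply (A : E →L[ℝ] E) (μ : BracketSpace E) (x y : E) :
    (repFun A μ).1 x y = A (μ.1 x y) - μ.1 (A x) y - μ.1 x (A y) := rfl

/-- The representation `π : gl(E) → End(V(E))`. -/
def rep : (E →L[ℝ] E) →ₗ[ℝ] Module.End ℝ (BracketSpace E) :=
  LinearMap.mk₂ ℝ repFun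
    (by
      intro A B μ
      ext x y
      simp
      abel)
    (by
      intro c A μ
      ext x y
      simp [smul_sub])
    (by
      intro A μ ν
      ext x y
      simp
      abel)
    (by
      intro c A μ
      ext x y
      simp [smul_sub])

@[simp] theorem rep_apply (A : E →L[ℝ] E) (μ : BracketSpace E) (x y : E) :
    (rep A μ).1 x y = A (μ.1 x y) - μ.1 (A x) y - μ.1 x (A y) := rfl

/-- The subspace `π(W)μ = {π(A)μ : A ∈ W}`. -/
def repImage (W : Submodule ℝ (E →L[ℝ] E)) (μ : BracketSpace E) : Submodule ℝ (BracketSpace E) :=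
  W.map (rep.flip μ)

/-! ### Scalar products -/

/-- The trace of an endomorphism. -/
def tr (A : E →L[ℝ] E) : ℝ := LinearMap.trace ℝ E (A : E →ₗ[ℝ] E)

/-- The induced scalar product `⟨A, B⟩ = tr(A Bᵗ)` on `gl(E)`. -/
def glInner (A B : E →L[ℝ] E) : ℝ := tr (A * ContinuousLinearMap.adjoint B)

theorem glInner_add_left (A B C : E →L[ℝ] E) :
    glInner (A + B) C = glInner A C + glInner B C := by
  simp only [glInner, tr, add_mul, ContinuousLinearMap.toLinearMap_add, map_add]

theorem glInner_smul_left (c : ℝ) (A C : E →L[ℝ] E) :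
    glInner (c • A) C = c * glInner A C := by
  simp only [glInner, tr, smul_mul_assoc, ContinuousLinearMap.toLinearMap_smul, map_smul,
    smul_eq_mul]

theorem tr_eq_sum (A : E →L[ℝ] E) :
    tr A = ∑ i, ⟪stdOrthonormalBasis ℝ E i, A (stdOrthonormalBasis ℝ E i)⟫_ℝ :=
  LinearMap.trace_eq_sum_inner _ (stdOrthonormalBasis ℝ E)

/-- The induced scalar product `⟨μ, ν⟩ = ∑ᵢⱼ ⟨μ(eᵢ, eⱼ), ν(eᵢ, eⱼ)⟩` on `V(E)`, for an
orthonormal basis `(eᵢ)`. -/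
def bracketInner (μ ν : BracketSpace E) : ℝ :=
  ∑ i, ∑ j, ⟪μ.1 (stdOrthonormalBasis ℝ E i) (stdOrthonormalBasis ℝ E j),
    ν.1 (stdOrthonormalBasis ℝ E i) (stdOrthonormalBasis ℝ E j)⟫_ℝ

/-! ### Moment map, (modified) Ricci curvature -/

/-- The endomorphism representing the linear form `A ↦ ⟨π(A)μ, μ⟩`
(see `glInner_momentForm` and `isSelfAdjoint_momentForm`). -/
def momentForm (μ : BracketSpace E) : E →L[ℝ] E :=
  (∑ i, ∑ j, InnerProductSpace.rankOne ℝ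
      (μ.1 (stdOrthonormalBasis ℝ E i) (stdOrthonormalBasis ℝ E j))
      (μ.1 (stdOrthonormalBasis ℝ E i) (stdOrthonormalBasis ℝ E j)))
    - (2 : ℝ) • ∑ i, ContinuousLinearMap.adjoint (ad μ (stdOrthonormalBasis ℝ E i))
        * ad μ (stdOrthonormalBasis ℝ E i)

theorem isSelfAdjoint_momentForm (μ : BracketSpace E) : IsSelfAdjoint (momentForm μ) := by
  rw [ContinuousLinearMap.isSelfAdjoint_iff_isSymmetric]
  intro x y
  simp [momentForm, inner_sub_left, inner_sub_right, inner_sum, sum_inner,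
    inner_smul_left, inner_smul_right, ContinuousLinearMap.adjoint_inner_left,
    ContinuousLinearMap.adjoint_inner_right, real_inner_comm, mul_comm]

theorem glInner_momentForm (μ : BracketSpace E) (A : E →L[ℝ] E) :
    glInner (momentForm μ) A = bracketInner (rep A μ) μ := by
  set b := stdOrthonormalBasis ℝ E with hb
  have h1 : ∀ T : E →L[ℝ] E, glInner T A = ∑ i, ⟪A (b i), T (b i)⟫_ℝ := by
    intro T
    have h : glInner T A = tr (ContinuousLinearMap.adjoint A * T) :=
      LinearMap.trace_mul_comm ℝ (T : E →ₗ[ℝ] E) (ContinuousLinearMap.adjoint A : E →L[ℝ] E)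
    rw [h, tr_eq_sum]
    simp [ContinuousLinearMap.adjoint_inner_right, hb]
  have h3 : ∑ i, ∑ j, ⟪μ.1 (b i) (A (b j)), μ.1 (b i) (b j)⟫_ℝ
      = ∑ i, ∑ j, ⟪μ.1 (A (b i)) (b j), μ.1 (b i) (b j)⟫_ℝ := by
    rw [Finset.sum_comm]
    refine Finset.sum_congr rfl fun i _ => Finset.sum_congr rfl fun j _ => ?_
    rw [bracket_skew μ (b j) (A (b i)), bracket_skew μ (b j) (b i), inner_neg_neg]
  have h4 : bracketInner (rep A μ) μ = (∑ i, ∑ j, ⟪A (μ.1 (b i) (b j)), μ.1 (b i) (b j)⟫_ℝ)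
      - 2 * ∑ i, ∑ j, ⟪μ.1 (b i) (A (b j)), μ.1 (b i) (b j)⟫_ℝ := by
    rw [two_mul]
    conv_rhs => rw [h3]
    conv_rhs => enter [2, 2]; rw [← h3]
    simp only [bracketInner, rep_apply, inner_sub_left, Finset.sum_sub_distrib, ← hb]
    ring
  rw [h4, momentForm, ← hb, sub_eq_add_neg, glInner_add_left, ← neg_smul, glInner_smul_left,
    h1, h1]
  have p1 : ∑ k, ⟪A (b k), (∑ i, ∑ j, InnerProductSpace.rankOne ℝ (μ.1 (b i) (b j))
      (μ.1 (b i) (b j))) (b k)⟫_ℝ = ∑ i, ∑ j, ⟪A (μ.1 (b i) (b j)), μ.1 (b i) (b j)⟫_ℝ := by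
    have hu : ∀ u : E, ∑ k, ⟪u, b k⟫_ℝ * ⟪A (b k), u⟫_ℝ = ⟪A u, u⟫_ℝ := by
      intro u
      simp only [← ContinuousLinearMap.adjoint_inner_right A]
      exact b.sum_inner_mul_inner u (ContinuousLinearMap.adjoint A u)
    simp only [sum_apply, InnerProductSpace.rankOne_apply, inner_sum, inner_smul_right]
    rw [Finset.sum_comm]
    refine Finset.sum_congr rfl fun i _ => ?_
    rw [Finset.sum_comm]
    exact Finset.sum_congr rfl fun j _ => hu _
  have p2 : ∑ k, ⟪A (b k), (∑ i, ContinuousLinearMap.adjoint (ad μ (b i)) * ad μ (b i)) (b k)⟫_ℝ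
      = ∑ i, ∑ j, ⟪μ.1 (b i) (A (b j)), μ.1 (b i) (b j)⟫_ℝ := by
    simp only [sum_apply, inner_sum, mul_apply_eq_comp,
      ContinuousLinearMap.adjoint_inner_right]
    rw [Finset.sum_comm]
  rw [p1, p2]
  ring

/-- The moment map: `⟨m(μ), A⟩ = ⟨π(A)μ, μ⟩ / ‖μ‖²` for all symmetric `A`. -/
def momentMap (μ : BracketSpace E) : E →L[ℝ] E := (bracketInner μ μ)⁻¹ • momentForm μ

/-- The energy `F(μ) = ‖m(μ)‖²` of the moment map. -/
def energy (μ : BracketSpace E) : ℝ := glInner (momentMap μ) (momentMap μ)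

/-- `β` is a stratum label: the value of the moment map at a critical point `μ ≠ 0` of its
energy. -/
def IsStratumLabel (β : E →L[ℝ] E) : Prop :=
  ∃ μ : BracketSpace E, μ ≠ 0 ∧ HasFDerivAt energy (0 : BracketSpace E →L[ℝ] ℝ) μ ∧ momentMap μ = β

/-- `M_μ = ¼ ‖μ‖² m(μ)`. -/
def momentPart (μ : BracketSpace E) : E →L[ℝ] E := ((1 / 4 : ℝ) * bracketInner μ μ) • momentMap μ

/-- The endomorphism of the Killing form: `⟨K_μ x, y⟩ = tr(ad_μ x ∘ ad_μ y)`. -/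
def killing (μ : BracketSpace E) : E →L[ℝ] E :=
  LinearMap.toContinuousLinearMap
    { toFun := fun x => ∑ i, tr (ad μ x * ad μ (stdOrthonormalBasis ℝ E i)) •
        stdOrthonormalBasis ℝ E i
      map_add' := by
        intro x y
        simp [tr, add_mul, add_smul, Finset.sum_add_distrib]
      map_smul' := by
        intro c x
        simp [tr, mul_smul, Finset.smul_sum] }

/-- The mean curvature vector: `⟨H_μ, x⟩ = tr(ad_μ x)`. -/
def meanCurvature (μ : BracketSpace E) : E :=
  ∑ i, tr (ad μ (stdOrthonormalBasis ℝ E i)) • stdOrthonormalBasis ℝ E i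

theorem inner_killing (μ : BracketSpace E) (x y : E) :
    ⟪killing μ x, y⟫_ℝ = tr (ad μ x * ad μ y) := by
  have h : ad μ y = ∑ i, ⟪stdOrthonormalBasis ℝ E i, y⟫_ℝ • ad μ (stdOrthonormalBasis ℝ E i) := by
    conv_lhs => rw [← (stdOrthonormalBasis ℝ E).sum_repr' y]
    simp
  rw [h]
  simp [killing, tr, sum_inner, inner_smul_left, Finset.mul_sum, mul_comm]

theorem inner_meanCurvature (μ : BracketSpace E) (x : E) :
    ⟪meanCurvature μ, x⟫_ℝ = tr (ad μ x) := by
  have h : ad μ x = ∑ i, ⟪stdOrthonormalBasis ℝ E i, x⟫_ℝ • ad μ (stdOrthonormalBasis ℝ E i) := by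
    conv_lhs => rw [← (stdOrthonormalBasis ℝ E).sum_repr' x]
    simp
  rw [h]
  simp [meanCurvature, tr, sum_inner, inner_smul_left, mul_comm]

/-- The modified Ricci curvature `Ric*_μ = M_μ - ½ K_μ`. -/
def ricMod (μ : BracketSpace E) : E →L[ℝ] E := momentPart μ - (1 / 2 : ℝ) • killing μ

/-- The Ricci endomorphism at the identity of the left-invariant metric defined by the scalar
product of `E` on the Lie group with Lie algebra `(E, μ)`:
`Ric_μ = M_μ - ½ K_μ - ½ (ad_μ H_μ + (ad_μ H_μ)ᵗ)`. -/
def ric (μ : BracketSpace E) : E →L[ℝ] E :=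
  momentPart μ - (1 / 2 : ℝ) • killing μ
    - (1 / 2 : ℝ) • (ad μ (meanCurvature μ) + ContinuousLinearMap.adjoint (ad μ (meanCurvature μ)))

/-! ### Solvsolitons -/

/-- The Jacobi identity. -/
def IsLie (μ : BracketSpace E) : Prop :=
  ∀ x y z, μ.1 x (μ.1 y z) = μ.1 (μ.1 x y) z + μ.1 y (μ.1 x z)

/-- The Lie ring structure on `E` given by a bracket satisfying the Jacobi identity. -/
@[reducible] def lieRing (μ : BracketSpace E) (h : IsLie μ) : LieRing E where
  bracket x y := μ.1 x y
  add_lie x y z := by simp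
  lie_add x y z := by simp
  lie_self x := bracket_self μ x
  leibniz_lie x y z := h x y z

/-- `μ` is the bracket of a solvable Lie algebra. -/
def IsSolvableLie (μ : BracketSpace E) : Prop :=
  ∃ h : IsLie μ, @LieAlgebra.IsSolvable E (lieRing μ h)

/-- `D` is a derivation of `μ`. -/
def IsDerivation (μ : BracketSpace E) (D : E →L[ℝ] E) : Prop :=
  ∀ x y, D (μ.1 x y) = μ.1 (D x) y + μ.1 x (D y)

/-- Solvsoliton brackets: solvable Lie brackets with `Ric_μ = c · Id + D`, `D ∈ Der(μ)`. -/
def IsSolvsoliton (μ : BracketSpace E) : Prop :=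
  IsSolvableLie μ ∧
    ∃ (c : ℝ) (D : E →L[ℝ] E), IsDerivation μ D ∧ ric μ = c • (1 : E →L[ℝ] E) + D

/-! ### Subspaces and subgroups attached to `β` -/

/-- `β⁺ = β + ‖β‖² Id`. -/
def betaPlus (β : E →L[ℝ] E) : E →L[ℝ] E := β + glInner β β • (1 : E →L[ℝ] E)

/-- The zero eigenspace of `π(β⁺)`. -/
def vZero (β : E →L[ℝ] E) : Submodule ℝ (BracketSpace E) :=
  Module.End.eigenspace (R := ℝ) (M := BracketSpace E) (rep (betaPlus β)) 0

/-- The sum of the eigenspaces of `π(β⁺)` with eigenvalue `r ≥ 0`. -/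
def vNonneg (β : E →L[ℝ] E) : Submodule ℝ (BracketSpace E) :=
  ⨆ r ∈ Set.Ici (0 : ℝ), Module.End.eigenspace (R := ℝ) (M := BracketSpace E) (rep (betaPlus β)) r

/-- `ad(β) : A ↦ [β, A]`. -/
def adBeta (β : E →L[ℝ] E) : Module.End ℝ (E →L[ℝ] E) :=
  LinearMap.mulLeft ℝ β - LinearMap.mulRight ℝ β

/-- `𝔤_β`, the centralizer of `β` in `gl(E)`. -/
def gAlg (β : E →L[ℝ] E) : Submodule ℝ (E →L[ℝ] E) := Module.End.eigenspace (adBeta β) 0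

/-- `𝔲_β`, the sum of the eigenspaces of `ad(β)` with eigenvalue `r > 0`. -/
def uAlg (β : E →L[ℝ] E) : Submodule ℝ (E →L[ℝ] E) :=
  ⨆ r ∈ Set.Ioi (0 : ℝ), Module.End.eigenspace (adBeta β) r

/-- `𝔮_β = 𝔤_β ⊕ 𝔲_β`. -/
def qAlg (β : E →L[ℝ] E) : Submodule ℝ (E →L[ℝ] E) := gAlg β ⊔ uAlg β

/-- The linear map `A ↦ A - Aᵗ`. -/
def skewPart : (E →L[ℝ] E) →ₗ[ℝ] (E →L[ℝ] E) :=
  LinearMap.id -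
    (ContinuousLinearMap.adjoint (𝕜 := ℝ) (E := E) (F := E)).toLinearEquiv.toLinearMap

/-- `𝔨_{𝔲_β} = {A - Aᵗ : A ∈ 𝔲_β}`. -/
def kuAlg (β : E →L[ℝ] E) : Submodule ℝ (E →L[ℝ] E) := (uAlg β).map skewPart

theorem isCompl_qAlg_kuAlg {β : E →L[ℝ] E} (hβ : IsSelfAdjoint β) :
    IsCompl (qAlg β) (kuAlg β) := by
  have hadj : ContinuousLinearMap.adjoint β = β := hβ
  have hsym : (β : E →ₗ[ℝ] E).IsSymmetric :=
    (ContinuousLinearMap.isSelfAdjoint_iff_isSymmetric).1 hβ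
  have hmem : ∀ (A : E →L[ℝ] E) (r : ℝ),
      A ∈ Module.End.eigenspace (adBeta β) r ↔ β * A - A * β = r • A := by
    intro A r
    rw [Module.End.mem_eigenspace_iff]
    rfl
  have htr : ∀ (A : E →L[ℝ] E) (r : ℝ), A ∈ Module.End.eigenspace (adBeta β) r →
      ContinuousLinearMap.adjoint A ∈ Module.End.eigenspace (adBeta β) (-r) := by
    intro A r hA
    rw [hmem] at hA ⊢
    have h := congrArg (ContinuousLinearMap.adjoint (𝕜 := ℝ) (E := E) (F := E)) hA
    rw [map_sub] at h
    have e1 : ContinuousLinearMap.adjoint (β * A) = ContinuousLinearMap.adjoint A * β := by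
      have := star_mul β A
      rwa [ContinuousLinearMap.star_eq_adjoint, ContinuousLinearMap.star_eq_adjoint,
        ContinuousLinearMap.star_eq_adjoint, hadj] at this
    have e2 : ContinuousLinearMap.adjoint (A * β) = β * ContinuousLinearMap.adjoint A := by
      have := star_mul A β
      rwa [ContinuousLinearMap.star_eq_adjoint, ContinuousLinearMap.star_eq_adjoint,
        ContinuousLinearMap.star_eq_adjoint, hadj] at this
    have e3 : ContinuousLinearMap.adjoint (r • A) = r • ContinuousLinearMap.adjoint A := by
      simp
    rw [e1, e2, e3] at h
    rw [neg_smul, ← h, neg_sub]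
  constructor
  · rw [Submodule.disjoint_def]
    intro x hx hx'
    obtain ⟨a, ha, rfl⟩ := hx'
    have hle : qAlg β ≤ ⨆ r ∈ Set.Ici (0 : ℝ), Module.End.eigenspace (adBeta β) r := by
      refine sup_le (le_biSup (fun r => Module.End.eigenspace (adBeta β) r)
        (Set.self_mem_Ici)) ?_
      exact biSup_mono fun r hr => Set.Ioi_subset_Ici_self hr
    have hneg : ContinuousLinearMap.adjoint a ∈
        ⨆ r ∈ Set.Iio (0 : ℝ), Module.End.eigenspace (adBeta β) r := by
      have hsub : uAlg β ≤ (⨆ r ∈ Set.Iio (0 : ℝ), Module.End.eigenspace (adBeta β) r).comap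
          (ContinuousLinearMap.adjoint (𝕜 := ℝ) (E := E) (F := E)).toLinearEquiv.toLinearMap := by
        refine iSup₂_le fun r hr A hA => ?_
        exact Submodule.mem_iSup_of_mem (-r)
          (Submodule.mem_iSup_of_mem (Set.mem_Iio.2 (neg_lt_zero.2 (Set.mem_Ioi.1 hr)))
            (htr A r hA))
      exact hsub ha
    have hpos : ContinuousLinearMap.adjoint a ∈
        ⨆ r ∈ Set.Ici (0 : ℝ), Module.End.eigenspace (adBeta β) r := by
      have h : ContinuousLinearMap.adjoint a = a - skewPart a := by
        simp [skewPart]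
      rw [h]
      exact sub_mem (hle (Submodule.mem_sup_right ha)) (hle hx)
    have hdisj := (Module.End.eigenspaces_iSupIndep (adBeta β)).disjoint_biSup_biSup
      (s := Set.Ici (0 : ℝ)) (t := Set.Iio (0 : ℝ))
      (Set.disjoint_left.2 fun r hr hr' => not_lt_of_ge (Set.mem_Ici.1 hr) (Set.mem_Iio.1 hr'))
    have h0 := Submodule.disjoint_def.1 hdisj _ hpos hneg
    have : a = 0 := by simpa using h0
    rw [this, map_zero]
  · rw [codisjoint_iff, eq_top_iff]
    set b := hsym.eigenvectorBasis rfl with hb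
    have hbe : ∀ i, β (b i) = hsym.eigenvalues rfl i • b i := by
      intro i
      exact hsym.apply_eigenvectorBasis rfl i
    have hR : ∀ i j, InnerProductSpace.rankOne ℝ (b i) (b j) ∈
        Module.End.eigenspace (adBeta β) (hsym.eigenvalues rfl i - hsym.eigenvalues rfl j) := by
      intro i j
      rw [hmem]
      ext x
      have h := hsym (b j) x
      simp only [ContinuousLinearMap.coe_coe] at h
      simp [hbe, ← h, inner_smul_left, sub_smul, smul_smul, mul_comm]
    have hRadj : ∀ i j, ContinuousLinearMap.adjoint (InnerProductSpace.rankOne ℝ (b i) (b j)) =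
        InnerProductSpace.rankOne ℝ (b j) (b i) := by
      intro i j
      simp
    have hall : ∀ i j, InnerProductSpace.rankOne ℝ (b i) (b j) ∈ qAlg β ⊔ kuAlg β := by
      have hge : ∀ i j, hsym.eigenvalues rfl j ≤ hsym.eigenvalues rfl i →
          InnerProductSpace.rankOne ℝ (b i) (b j) ∈ qAlg β := by
        intro i j hij
        rcases hij.eq_or_lt with h | h
        · refine Submodule.mem_sup_left ?_
          have := hR i j
          rwa [h, sub_self] at this
        · refine Submodule.mem_sup_right ?_
          exact Submodule.mem_iSup_of_mem _
            (Submodule.mem_iSup_of_mem (sub_pos.2 h) (hR i j))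
      intro i j
      rcases le_or_gt (hsym.eigenvalues rfl j) (hsym.eigenvalues rfl i) with h | h
      · exact Submodule.mem_sup_left (hge i j h)
      · have hu : InnerProductSpace.rankOne ℝ (b j) (b i) ∈ uAlg β :=
          Submodule.mem_iSup_of_mem _ (Submodule.mem_iSup_of_mem (sub_pos.2 h) (hR j i))
        have e : InnerProductSpace.rankOne ℝ (b i) (b j) =
            InnerProductSpace.rankOne ℝ (b j) (b i)
              - skewPart (InnerProductSpace.rankOne ℝ (b j) (b i)) := by
          simp [skewPart]
        rw [e]
        exact sub_mem (Submodule.mem_sup_left (hge j i h.le))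
          (Submodule.mem_sup_right (Submodule.mem_map_of_mem hu))
    intro A _
    have hA : A = ∑ j, ∑ i, ⟪b i, A (b j)⟫_ℝ • InnerProductSpace.rankOne ℝ (b i) (b j) := by
      ext x
      conv_lhs => rw [← b.sum_repr' x]
      simp only [map_sum, map_smul, sum_apply, smul_apply,
        InnerProductSpace.rankOne_apply]
      refine Finset.sum_congr rfl fun j _ => ?_
      conv_lhs => rw [← b.sum_repr' (A (b j))]
      rw [Finset.smul_sum]
      refine Finset.sum_congr rfl fun i _ => ?_
      rw [smul_comm]
    rw [hA]
    exact sum_mem fun j _ => sum_mem fun i _ => Submodule.smul_mem _ _ (hall i j)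

/-- `𝔨_β = {A ∈ 𝔤_β : Aᵗ = -A}`, the Lie algebra of `K_β = O(E) ∩ G_β`. -/
def kAlg (β : E →L[ℝ] E) : Submodule ℝ (E →L[ℝ] E) :=
  gAlg β ⊓ LinearMap.ker (LinearMap.id +
    (ContinuousLinearMap.adjoint (𝕜 := ℝ) (E := E) (F := E)).toLinearEquiv.toLinearMap)

/-- `𝔥_β = {A ∈ 𝔤_β : ⟨A, β⟩ = 0}`. -/
def hAlg (β : E →L[ℝ] E) : Submodule ℝ (E →L[ℝ] E) where
  carrier := {A | A ∈ gAlg β ∧ glInner A β = 0}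
  add_mem' := by
    rintro A B ⟨hA, hA'⟩ ⟨hB, hB'⟩
    refine ⟨add_mem hA hB, ?_⟩
    rw [glInner_add_left, hA', hB', add_zero]
  zero_mem' := ⟨zero_mem _, by simp [glInner, tr]⟩
  smul_mem' := by
    rintro c A ⟨hA, hA'⟩
    refine ⟨Submodule.smul_mem _ _ hA, ?_⟩
    rw [glInner_smul_left, hA', mul_zero]

/-- `𝔰𝔩_β = 𝔥_β ⊕ 𝔲_β`, the Lie algebra of the group `SL_β = H_β U_β`. -/
def slAlg (β : E →L[ℝ] E) : Submodule ℝ (E →L[ℝ] E) := hAlg β ⊔ uAlg β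

/-- The tangent space `T_μ(SL_β · μ) = {π(A)μ : A ∈ 𝔰𝔩_β}` at `μ` of its `SL_β`-orbit, i.e. the
image of the differential at the identity of the orbit map `g ↦ g · μ`. -/
def orbitTangent (β : E →L[ℝ] E) (μ : BracketSpace E) : Submodule ℝ (BracketSpace E) :=
  repImage (slAlg β) μ

/-- The subgroup `H_β = K_β exp(𝔭 ∩ 𝔥_β)` of `GL(E)`, where `𝔭` is the space of symmetric
endomorphisms and `K_β` the group of orthogonal maps commuting with `β`. -/
def hGroup (β : E →L[ℝ] E) : Set (E →L[ℝ] E)ˣ :=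
  {g | ∃ k ∈ unitary (E →L[ℝ] E), k * β = β * k ∧
    ∃ A ∈ hAlg β, IsSelfAdjoint A ∧ (g : E →L[ℝ] E) = k * NormedSpace.exp A}

/-- The brackets in the zero eigenspace whose `H_β`-orbit does not accumulate at `0`. -/
def vZeroSS (β : E →L[ℝ] E) : Set (BracketSpace E) :=
  {μ | μ ∈ vZero β ∧ (0 : BracketSpace E) ∉ closure ((fun g => act g μ) '' hGroup β)}

/-- The brackets `μ` in `vNonneg β` whose orthogonal projection `μ₀` to `vZero β` lies in
`vZeroSS β`. These are the brackets gauged correctly with respect to `β`. -/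
def vNonnegSS (β : E →L[ℝ] E) : Set (BracketSpace E) :=
  {μ | μ ∈ vNonneg β ∧
    ∃ μ₀ ∈ vZeroSS β, ∀ ν ∈ vZero β, bracketInner (μ - μ₀) ν = 0}

/-! ### The normalized gauged bracket flow -/

open Classical in
/-- The projection `A ↦ A_{𝔮_β}` of `gl(E) = 𝔮_β ⊕ 𝔨_{𝔲_β}` onto `𝔮_β` along `𝔨_{𝔲_β}`.
The two subspaces are complementary for every symmetric `β`, by `isCompl_qAlg_kuAlg`. -/
def qProj (β : E →L[ℝ] E) : (E →L[ℝ] E) →ₗ[ℝ] (E →L[ℝ] E) :=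
  if h : IsCompl (qAlg β) (kuAlg β) then Submodule.projection _ _ h else 0

/-- The vector field `ν ↦ -π((Ric*_ν)_{𝔮_β} + ‖Ric*_ν‖² Id) ν` on `V(E)` whose integral curves
are the solutions of the `scal*`-normalized gauged bracket flow. -/
def flowField (β : E →L[ℝ] E) (ν : BracketSpace E) : BracketSpace E :=
  -rep (qProj β (ricMod ν) + glInner (ricMod ν) (ricMod ν) • (1 : E →L[ℝ] E)) ν

end BracketFlow

end

/-! Write `B` for `killing μ` and let `f : A ↦ π(A)μ` map `𝔰𝔩_β` onto the tangent space. The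
modified Ricci curvature is quadratic in the bracket, so the derivative of the flow field along the
orbit is explicit: `L (f A) = -f (M A)` with `M A = (d Ric*(π(A)μ))_{𝔮_β} + [β, A]` (`linOp`,
`exists_linearization`). Hence `L` is a quotient of `-M`. By `ker_and_eigenvalue_of_intertwined` it
suffices that `M` is symmetric and positive semidefinite on `𝔰𝔩_β` for the trace scalar product,
that it kills `𝔨_β`, and that `⟨M A, A⟩ = 0` forces `π(A)μ` into `π(𝔨_β)μ`.

Splitting along `𝔤_β ⊕ 𝔲_β`, `glInner_linOp` expresses the form of `M` as the sum of the Hessian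
`½⟨π(A)μ, π(C)μ⟩ + ⟨B A, C⟩` on symmetric parts of the `𝔤_β`-components, of `½⟨π(U)μ, π(V)μ⟩`, and
of `⟨[β, U], V⟩`. The last two are visibly nonnegative, the third being definite on `𝔲_β`. The
Killing term of the Hessian has no evident sign, and controlling it needs the structure of the
soliton.

That structure comes from `β⁺`. The soliton equation gives `⟨π(β⁺)μ, μ⟩ = 0`, and since `μ` lies in
`V^{≥0}` this makes `β⁺` a derivation (`isDerivation_betaPlus`). Lie's theorem for the solvable
algebra `ad E + ℝ β⁺` then produces an ideal `n` containing all brackets and the image of `β⁺`,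
acting nilpotently, on which `B` vanishes (`exists_nilpotentIdeal`). So `β⁺ = 0` on `nᗮ`. Averaging
`Ric* = β` over orthonormal families in invariant subspaces shows that `β⁺` has only positive
eigenvalues on `n` (`NilpotentIdeal.eq_zero_of_eigenvalue_nonpos`). Consequently `nᗮ` is abelian,
the transposes of its adjoint maps are derivations, and `⟨B y, y⟩ = 2‖β‖²|y|² - |ad y|²` there. The
negative summand is cancelled exactly by a part of `½|π(A)μ|²`, and the Hessian becomes a sum of
squares (`NilpotentIdeal.hessian_eq`). -/

open scoped InnerProductSpace

namespace BracketFlow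

set_option linter.unusedSectionVars false

local postfix:max "ᵗ" => ContinuousLinearMap.adjoint

/-! ### Linear algebra of positive definite forms -/

section Forms

variable {U : Type*} [AddCommGroup U] [Module ℝ U]

/-- The inner product space core of a positive definite symmetric bilinear form. -/
abbrev formCore (b : LinearMap.BilinForm ℝ U) (hs : ∀ x y, b x y = b y x)
    (hp : ∀ x, x ≠ 0 → 0 < b x x) : InnerProductSpace.Core ℝ U where
  inner x y := b x y
  conj_inner_symm x y := by simpa using hs y x
  re_inner_nonneg x := by
    by_cases h : x = 0
    · simp [h]
    · simpa using (hp x h).le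
  add_left x y z := by simp
  smul_left x y r := by simp
  definite x h := by
    by_contra hx
    exact (hp x hx).ne' h

/-- The form is an explicit argument because it is applied to `E` and to `gl(E)`, and the latter
already carries the operator norm. The inner product structure is installed only inside the proof.
-/
theorem exists_orthonormal_family (b : LinearMap.BilinForm ℝ U) (hs : ∀ x y, b x y = b y x)
    (hp : ∀ x, x ≠ 0 → 0 < b x x) (S : Submodule ℝ U) [FiniteDimensional ℝ S] :
    ∃ a : Fin (Module.finrank ℝ S) → U, (∀ i, a i ∈ S) ∧
      (∀ i j, b (a i) (a j) = if i = j then 1 else 0) ∧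
      ∀ x ∈ S, x = ∑ i, b (a i) x • a i := by
  let _ : NormedAddCommGroup U := (formCore b hs hp).toNormedAddCommGroup
  let _ : InnerProductSpace ℝ U := InnerProductSpace.ofCore (formCore b hs hp).toCore
  have hb : ∀ x y : U, ⟪x, y⟫_ℝ = b x y := fun _ _ => rfl
  let e := stdOrthonormalBasis ℝ S
  refine ⟨fun i => e i, fun i => (e i).2, fun i j => ?_, fun x hx => ?_⟩
  · have h := e.inner_eq_ite i j
    rw [Submodule.coe_inner, hb] at h
    exact h
  · have h := congrArg Subtype.val (e.sum_repr' ⟨x, hx⟩)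
    simp only [Submodule.coe_inner, hb, Submodule.coe_sum, Submodule.coe_smul] at h
    exact h.symm

/-- Bessel's inequality: the residual of `x` after projection has nonnegative square. -/
theorem sum_sq_le_form (b : LinearMap.BilinForm ℝ U) (hs : ∀ x y, b x y = b y x)
    (hp : ∀ x, x ≠ 0 → 0 < b x x) {ι : Type*} [Fintype ι] [DecidableEq ι] (a : ι → U)
    (ha : ∀ i j, b (a i) (a j) = if i = j then 1 else 0) (x : U) :
    ∑ i, b (a i) x ^ 2 ≤ b x x := by
  have h0 : 0 ≤ b (x - ∑ i, b (a i) x • a i) (x - ∑ i, b (a i) x • a i) := by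
    by_cases h : x - ∑ i, b (a i) x • a i = 0
    · simp [h]
    · exact (hp _ h).le
  have h1 : ∀ j, b (a j) (x - ∑ i, b (a i) x • a i) = 0 := by
    intro j
    simp [map_sum, ha]
  have h2 : b (x - ∑ i, b (a i) x • a i) (x - ∑ i, b (a i) x • a i)
      = b x x - ∑ i, b (a i) x ^ 2 := by
    have : b (∑ i, b (a i) x • a i) (x - ∑ i, b (a i) x • a i) = 0 := by
      rw [map_sum, LinearMap.sum_apply]
      exact Finset.sum_eq_zero fun i _ => by rw [map_smul, LinearMap.smul_apply, h1, smul_zero]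
    rw [LinearMap.map_sub₂, this, sub_zero, map_sub]
    simp only [map_sum, map_smul, smul_eq_mul]
    congr 1
    exact Finset.sum_congr rfl fun i _ => by rw [hs x, sq]
  linarith

/-- If `T` maps the span of the orthonormal family `a` into itself and `T'` is adjoint to `T`,
then `∑ |T aₖ|² ≤ ∑ |T' aₖ|²`. -/
theorem sum_form_le_sum_form_adjoint (b : LinearMap.BilinForm ℝ U) (hs : ∀ x y, b x y = b y x)
    (hp : ∀ x, x ≠ 0 → 0 < b x x) {S : Submodule ℝ U} {ι : Type*} [Fintype ι] [DecidableEq ι]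
    (a : ι → U) (haS : ∀ i, a i ∈ S) (ha : ∀ i j, b (a i) (a j) = if i = j then 1 else 0)
    (hspan : ∀ x ∈ S, x = ∑ i, b (a i) x • a i) (T T' : U → U)
    (hT : ∀ x ∈ S, T x ∈ S) (hadj : ∀ x y, b (T x) y = b x (T' y)) :
    ∑ k, b (T (a k)) (T (a k)) ≤ ∑ k, b (T' (a k)) (T' (a k)) := by
  -- `T aₖ` stays in the span, so Parseval applies to it; `T' aₗ` may leave the span, so only Bessel
  -- is available there. This asymmetry is the inequality.
  have h1 : ∀ k, b (T (a k)) (T (a k)) = ∑ l, b (a k) (T' (a l)) ^ 2 := by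
    intro k
    have := hspan _ (hT _ (haS k))
    calc b (T (a k)) (T (a k)) = b (T (a k)) (∑ i, b (a i) (T (a k)) • a i) := by rw [← this]
      _ = ∑ l, b (a k) (T' (a l)) ^ 2 := by
        rw [map_sum]
        refine Finset.sum_congr rfl fun l _ => ?_
        rw [map_smul, hs (a l), hadj, smul_eq_mul, sq]
  calc ∑ k, b (T (a k)) (T (a k)) = ∑ l, ∑ k, b (a k) (T' (a l)) ^ 2 := by
        rw [Finset.sum_comm]
        exact Finset.sum_congr rfl fun k _ => h1 k
    _ ≤ _ := Finset.sum_le_sum fun l _ => sum_sq_le_form b hs hp a ha _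

theorem form_eigenspace_eq_zero (b : LinearMap.BilinForm ℝ U) (T : Module.End ℝ U)
    (hT : ∀ x y, b (T x) y = b x (T y)) {r s : ℝ} (hrs : r ≠ s) {x y : U}
    (hx : x ∈ Module.End.eigenspace T r) (hy : y ∈ Module.End.eigenspace T s) : b x y = 0 := by
  have h := hT x y
  rw [Module.End.mem_eigenspace_iff.1 hx, Module.End.mem_eigenspace_iff.1 hy] at h
  simp only [map_smul, LinearMap.smul_apply, smul_eq_mul] at h
  have : (r - s) * b x y = 0 := by linarith
  exact (mul_eq_zero.1 this).resolve_left (sub_ne_zero.2 hrs)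

/-- Applied to `ad β`, this separates `𝔤_β`, `𝔲_β` and the transposes of `𝔲_β`, which are the zero,
positive and negative spectral parts. -/
theorem form_iSup_eigenspace_eq_zero (b : LinearMap.BilinForm ℝ U) (T : Module.End ℝ U)
    (hT : ∀ x y, b (T x) y = b x (T y)) {s t : Set ℝ} (hst : Disjoint s t) {x y : U}
    (hx : x ∈ ⨆ r ∈ s, Module.End.eigenspace T r)
    (hy : y ∈ ⨆ r ∈ t, Module.End.eigenspace T r) : b x y = 0 := by
  have h1 : ∀ r ∈ s, ∀ z ∈ Module.End.eigenspace T r, b z y = 0 := by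
    intro r hr z hz
    have hle : ⨆ r ∈ t, Module.End.eigenspace T r ≤ LinearMap.ker (b z) := by
      refine iSup₂_le fun r' hr' w hw => ?_
      rw [LinearMap.mem_ker]
      refine form_eigenspace_eq_zero b T hT ?_ hz hw
      rintro rfl
      exact Set.disjoint_left.1 hst hr hr'
    exact LinearMap.mem_ker.1 (hle hy)
  have hle : ⨆ r ∈ s, Module.End.eigenspace T r ≤ LinearMap.ker (b.flip y) := by
    refine iSup₂_le fun r hr z hz => ?_
    exact h1 r hr z hz
  exact LinearMap.mem_ker.1 (hle hx)

theorem exists_sum_of_mem_iSup_eigenspace {T : Module.End ℝ U} {s : Set ℝ} {x : U}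
    (hx : x ∈ ⨆ r ∈ s, Module.End.eigenspace T r) :
    ∃ (t : Finset ℝ) (f : ℝ → U), (∀ r ∈ t, r ∈ s) ∧ (∀ r, T (f r) = r • f r) ∧
      x = ∑ r ∈ t, f r := by
  classical
  rw [iSup_subtype', Submodule.mem_iSup_iff_exists_finsupp] at hx
  obtain ⟨f, hf, rfl⟩ := hx
  refine ⟨f.support.map (Function.Embedding.subtype _),
    fun r => if h : r ∈ s then f ⟨r, h⟩ else 0, ?_, ?_, ?_⟩
  · intro r hr
    simp only [Finset.mem_map] at hr
    obtain ⟨a, -, rfl⟩ := hr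
    exact a.2
  · intro r
    by_cases h : r ∈ s
    · simp only [h, dite_true]
      exact Module.End.mem_eigenspace_iff.1 (hf ⟨r, h⟩)
    · simp [h]
  · rw [Finset.sum_map, Finsupp.sum]
    refine Finset.sum_congr rfl fun a _ => ?_
    simp

theorem form_apply_self_of_sum (b : LinearMap.BilinForm ℝ U) {T : Module.End ℝ U}
    (hT : ∀ x y, b (T x) y = b x (T y)) (t : Finset ℝ) (f : ℝ → U)
    (hf : ∀ r, T (f r) = r • f r) :
    b (T (∑ r ∈ t, f r)) (∑ r ∈ t, f r) = ∑ r ∈ t, r * b (f r) (f r) := by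
  classical
  simp only [map_sum, LinearMap.sum_apply]
  refine Finset.sum_congr rfl fun r hr => ?_
  rw [Finset.sum_eq_single r]
  · rw [hf, map_smul, LinearMap.smul_apply, smul_eq_mul]
  · intro s _ hs
    rw [hf]
    simp only [map_smul, LinearMap.smul_apply]
    rw [form_eigenspace_eq_zero b T hT hs (Module.End.mem_eigenspace_iff.2 (hf s))
      (Module.End.mem_eigenspace_iff.2 (hf r)), smul_zero]
  · exact fun h => absurd hr h

/-- In an eigenvector expansion `b (T x) x` is a sum of terms `r |x_r|²` with `r ≥ 0`, so each one
vanishes. This upgrades `⟨π(β⁺)μ, μ⟩ = 0` to `π(β⁺)μ = 0`. -/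
theorem apply_eq_zero_of_form_apply_self_eq_zero (b : LinearMap.BilinForm ℝ U)
    (hp : ∀ x, x ≠ 0 → 0 < b x x) {T : Module.End ℝ U} (hT : ∀ x y, b (T x) y = b x (T y))
    {x : U} (hx : x ∈ Submodule.span ℝ {y | ∃ r : ℝ, 0 ≤ r ∧ T y = r • y})
    (h0 : b (T x) x = 0) : T x = 0 := by
  have hle : Submodule.span ℝ {y | ∃ r : ℝ, 0 ≤ r ∧ T y = r • y}
      ≤ ⨆ r ∈ Set.Ici (0 : ℝ), Module.End.eigenspace T r := by
    refine Submodule.span_le.2 ?_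
    rintro y ⟨r, hr, hy⟩
    exact Submodule.mem_iSup_of_mem r
      (Submodule.mem_iSup_of_mem hr (Module.End.mem_eigenspace_iff.2 hy))
  obtain ⟨t, f, ht, hf, rfl⟩ := exists_sum_of_mem_iSup_eigenspace (hle hx)
  rw [form_apply_self_of_sum b hT t f hf] at h0
  have hnn : ∀ z, 0 ≤ b z z := by
    intro z
    by_cases h : z = 0
    · simp [h]
    · exact (hp z h).le
  rw [Finset.sum_eq_zero_iff_of_nonneg fun r hr => mul_nonneg (ht r hr) (hnn _)] at h0
  rw [map_sum]
  refine Finset.sum_eq_zero fun r hr => ?_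
  rw [hf]
  by_contra hne
  have hr0 : r ≠ 0 := by
    rintro rfl
    simp at hne
  have hf0 : f r ≠ 0 := by
    intro h
    simp [h] at hne
  exact (mul_ne_zero hr0 (hp _ hf0).ne') (h0 r hr)

theorem form_apply_self_nonneg_of_mem (b : LinearMap.BilinForm ℝ U)
    (hp : ∀ x, x ≠ 0 → 0 < b x x) {T : Module.End ℝ U} (hT : ∀ x y, b (T x) y = b x (T y))
    {x : U} (hx : x ∈ ⨆ r ∈ Set.Ioi (0 : ℝ), Module.End.eigenspace T r) :
    0 ≤ b (T x) x ∧ (b (T x) x = 0 → x = 0) := by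
  obtain ⟨t, f, ht, hf, rfl⟩ := exists_sum_of_mem_iSup_eigenspace hx
  rw [form_apply_self_of_sum b hT t f hf]
  have hnn : ∀ z, 0 ≤ b z z := by
    intro z
    by_cases h : z = 0
    · simp [h]
    · exact (hp z h).le
  refine ⟨Finset.sum_nonneg fun r hr => mul_nonneg (le_of_lt (ht r hr)) (hnn _), fun h0 => ?_⟩
  rw [Finset.sum_eq_zero_iff_of_nonneg fun r hr => mul_nonneg (le_of_lt (ht r hr)) (hnn _)] at h0
  refine Finset.sum_eq_zero fun r hr => ?_
  by_contra hf0
  exact (mul_ne_zero (ne_of_gt (ht r hr)) (hp _ hf0).ne') (h0 r hr)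

end Forms

/-! ### Operators intertwined with a positive semidefinite symmetric operator -/

section Intertwined

variable {T : Type*} [AddCommGroup T] [Module ℝ T]

theorem exists_finset_of_intertwined_aux {W : Type*} [NormedAddCommGroup W]
    [InnerProductSpace ℝ W] [FiniteDimensional ℝ W] (M : Module.End ℝ W)
    (hM : M.IsSymmetric) (hpos : ∀ x, 0 ≤ ⟪M x, x⟫_ℝ) (L : Module.End ℝ T) (f : W →ₗ[ℝ] T)
    (hf : Function.Surjective f) (hL : ∀ x, L (f x) = -f (M x)) :
    (∀ x, L (f x) = 0 → ∃ y, M y = 0 ∧ f y = f x) ∧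
      ∃ t : Finset ℝ, (∀ r ∈ t, r ≤ 0) ∧
        Polynomial.aeval L (∏ r ∈ t, (Polynomial.X - Polynomial.C r)) = 0 := by
  classical
  constructor
  · intro x hx
    obtain ⟨k, hk, x', hx', rfl⟩ := (LinearMap.ker f).exists_add_mem_mem_orthogonal x
    have hMk : ∀ k ∈ LinearMap.ker f, M k ∈ LinearMap.ker f := by
      intro k hk
      have := hL k
      rw [LinearMap.mem_ker.1 hk, map_zero, eq_comm, neg_eq_zero] at this
      exact this
    refine ⟨x', ?_, ?_⟩
    -- `M` preserves `ker f`, hence by symmetry its orthogonal complement. Since `M x'` also lies in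
    -- `ker f`, it is zero.
    · have h1 : M x' ∈ (LinearMap.ker f)ᗮ := by
        intro u hu
        rw [← hM]
        exact hx' _ (hMk u hu)
      have h2 : M x' ∈ LinearMap.ker f := by
        have h3 : M (k + x') ∈ LinearMap.ker f := by
          have := hL (k + x')
          rw [hx, eq_comm, neg_eq_zero] at this
          exact this
        have := sub_mem h3 (hMk k hk)
        rwa [map_add, add_sub_cancel_left] at this
      exact inner_self_eq_zero.1 (h1 _ h2)
    · rw [map_add, LinearMap.mem_ker.1 hk, zero_add]
  · set e := hM.eigenvectorBasis rfl with he
    have hev : ∀ i, M (e i) = hM.eigenvalues rfl i • e i :=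
      fun i => hM.apply_eigenvectorBasis rfl i
    have hnn : ∀ i, 0 ≤ hM.eigenvalues rfl i := by
      intro i
      have := hpos (e i)
      rw [hev, real_inner_smul_left, real_inner_self_eq_norm_sq, e.norm_eq_one] at this
      simpa using this
    -- The images of an eigenbasis of `M` span `T` and consist of zero vectors or eigenvectors of
    -- `L` with the negated eigenvalues.
    refine ⟨Finset.univ.image fun i => -hM.eigenvalues rfl i, ?_, ?_⟩
    · intro r hr
      obtain ⟨i, -, rfl⟩ := Finset.mem_image.1 hr
      simpa using hnn i
    · have hzero : ∀ i, Polynomial.aeval L (∏ r ∈ Finset.univ.image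
          (fun i => -hM.eigenvalues rfl i), (Polynomial.X - Polynomial.C r)) (f (e i)) = 0 := by
        intro i
        rw [← Finset.prod_erase_mul _ _ (Finset.mem_image_of_mem
          (fun i => -hM.eigenvalues rfl i) (Finset.mem_univ i)), map_mul, Module.End.mul_apply]
        have : Polynomial.aeval L (Polynomial.X - Polynomial.C (-hM.eigenvalues rfl i))
            (f (e i)) = 0 := by
          simp [hL, hev, Module.algebraMap_end_apply]
        rw [this, map_zero]
      refine LinearMap.ext fun x => ?_
      obtain ⟨w, rfl⟩ := hf x
      rw [← e.sum_repr w]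
      simp only [map_sum, map_smul, hzero, smul_zero, Finset.sum_const_zero, LinearMap.zero_apply]

/-- A polynomial annihilating `L` also annihilates its complexification, so each complex eigenvalue
is one of its roots, all of which are real. -/
theorem eigenvalue_mem_of_aeval_eq_zero [FiniteDimensional ℝ T] (L : Module.End ℝ T)
    (t : Finset ℝ)
    (h : Polynomial.aeval L (∏ r ∈ t, (Polynomial.X - Polynomial.C r)) = 0) (z : ℂ)
    (hz : Module.End.HasEigenvalue (LinearMap.baseChange ℂ L) z) : ∃ r ∈ t, z = (r : ℂ) := by
  obtain ⟨v, hv⟩ := hz.exists_hasEigenvector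
  have h1 : Polynomial.aeval (LinearMap.baseChange ℂ L)
      (∏ r ∈ t, (Polynomial.X - Polynomial.C (r : ℂ))) = 0 := by
    have h2 := congrArg (Module.End.baseChangeHom ℝ ℂ T) h
    rw [map_zero] at h2
    rw [← h2]
    have h3 : ∏ r ∈ t, (Polynomial.X - Polynomial.C (r : ℂ))
        = (∏ r ∈ t, (Polynomial.X - Polynomial.C r)).map (algebraMap ℝ ℂ) := by
      simp [Polynomial.map_prod]
    rw [h3, Polynomial.aeval_map_algebraMap, ← Polynomial.aeval_algHom_apply]
    rfl
  have h3 := Module.End.aeval_apply_of_hasEigenvector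
    (p := ∏ r ∈ t, (Polynomial.X - Polynomial.C (r : ℂ))) hv
  rw [h1, LinearMap.zero_apply, eq_comm, smul_eq_zero] at h3
  have h4 := h3.resolve_right hv.2
  rw [Polynomial.eval_prod, Finset.prod_eq_zero_iff] at h4
  obtain ⟨r, hr, h5⟩ := h4
  exact ⟨r, hr, by simpa [sub_eq_zero] using h5⟩

/-- If `L f = -f M` with `f` surjective and `M` symmetric and positive semidefinite, then
`ker L = f (ker M)`, and the complex eigenvalues of `L` are real and non-positive. -/
theorem ker_and_eigenvalue_of_intertwined [FiniteDimensional ℝ T] {W : Type*} [AddCommGroup W]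
    [Module ℝ W] [FiniteDimensional ℝ W] (b : LinearMap.BilinForm ℝ W)
    (hs : ∀ x y, b x y = b y x) (hp : ∀ x, x ≠ 0 → 0 < b x x) (M : Module.End ℝ W)
    (hM : ∀ x y, b (M x) y = b x (M y)) (hpos : ∀ x, 0 ≤ b (M x) x) (L : Module.End ℝ T)
    (f : W →ₗ[ℝ] T) (hf : Function.Surjective f) (hL : ∀ x, L (f x) = -f (M x)) :
    (∀ x, L (f x) = 0 → ∃ y, M y = 0 ∧ f y = f x) ∧
      ∀ z : ℂ, Module.End.HasEigenvalue (LinearMap.baseChange ℂ L) z →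
        ∃ r : ℝ, r ≤ 0 ∧ z = (r : ℂ) := by
  let _ : NormedAddCommGroup W := (formCore b hs hp).toNormedAddCommGroup
  let _ : InnerProductSpace ℝ W := InnerProductSpace.ofCore (formCore b hs hp).toCore
  obtain ⟨h1, t, ht, h2⟩ := exists_finset_of_intertwined_aux M hM hpos L f hf hL
  refine ⟨h1, fun z hz => ?_⟩
  obtain ⟨r, hr, rfl⟩ := eigenvalue_mem_of_aeval_eq_zero L t h2 z hz
  exact ⟨r, ht r hr, rfl⟩

end Intertwined

section Products

variable {E : Type*} [NormedAddCommGroup E] [InnerProductSpace ℝ E] [FiniteDimensional ℝ E]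
variable {ι : Type*} [Fintype ι]

/-! ### Scalar products in arbitrary orthonormal bases -/

theorem adjoint_mul (A B : E →L[ℝ] E) : (A * B)ᵗ = Bᵗ * Aᵗ := ContinuousLinearMap.adjoint_comp A B

theorem tr_add (A B : E →L[ℝ] E) : tr (A + B) = tr A + tr B := by simp [tr]

theorem tr_sub (A B : E →L[ℝ] E) : tr (A - B) = tr A - tr B := by simp [tr]

theorem tr_neg (A : E →L[ℝ] E) : tr (-A) = -tr A := by simp [tr]

theorem tr_smul (c : ℝ) (A : E →L[ℝ] E) : tr (c • A) = c * tr A := by simp [tr]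

theorem tr_mul_comm (A B : E →L[ℝ] E) : tr (A * B) = tr (B * A) :=
  LinearMap.trace_mul_comm ℝ (A : E →ₗ[ℝ] E) (B : E →ₗ[ℝ] E)

theorem tr_eq_sum_basis (b : OrthonormalBasis ι ℝ E) (A : E →L[ℝ] E) :
    tr A = ∑ i, ⟪b i, A (b i)⟫_ℝ :=
  LinearMap.trace_eq_sum_inner _ b

theorem tr_adjoint (A : E →L[ℝ] E) : tr Aᵗ = tr A := by
  rw [tr_eq_sum, tr_eq_sum]
  refine Finset.sum_congr rfl fun i _ => ?_
  rw [ContinuousLinearMap.adjoint_inner_right, real_inner_comm]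

theorem glInner_eq_tr (A B : E →L[ℝ] E) : glInner A B = tr (Bᵗ * A) := tr_mul_comm _ _

theorem glInner_eq_sum (b : OrthonormalBasis ι ℝ E) (A B : E →L[ℝ] E) :
    glInner A B = ∑ i, ⟪A (b i), B (b i)⟫_ℝ := by
  rw [glInner_eq_tr, tr_eq_sum_basis b]
  refine Finset.sum_congr rfl fun i _ => ?_
  rw [mul_apply_eq_comp, ContinuousLinearMap.adjoint_inner_right, real_inner_comm]

theorem glInner_comm (A B : E →L[ℝ] E) : glInner A B = glInner B A := by
  simp only [glInner_eq_sum (stdOrthonormalBasis ℝ E), real_inner_comm]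

/-- The scalar product of `gl(E)` as a bilinear form. -/
noncomputable def glForm : LinearMap.BilinForm ℝ (E →L[ℝ] E) :=
  LinearMap.mk₂ ℝ glInner glInner_add_left glInner_smul_left
    (fun A B C => by rw [glInner_comm, glInner_add_left, glInner_comm B, glInner_comm C])
    (fun c A B => by rw [glInner_comm, glInner_smul_left, glInner_comm B, smul_eq_mul])

@[simp] theorem glForm_apply (A B : E →L[ℝ] E) : glForm A B = glInner A B := rfl

theorem glInner_add_right (A B C : E →L[ℝ] E) :
    glInner A (B + C) = glInner A B + glInner A C := map_add (glForm A) B C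

theorem glInner_sub_right (A B C : E →L[ℝ] E) :
    glInner A (B - C) = glInner A B - glInner A C := map_sub (glForm A) B C

theorem glInner_sub_left (A B C : E →L[ℝ] E) :
    glInner (A - B) C = glInner A C - glInner B C := LinearMap.map_sub₂ glForm A B C

theorem glInner_neg_left (A C : E →L[ℝ] E) : glInner (-A) C = -glInner A C :=
  LinearMap.map_neg₂ glForm A C

theorem glInner_neg_right (A C : E →L[ℝ] E) : glInner A (-C) = -glInner A C :=
  map_neg (glForm A) C

theorem glInner_smul_right (c : ℝ) (A C : E →L[ℝ] E) : glInner A (c • C) = c * glInner A C :=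
  map_smul (glForm A) c C

@[simp] theorem glInner_zero_left (C : E →L[ℝ] E) : glInner 0 C = 0 := LinearMap.map_zero₂ glForm C

@[simp] theorem glInner_zero_right (C : E →L[ℝ] E) : glInner C 0 = 0 := map_zero (glForm C)

theorem glInner_self_nonneg (A : E →L[ℝ] E) : 0 ≤ glInner A A := by
  rw [glInner_eq_sum (stdOrthonormalBasis ℝ E)]
  exact Finset.sum_nonneg fun i _ => real_inner_self_nonneg

theorem glInner_self_eq_zero {A : E →L[ℝ] E} (h : glInner A A = 0) : A = 0 := by
  rw [glInner_eq_sum (stdOrthonormalBasis ℝ E),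
    Finset.sum_eq_zero_iff_of_nonneg fun i _ => real_inner_self_nonneg] at h
  have h1 : ∀ i, A (stdOrthonormalBasis ℝ E i) = 0 := fun i =>
    inner_self_eq_zero.1 (h i (Finset.mem_univ i))
  ext x
  rw [← (stdOrthonormalBasis ℝ E).sum_repr x]
  simp [h1]

theorem glForm_pos (A : E →L[ℝ] E) (h : A ≠ 0) : 0 < glForm A A :=
  lt_of_le_of_ne (glInner_self_nonneg A) fun h' => h (glInner_self_eq_zero h'.symm)

theorem glInner_adjoint (A B : E →L[ℝ] E) : glInner Aᵗ Bᵗ = glInner A B := by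
  rw [glInner_eq_tr, glInner_comm, glInner, ContinuousLinearMap.adjoint_adjoint]

theorem glInner_mul_left (A B C : E →L[ℝ] E) : glInner (A * B) C = glInner B (Aᵗ * C) := by
  rw [glInner_eq_tr, glInner_eq_tr, adjoint_mul, ContinuousLinearMap.adjoint_adjoint, mul_assoc]

theorem glInner_mul_right (A B C : E →L[ℝ] E) : glInner (A * B) C = glInner A (C * Bᵗ) := by
  rw [glInner, glInner, adjoint_mul, ContinuousLinearMap.adjoint_adjoint, mul_assoc]

theorem glInner_one_right (A : E →L[ℝ] E) : glInner A 1 = tr A := by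
  rw [glInner, ← ContinuousLinearMap.star_eq_adjoint, star_one, mul_one]

/-- The scalar products are defined through a fixed basis; this independence allows computing them
in bases adapted to `n ⊕ nᗮ`. -/
theorem sum_basis_eq {κ : Type*} [Fintype κ] (b : OrthonormalBasis ι ℝ E)
    (c : OrthonormalBasis κ ℝ E) (q : E →ₗ[ℝ] E →ₗ[ℝ] ℝ) :
    ∑ i, q (b i) (b i) = ∑ j, q (c j) (c j) := by
  have h : ∀ i, q (b i) (b i) = ∑ j, ∑ k, ⟪c j, b i⟫_ℝ * ⟪b i, c k⟫_ℝ * q (c j) (c k) := by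
    intro i
    conv_lhs => rw [← c.sum_repr' (b i)]
    simp only [map_sum, LinearMap.sum_apply, map_smul, LinearMap.smul_apply, smul_eq_mul]
    rw [Finset.sum_comm]
    refine Finset.sum_congr rfl fun j _ => ?_
    rw [Finset.mul_sum]
    refine Finset.sum_congr rfl fun k _ => ?_
    rw [real_inner_comm (b i) (c j)]
    ring
  simp only [h]
  rw [Finset.sum_comm]
  refine Finset.sum_congr rfl fun j _ => ?_
  rw [Finset.sum_comm]
  classical
  rw [Finset.sum_eq_single j]
  · rw [← Finset.sum_mul, b.sum_inner_mul_inner, real_inner_self_eq_norm_sq, c.norm_eq_one]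
    simp
  · intro k _ hk
    rw [← Finset.sum_mul, b.sum_inner_mul_inner, c.inner_eq_zero (Ne.symm hk), zero_mul]
  · exact fun h => absurd (Finset.mem_univ j) h

theorem bracketInner_eq_sum_gl (b : OrthonormalBasis ι ℝ E) (μ ν : BracketSpace E) :
    bracketInner μ ν = ∑ i, glInner (ad μ (b i)) (ad ν (b i)) := by
  have h := sum_basis_eq b (stdOrthonormalBasis ℝ E)
    (LinearMap.compl₁₂ (glForm (E := E)) (μ.1 : E →ₗ[ℝ] E →L[ℝ] E) (ν.1 : E →ₗ[ℝ] E →L[ℝ] E))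
  simp only [LinearMap.compl₁₂_apply, ContinuousLinearMap.coe_coe, glForm_apply] at h
  rw [h]
  exact Finset.sum_congr rfl fun i _ => (glInner_eq_sum _ _ _).symm

theorem bracketInner_eq_sum (b : OrthonormalBasis ι ℝ E) (μ ν : BracketSpace E) :
    bracketInner μ ν = ∑ i, ∑ j, ⟪μ.1 (b i) (b j), ν.1 (b i) (b j)⟫_ℝ := by
  rw [bracketInner_eq_sum_gl b]
  exact Finset.sum_congr rfl fun i _ => glInner_eq_sum b _ _

theorem bracketInner_comm (μ ν : BracketSpace E) : bracketInner μ ν = bracketInner ν μ := by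
  simp only [bracketInner, real_inner_comm]

/-- The scalar product of `V(E)` as a bilinear form. -/
noncomputable def bracketForm : LinearMap.BilinForm ℝ (BracketSpace E) :=
  LinearMap.mk₂ ℝ bracketInner
    (fun μ ν ρ => by simp [bracketInner, inner_add_left, Finset.sum_add_distrib])
    (fun c μ ν => by simp [bracketInner, inner_smul_left, Finset.mul_sum])
    (fun μ ν ρ => by simp [bracketInner, inner_add_right, Finset.sum_add_distrib])
    (fun c μ ν => by simp [bracketInner, inner_smul_right, Finset.mul_sum])

@[simp] theorem bracketForm_apply (μ ν : BracketSpace E) :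
    bracketForm μ ν = bracketInner μ ν := rfl

theorem bracketInner_sub_left (μ ν ρ : BracketSpace E) :
    bracketInner (μ - ν) ρ = bracketInner μ ρ - bracketInner ν ρ :=
  LinearMap.map_sub₂ bracketForm μ ν ρ

theorem bracketInner_add_left (μ ν ρ : BracketSpace E) :
    bracketInner (μ + ν) ρ = bracketInner μ ρ + bracketInner ν ρ :=
  LinearMap.map_add₂ bracketForm μ ν ρ

theorem bracketInner_add_right (μ ν ρ : BracketSpace E) :
    bracketInner μ (ν + ρ) = bracketInner μ ν + bracketInner μ ρ :=
  map_add (bracketForm μ) ν ρ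

theorem bracketInner_neg_left (μ ν : BracketSpace E) : bracketInner (-μ) ν = -bracketInner μ ν :=
  LinearMap.map_neg₂ bracketForm μ ν

theorem bracketInner_neg_right (μ ν : BracketSpace E) : bracketInner μ (-ν) = -bracketInner μ ν :=
  map_neg (bracketForm μ) ν

theorem bracketInner_smul_left (c : ℝ) (μ ν : BracketSpace E) :
    bracketInner (c • μ) ν = c * bracketInner μ ν :=
  LinearMap.map_smul₂ bracketForm c μ ν

theorem bracketInner_smul_right (c : ℝ) (μ ν : BracketSpace E) :
    bracketInner μ (c • ν) = c * bracketInner μ ν :=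
  map_smul (bracketForm μ) c ν

@[simp] theorem bracketInner_zero_left (μ : BracketSpace E) : bracketInner 0 μ = 0 :=
  LinearMap.map_zero₂ bracketForm μ

theorem bracketInner_self_nonneg (μ : BracketSpace E) : 0 ≤ bracketInner μ μ := by
  rw [bracketInner_eq_sum_gl (stdOrthonormalBasis ℝ E)]
  exact Finset.sum_nonneg fun i _ => glInner_self_nonneg _

theorem bracketInner_self_eq_zero {μ : BracketSpace E} (h : bracketInner μ μ = 0) : μ = 0 := by
  rw [bracketInner_eq_sum_gl (stdOrthonormalBasis ℝ E),
    Finset.sum_eq_zero_iff_of_nonneg fun i _ => glInner_self_nonneg _] at h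
  have h1 : ∀ i, μ.1 (stdOrthonormalBasis ℝ E i) = 0 := fun i =>
    glInner_self_eq_zero (h i (Finset.mem_univ i))
  ext x : 2
  rw [← (stdOrthonormalBasis ℝ E).sum_repr x]
  simp [h1]

theorem bracketForm_pos (μ : BracketSpace E) (h : μ ≠ 0) : 0 < bracketForm μ μ :=
  lt_of_le_of_ne (bracketInner_self_nonneg μ) fun h' => h (bracketInner_self_eq_zero h'.symm)

/-! ### The representation `π` -/

theorem ad_rep (A : E →L[ℝ] E) (μ : BracketSpace E) (x : E) :
    ad (rep A μ) x = A * ad μ x - ad μ (A x) - ad μ x * A := rfl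

theorem rep_one (μ : BracketSpace E) : rep (1 : E →L[ℝ] E) μ = -μ := by
  ext x y
  simp

theorem rep_commutator (A C : E →L[ℝ] E) (μ : BracketSpace E) :
    rep (A * C - C * A) μ = rep A (rep C μ) - rep C (rep A μ) := by
  ext x y
  simp
  abel

theorem bracketInner_rep_left (A : E →L[ℝ] E) (μ ν : BracketSpace E) :
    bracketInner (rep A μ) ν = bracketInner μ (rep Aᵗ ν) := by
  set b := stdOrthonormalBasis ℝ E with hb
  have h : ∀ (A : E →L[ℝ] E) (μ ν : BracketSpace E),
      ∑ i, glInner (ad μ (A (b i))) (ad ν (b i)) = ∑ i, glInner (ad μ (b i)) (ad ν (Aᵗ (b i))) := by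
    intro A μ ν
    have h1 : ∀ i, glInner (ad μ (A (b i))) (ad ν (b i))
        = ∑ j, ⟪b j, A (b i)⟫_ℝ * glInner (ad μ (b j)) (ad ν (b i)) := by
      intro i
      conv_lhs => rw [← b.sum_repr' (A (b i))]
      simp only [← glForm_apply, map_sum, map_smul, LinearMap.sum_apply, LinearMap.smul_apply,
        smul_eq_mul]
    have h2 : ∀ i, glInner (ad μ (b i)) (ad ν (Aᵗ (b i)))
        = ∑ j, ⟪b j, Aᵗ (b i)⟫_ℝ * glInner (ad μ (b i)) (ad ν (b j)) := by
      intro i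
      conv_lhs => rw [← b.sum_repr' (Aᵗ (b i))]
      simp only [← glForm_apply, map_sum, map_smul, smul_eq_mul]
    simp only [h1, h2]
    rw [Finset.sum_comm]
    refine Finset.sum_congr rfl fun i _ => Finset.sum_congr rfl fun j _ => ?_
    rw [ContinuousLinearMap.adjoint_inner_right, real_inner_comm]
  simp only [bracketInner_eq_sum_gl b, ad_rep, glInner_sub_left, glInner_sub_right,
    Finset.sum_sub_distrib, h]
  congr 1
  · congr 1
    exact Finset.sum_congr rfl fun i _ => glInner_mul_left _ _ _
  · exact Finset.sum_congr rfl fun i _ => glInner_mul_right _ _ _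

/-- `π` is a Lie algebra representation and turns transposes into adjoints. Curvature, being dual to
`⟨π(·)μ, μ⟩`, is compared with norms of `π(A)μ` and `π(Aᵗ)μ` through this identity. -/
theorem bracketInner_rep_commutator_adjoint (A : E →L[ℝ] E) (μ : BracketSpace E) :
    bracketInner (rep (A * Aᵗ - Aᵗ * A) μ) μ =
      bracketInner (rep Aᵗ μ) (rep Aᵗ μ) - bracketInner (rep A μ) (rep A μ) := by
  rw [rep_commutator]
  rw [bracketInner_sub_left, bracketInner_rep_left A, bracketInner_rep_left Aᵗ (rep A μ), ContinuousLinearMap.adjoint_adjoint]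

/-! ### Curvature -/

theorem momentPart_eq (μ : BracketSpace E) : momentPart μ = (1 / 4 : ℝ) • momentForm μ := by
  rw [momentPart, momentMap, smul_smul]
  by_cases h : bracketInner μ μ = 0
  · rw [h, bracketInner_self_eq_zero h]
    have : momentForm (0 : BracketSpace E) = 0 := by
      have h0 : ∀ x, ad (0 : BracketSpace E) x = 0 := fun _ => rfl
      simp [momentForm, h0]
    rw [this, smul_zero, smul_zero]
  · rw [mul_assoc, mul_inv_cancel₀ h, mul_one]

theorem glInner_momentPart (μ : BracketSpace E) (A : E →L[ℝ] E) :
    glInner (momentPart μ) A = 1 / 4 * bracketInner (rep A μ) μ := by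
  rw [momentPart_eq, glInner_smul_left, glInner_momentForm]

theorem adjoint_momentPart (μ : BracketSpace E) : (momentPart μ)ᵗ = momentPart μ := by
  rw [momentPart_eq, map_smulₛₗ]
  congr 1
  exact isSelfAdjoint_momentForm μ

/-- Obtained by testing the moment map against the rank-one endomorphism `x ⊗ x`. -/
theorem inner_momentPart (b : OrthonormalBasis ι ℝ E) (μ : BracketSpace E) (x : E) :
    ⟪momentPart μ x, x⟫_ℝ = 1 / 4 * (∑ i, ∑ j, ⟪μ.1 (b i) (b j), x⟫_ℝ ^ 2)
      - 1 / 2 * glInner (ad μ x) (ad μ x) := by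
  have h1 := glInner_momentPart μ (InnerProductSpace.rankOne ℝ x x)
  have h2 : glInner (momentPart μ) (InnerProductSpace.rankOne ℝ x x) = ⟪momentPart μ x, x⟫_ℝ := by
    rw [glInner_eq_sum b]
    simp only [InnerProductSpace.rankOne_apply, real_inner_smul_right]
    have : ∀ i, ⟪x, b i⟫_ℝ * ⟪momentPart μ (b i), x⟫_ℝ
        = ⟪x, b i⟫_ℝ * ⟪b i, momentPart μ x⟫_ℝ := by
      intro i
      conv_rhs => rw [← adjoint_momentPart, ContinuousLinearMap.adjoint_inner_right]
    simp only [this, b.sum_inner_mul_inner]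
    rw [real_inner_comm]
  have h3 : bracketInner (rep (InnerProductSpace.rankOne ℝ x x) μ) μ
      = ∑ i, ∑ j, ⟪μ.1 (b i) (b j), x⟫_ℝ ^ 2 - 2 * glInner (ad μ x) (ad μ x) := by
    have e1 : ∑ i, ∑ j, ⟪x, b i⟫_ℝ * ⟪μ.1 x (b j), μ.1 (b i) (b j)⟫_ℝ
        = glInner (ad μ x) (ad μ x) := by
      rw [glInner_eq_sum b, Finset.sum_comm]
      refine Finset.sum_congr rfl fun j _ => ?_
      have : μ.1 x (b j) = ∑ i, ⟪x, b i⟫_ℝ • μ.1 (b i) (b j) := by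
        conv_lhs => rw [← b.sum_repr' x]
        simp only [map_sum, sum_apply, map_smul, smul_apply, real_inner_comm]
      simp only [← real_inner_smul_right, ← inner_sum, ← this]
    have e2 : ∑ i, ∑ j, ⟪x, b j⟫_ℝ * ⟪μ.1 (b i) x, μ.1 (b i) (b j)⟫_ℝ
        = glInner (ad μ x) (ad μ x) := by
      rw [← e1, Finset.sum_comm]
      refine Finset.sum_congr rfl fun i _ => Finset.sum_congr rfl fun j _ => ?_
      rw [bracket_skew μ (b j) x, bracket_skew μ (b j) (b i), inner_neg_neg]
    rw [bracketInner_eq_sum b]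
    simp only [rep_apply, InnerProductSpace.rankOne_apply, inner_sub_left, map_smul, smul_apply,
      real_inner_smul_left, Finset.sum_sub_distrib, e1, e2]
    have : ∀ i j, ⟪x, μ.1 (b i) (b j)⟫_ℝ * ⟪x, μ.1 (b i) (b j)⟫_ℝ
        = ⟪μ.1 (b i) (b j), x⟫_ℝ ^ 2 := by
      intro i j
      rw [real_inner_comm, sq]
    simp only [this]
    ring
  rw [h2, h3] at h1
  rw [h1]
  ring

theorem adjoint_killing (μ : BracketSpace E) : (killing μ)ᵗ = killing μ := by
  symm
  rw [ContinuousLinearMap.eq_adjoint_iff]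
  intro x y
  rw [inner_killing, real_inner_comm, inner_killing, tr_mul_comm]

theorem isDerivation_iff {μ : BracketSpace E} {D : E →L[ℝ] E} :
    IsDerivation μ D ↔ rep D μ = 0 := by
  constructor
  · intro h
    ext x y
    simp [h x y]
  · intro h x y
    have : (rep D μ).1 x y = 0 := by rw [h]; rfl
    rw [rep_apply, sub_sub, sub_eq_zero] at this
    exact this

theorem IsDerivation.ad_apply {μ : BracketSpace E} {D : E →L[ℝ] E} (h : IsDerivation μ D)
    (x : E) : ad μ (D x) = D * ad μ x - ad μ x * D := by
  ext y
  simp [h x y]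

theorem isDerivation_ad {μ : BracketSpace E} (h : IsLie μ) (x : E) : IsDerivation μ (ad μ x) :=
  fun y z => h x y z

/-- The infinitesimal invariance of the Killing form, since `ad (D x) = [D, ad x]` and the trace is
cyclic. -/
theorem killing_mul_derivation {μ : BracketSpace E} {D : E →L[ℝ] E} (h : IsDerivation μ D) :
    killing μ * D = -(Dᵗ * killing μ) := by
  ext x
  refine ext_inner_right ℝ fun y => ?_
  simp only [mul_apply_eq_comp, neg_apply, inner_neg_left,
    ContinuousLinearMap.adjoint_inner_left, inner_killing, h.ad_apply]
  simp only [sub_mul, mul_sub, tr_sub]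
  rw [mul_assoc, tr_mul_comm D, mul_assoc, mul_assoc]
  ring

theorem glInner_killing_derivation {μ : BracketSpace E} {D : E →L[ℝ] E} (h : IsDerivation μ D) :
    glInner (killing μ) D = 0 := by
  have h1 := congrArg tr (killing_mul_derivation h)
  have h2 : tr (killing μ * D) = glInner (killing μ) D := by
    rw [← tr_adjoint, adjoint_mul, adjoint_killing, tr_mul_comm, glInner]
  have h3 : tr (Dᵗ * killing μ) = glInner (killing μ) D := (glInner_eq_tr _ _).symm
  rw [tr_neg, h2, h3] at h1
  linarith

end Products

/-! ### Solvable Lie algebras of endomorphisms -/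

section Solvable

open TensorProduct

attribute [local instance 100] LieRing.ofAssociativeRing

/-- A real module of a solvable Lie algebra contains a non-zero vector annihilated by the
derived algebra. -/
theorem exists_ne_zero_lie_lie_eq_zero (L V : Type*) [LieRing L] [LieAlgebra ℝ L]
    [LieAlgebra.IsSolvable L] [AddCommGroup V] [Module ℝ V] [LieRingModule L V] [LieModule ℝ L V]
    [FiniteDimensional ℝ V] [Nontrivial V] : ∃ v : V, v ≠ 0 ∧ ∀ x y : L, ⁅⁅x, y⁆, v⁆ = 0 := by
  obtain ⟨χ, hχ⟩ := LieModule.exists_nontrivial_weightSpace_of_isSolvable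
    (k := ℂ) (L := ℂ ⊗[ℝ] L) (V := ℂ ⊗[ℝ] V)
  obtain ⟨⟨w, hw⟩, hw0⟩ := exists_ne (0 : LieModule.weightSpace (ℂ ⊗[ℝ] V) χ)
  have hw0' : w ≠ 0 := fun h => hw0 (Subtype.ext h)
  rw [LieModule.mem_weightSpace] at hw
  have hkill : ∀ x y : L, ⁅(1 : ℂ) ⊗ₜ[ℝ] ⁅x, y⁆, w⁆ = 0 := by
    intro x y
    have h1 : (1 : ℂ) ⊗ₜ[ℝ] ⁅x, y⁆ = ⁅(1 : ℂ) ⊗ₜ[ℝ] x, (1 : ℂ) ⊗ₜ[ℝ] y⁆ := by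
      rw [LieAlgebra.ExtendScalars.bracket_tmul, one_mul]
    rw [h1, lie_lie, hw (1 ⊗ₜ[ℝ] y), hw (1 ⊗ₜ[ℝ] x), lie_smul, lie_smul, hw (1 ⊗ₜ[ℝ] y),
      hw (1 ⊗ₜ[ℝ] x), smul_smul, smul_smul, mul_comm, sub_self]
  -- Applying a real functional to the complex factor commutes with `L`, so the real and imaginary
  -- parts of the weight vector are also killed by the derived algebra. At least one of them is
  -- non-zero.
  let F : (ℂ →ₗ[ℝ] ℝ) → (ℂ ⊗[ℝ] V →ₗ[ℝ] V) := fun f =>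
    (TensorProduct.lid ℝ V).toLinearMap ∘ₗ LinearMap.rTensor V f
  have hF : ∀ f z v, F f (z ⊗ₜ v) = f z • v := fun f z v => by simp [F]
  have hcomm : ∀ f (x : L) u, F f ⁅(1 : ℂ) ⊗ₜ[ℝ] x, u⁆ = ⁅x, F f u⁆ := by
    intro f x u
    induction u with
    | zero =>
      have h0 : ⁅(1 : ℂ) ⊗ₜ[ℝ] x, (0 : ℂ ⊗[ℝ] V)⁆ = 0 :=
        lie_zero (L := ℂ ⊗[ℝ] L) (M := ℂ ⊗[ℝ] V) _
      rw [h0, map_zero, lie_zero]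
    | tmul z v => rw [LieAlgebra.ExtendScalars.bracket_tmul, one_mul, hF, hF, lie_smul]
    | add a b ha hb =>
      have h0 : ⁅(1 : ℂ) ⊗ₜ[ℝ] x, a + b⁆ = ⁅(1 : ℂ) ⊗ₜ[ℝ] x, a⁆ + ⁅(1 : ℂ) ⊗ₜ[ℝ] x, b⁆ :=
        lie_add (L := ℂ ⊗[ℝ] L) (M := ℂ ⊗[ℝ] V) _ _ _
      rw [h0, map_add, ha, hb, map_add, lie_add]
  have hsum : ∀ u : ℂ ⊗[ℝ] V, u = (1 : ℂ) ⊗ₜ F Complex.reLm u + Complex.I ⊗ₜ F Complex.imLm u := by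
    intro u
    induction u with
    | zero => simp
    | tmul z v =>
      rw [hF, hF, ← TensorProduct.smul_tmul, ← TensorProduct.smul_tmul, ← TensorProduct.add_tmul]
      congr 1
      simpa [mul_comm] using (Complex.re_add_im z).symm
    | add a b ha hb =>
      conv_lhs => rw [ha, hb]
      rw [map_add, map_add, TensorProduct.tmul_add, TensorProduct.tmul_add]
      abel
  have hk : ∀ f (x y : L), ⁅⁅x, y⁆, F f w⁆ = 0 := fun f x y => by
    rw [← hcomm, hkill, map_zero]
  by_cases h : F Complex.reLm w = 0
  · refine ⟨F Complex.imLm w, fun h' => hw0' ?_, hk _⟩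
    rw [hsum w, h, h', TensorProduct.tmul_zero, TensorProduct.tmul_zero, add_zero]
  · exact ⟨_, h, hk _⟩

/-- A module of a solvable Lie algebra has a flag of submodules whose quotients are annihilated by
the derived algebra. -/
theorem exists_flag_of_isSolvable (L V : Type*) [LieRing L] [LieAlgebra ℝ L]
    [LieAlgebra.IsSolvable L] [AddCommGroup V] [Module ℝ V] [LieRingModule L V] [LieModule ℝ L V]
    [FiniteDimensional ℝ V] : ∃ (F : ℕ → LieSubmodule ℝ L V) (N : ℕ), F 0 = ⊥ ∧ F N = ⊤ ∧
      ∀ i, ∀ v ∈ F (i + 1), ∀ x y : L, ⁅⁅x, y⁆, v⁆ ∈ F i := by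
  -- The preimage of the vectors of `V ⧸ N` annihilated by brackets; the previous result applied to
  -- `V ⧸ N` makes it strictly larger than `N`.
  let step : LieSubmodule ℝ L V → LieSubmodule ℝ L V := fun N =>
    { carrier := {v | ∀ x y : L, ⁅⁅x, y⁆, v⁆ ∈ N}
      add_mem' := fun {a b} ha hb x y => by rw [lie_add]; exact add_mem (ha x y) (hb x y)
      zero_mem' := fun x y => by rw [lie_zero]; exact zero_mem _
      smul_mem' := fun c a ha x y => by rw [lie_smul]; exact N.smul_mem c (ha x y)
      lie_mem := fun {z v} hv x y => by
        rw [leibniz_lie]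
        exact add_mem (hv ⁅x, y⁆ z) (N.lie_mem (hv x y)) }
  have hstep : ∀ N v, v ∈ step N ↔ ∀ x y : L, ⁅⁅x, y⁆, v⁆ ∈ N := fun _ _ => Iff.rfl
  have hle : ∀ N, N ≤ step N := fun N v hv x y => N.lie_mem hv
  have hlt : ∀ N, N ≠ ⊤ → N < step N := by
    intro N hN
    refine lt_of_le_of_ne (hle N) fun heq => ?_
    have hnt : Nontrivial (V ⧸ N) := by
      refine Submodule.Quotient.nontrivial_iff.2 fun h => hN ?_
      exact (LieSubmodule.toSubmodule_eq_top _).1 h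
    have : FiniteDimensional ℝ (V ⧸ N) := inferInstanceAs (FiniteDimensional ℝ (V ⧸ N.toSubmodule))
    obtain ⟨v, hv, hk⟩ := exists_ne_zero_lie_lie_eq_zero L (V ⧸ N)
    obtain ⟨u, rfl⟩ := LieSubmodule.Quotient.surjective_mk' N v
    refine hv ((LieSubmodule.Quotient.mk_eq_zero _).2 ?_)
    rw [heq, hstep]
    intro x y
    have h1 := hk x y
    rw [← LieModuleHom.map_lie] at h1
    exact (LieSubmodule.Quotient.mk_eq_zero _).1 h1
  -- Each step raises the dimension by at least one until the top is reached, so `finrank` many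
  -- steps suffice.
  refine ⟨fun i => step^[i] ⊥, Module.finrank ℝ V, rfl, ?_, fun i v hv => ?_⟩
  · have hdim : ∀ i, step^[i] ⊥ = ⊤ ∨ i ≤ Module.finrank ℝ (step^[i] ⊥ : LieSubmodule ℝ L V) := by
      intro i
      induction i with
      | zero => exact Or.inr (Nat.zero_le _)
      | succ i ih =>
        rw [Function.iterate_succ_apply']
        by_cases h : step^[i] ⊥ = ⊤
        · exact Or.inl (top_le_iff.1 (h ▸ hle _))
        · refine Or.inr ?_
          have h1 := ih.resolve_left h
          have h2 : Module.finrank ℝ (step^[i] ⊥ : LieSubmodule ℝ L V).toSubmodule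
              < Module.finrank ℝ (step (step^[i] ⊥)).toSubmodule :=
            Submodule.finrank_lt_finrank_of_lt (hlt _ h)
          exact Nat.succ_le_of_lt (lt_of_le_of_lt h1 h2)
    rcases hdim (Module.finrank ℝ V) with h | h
    · exact h
    · refine (LieSubmodule.toSubmodule_eq_top _).1 (Submodule.eq_top_of_finrank_eq ?_)
      exact le_antisymm (Submodule.finrank_le _) h
  · have h : v ∈ step (step^[i] ⊥) := by
      rw [← Function.iterate_succ_apply' step]
      exact hv
    exact h

/-- An ideal with solvable bracket containing the derived algebra forces solvability. -/
theorem isSolvable_of_lie_top_le {L : Type*} [LieRing L] [LieAlgebra ℝ L] (I : LieIdeal ℝ L)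
    [LieAlgebra.IsSolvable I] (h : ⁅(⊤ : LieIdeal ℝ L), (⊤ : LieIdeal ℝ L)⁆ ≤ I) :
    LieAlgebra.IsSolvable L := by
  obtain ⟨k, hk⟩ := LieAlgebra.IsSolvable.solvable ℝ I
  refine LieAlgebra.IsSolvable.mk (R := ℝ) (k := k + 1) ?_
  rw [LieAlgebra.derivedSeries_def, LieAlgebra.derivedSeriesOfIdeal_add]
  have h1 := (LieIdeal.derivedSeries_eq_bot_iff I k).1 hk
  refine le_bot_iff.1 ?_
  rw [← h1]
  exact LieAlgebra.derivedSeriesOfIdeal_mono (by simpa using h) k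

/-- For a solvable Lie algebra `L` with a derivation `D` there is a flag of subspaces invariant
under `ad L`, such that the elements of `[L, L] + D L` shift the flag. -/
theorem exists_flag_of_derivation {L : Type*} [LieRing L] [LieAlgebra ℝ L]
    [LieAlgebra.IsSolvable L] [FiniteDimensional ℝ L] (D : LieDerivation ℝ L L) :
    ∃ (F : ℕ → Submodule ℝ L) (N : ℕ), F 0 = ⊥ ∧ F N = ⊤ ∧
      (∀ i, ∀ x : L, ∀ v ∈ F i, ⁅x, v⁆ ∈ F i) ∧
      (∀ i, ∀ x y : L, ∀ v ∈ F (i + 1), ⁅⁅x, y⁆, v⁆ ∈ F i) ∧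
      (∀ i, ∀ x : L, ∀ v ∈ F (i + 1), ⁅D x, v⁆ ∈ F i) := by
  let R : Submodule ℝ (Module.End ℝ L) :=
    LinearMap.range (LieAlgebra.ad ℝ L : L →ₗ[ℝ] Module.End ℝ L)
  have hlie : ∀ (x y : L) (c d : ℝ), ⁅LieAlgebra.ad ℝ L x + c • (D : Module.End ℝ L),
      LieAlgebra.ad ℝ L y + d • (D : Module.End ℝ L)⁆
        = LieAlgebra.ad ℝ L (⁅x, y⁆ + c • D y - d • D x) := by
    intro x y c d
    ext z
    simp only [LieRing.of_associative_ring_bracket, LinearMap.sub_apply, Module.End.mul_apply,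
      LinearMap.add_apply, LinearMap.smul_apply, LieAlgebra.ad_apply, LieDerivation.coeFn_coe,
      map_add, map_smul, sub_lie, add_lie, smul_lie, LieDerivation.apply_lie_eq_add,
      lie_lie, smul_add]
    module
  -- In `ad L + ℝ D` all commutators lie in the solvable ideal `ad L`, so this algebra is solvable
  -- too. As `[D, ad x] = ad (D x)`, its flag is shifted by `D L` as well as by `[L, L]`.
  let g : LieSubalgebra ℝ (Module.End ℝ L) :=
    { R ⊔ Submodule.span ℝ {(D : Module.End ℝ L)} with
      lie_mem' := by
        intro a b ha hb
        obtain ⟨_, ⟨x, rfl⟩, _, hc, rfl⟩ := Submodule.mem_sup.1 ha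
        obtain ⟨c, rfl⟩ := Submodule.mem_span_singleton.1 hc
        obtain ⟨_, ⟨y, rfl⟩, _, hd, rfl⟩ := Submodule.mem_sup.1 hb
        obtain ⟨d, rfl⟩ := Submodule.mem_span_singleton.1 hd
        exact Submodule.mem_sup_left ⟨_, (hlie x y c d).symm⟩ }
  have hg : ∀ a : g, ∃ (x : L) (c : ℝ), (a : Module.End ℝ L)
      = LieAlgebra.ad ℝ L x + c • (D : Module.End ℝ L) := by
    intro a
    obtain ⟨_, ⟨x, rfl⟩, _, hc, h⟩ := Submodule.mem_sup.1 a.2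
    obtain ⟨c, rfl⟩ := Submodule.mem_span_singleton.1 hc
    exact ⟨x, c, h.symm⟩
  have hadg : ∀ x, LieAlgebra.ad ℝ L x ∈ g := fun x => Submodule.mem_sup_left ⟨x, rfl⟩
  have hDg : (D : Module.End ℝ L) ∈ g :=
    Submodule.mem_sup_right (Submodule.mem_span_singleton_self _)
  have hlieg : ∀ a b : g, ∃ x, ((⁅a, b⁆ : g) : Module.End ℝ L) = LieAlgebra.ad ℝ L x := by
    intro a b
    obtain ⟨x, c, ha⟩ := hg a
    obtain ⟨y, d, hb⟩ := hg b
    exact ⟨_, by rw [LieSubalgebra.coe_bracket, ha, hb, hlie]⟩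
  let I : LieIdeal ℝ g :=
    { R.comap g.toSubmodule.subtype with
      lie_mem := by
        intro a b _
        obtain ⟨x, hx⟩ := hlieg a b
        exact ⟨x, hx.symm⟩ }
  have hI : LieAlgebra.IsSolvable I := by
    let f : L →ₗ⁅ℝ⁆ I :=
      { toFun := fun x => ⟨⟨LieAlgebra.ad ℝ L x, hadg x⟩, ⟨x, rfl⟩⟩
        map_add' := fun x y => by
          refine Subtype.ext (Subtype.ext ?_)
          exact map_add (LieAlgebra.ad ℝ L) x y
        map_smul' := fun c x => by
          refine Subtype.ext (Subtype.ext ?_)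
          exact map_smul (LieAlgebra.ad ℝ L) c x
        map_lie' := fun {x y} => by
          refine Subtype.ext (Subtype.ext ?_)
          exact LieHom.map_lie (LieAlgebra.ad ℝ L) x y }
    refine Function.Surjective.lieAlgebra_isSolvable (f := f) ?_
    rintro ⟨⟨a, ha⟩, x, hx⟩
    exact ⟨x, Subtype.ext (Subtype.ext hx)⟩
  have hsolv : LieAlgebra.IsSolvable g := by
    refine isSolvable_of_lie_top_le I ?_
    rw [LieSubmodule.lieIdeal_oper_eq_span, LieSubmodule.lieSpan_le]
    rintro _ ⟨a, b, rfl⟩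
    obtain ⟨x, hx⟩ := hlieg a b
    exact ⟨x, hx.symm⟩
  obtain ⟨F, N, h0, hN, hF⟩ := exists_flag_of_isSolvable g L
  refine ⟨fun i => (F i).toSubmodule, N, by simp [h0], by simp [hN], ?_, ?_, ?_⟩
  · intro i x v hv
    exact (F i).lie_mem (x := (⟨_, hadg x⟩ : g)) hv
  · intro i x y v hv
    have h := hF i v hv ⟨_, hadg x⟩ ⟨_, hadg y⟩
    have e : ⁅x, ⁅y, v⁆⁆ - ⁅y, ⁅x, v⁆⁆ ∈ F i := h
    rwa [← lie_lie] at e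
  · intro i x v hv
    have h := hF i v hv ⟨_, hDg⟩ ⟨_, hadg x⟩
    have e : D ⁅x, v⁆ - ⁅x, D v⁆ ∈ F i := h
    rwa [LieDerivation.apply_lie_eq_add, add_sub_cancel_left] at e

end Solvable

/-! ### Solvsolitons: the nilpotent ideal -/

section Structure

variable {E : Type*} [NormedAddCommGroup E] [InnerProductSpace ℝ E] [FiniteDimensional ℝ E]

theorem IsStratumLabel.adjoint_eq {β : E →L[ℝ] E} (h : IsStratumLabel β) : βᵗ = β := by
  obtain ⟨μ, -, -, rfl⟩ := h
  rw [momentMap, map_smulₛₗ]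
  congr 1
  exact isSelfAdjoint_momentForm μ

/-- Test the moment map against the identity, which acts on brackets as `-1`. -/
theorem IsStratumLabel.tr_eq {β : E →L[ℝ] E} (h : IsStratumLabel β) : tr β = -1 := by
  obtain ⟨μ, hμ, -, rfl⟩ := h
  rw [momentMap, tr_smul, ← glInner_one_right, glInner_momentForm, rep_one,
    bracketInner_neg_left]
  have := (bracketForm_pos μ hμ).ne'
  rw [bracketForm_apply] at this
  field_simp

theorem IsStratumLabel.glInner_self_pos {β : E →L[ℝ] E} (h : IsStratumLabel β) :
    0 < glInner β β := by
  refine glForm_pos β ?_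
  rintro rfl
  have := h.tr_eq
  simp [tr] at this

theorem betaPlus_apply (β : E →L[ℝ] E) (x : E) : betaPlus β x = β x + glInner β β • x := rfl

theorem betaPlus_commutator (β A : E →L[ℝ] E) :
    betaPlus β * A - A * betaPlus β = β * A - A * β := by
  simp [betaPlus, add_mul, mul_add]

theorem adjoint_one : (1 : E →L[ℝ] E)ᵗ = 1 := by
  rw [← ContinuousLinearMap.star_eq_adjoint, star_one]

theorem adjoint_betaPlus {β : E →L[ℝ] E} (h : βᵗ = β) : (betaPlus β)ᵗ = betaPlus β := by
  rw [betaPlus, map_add, h, map_smulₛₗ, adjoint_one]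
  rfl

theorem bracketInner_rep_of_adjoint_eq {A : E →L[ℝ] E} (h : Aᵗ = A) (μ ν : BracketSpace E) :
    bracketInner (rep A μ) ν = bracketInner μ (rep A ν) := by
  rw [bracketInner_rep_left, h]

/-- Both summands are orthogonal to derivations: the moment part because `π(D)μ = 0`, the Killing
part by invariance. -/
theorem glInner_ricMod_derivation {μ : BracketSpace E} {D : E →L[ℝ] E} (h : IsDerivation μ D) :
    glInner (ricMod μ) D = 0 := by
  rw [ricMod, glInner_sub_left, glInner_smul_left, glInner_momentPart, isDerivation_iff.1 h,
    glInner_killing_derivation h]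
  simp

theorem mem_span_of_mem_vNonneg {β : E →L[ℝ] E} {μ : BracketSpace E} (h : μ ∈ vNonneg β) :
    μ ∈ Submodule.span ℝ {ν | ∃ r : ℝ, 0 ≤ r ∧ rep (betaPlus β) ν = r • ν} := by
  have hle : vNonneg β ≤ Submodule.span ℝ {ν | ∃ r : ℝ, 0 ≤ r ∧ rep (betaPlus β) ν = r • ν} :=
    iSup₂_le fun r hr _ hν => Submodule.subset_span ⟨r, hr, Module.End.mem_eigenspace_iff.1 hν⟩
  exact hle h

theorem apply_eq_zero_of_bracketInner_eq_zero {T : Module.End ℝ (BracketSpace E)}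
    (hT : ∀ x y : BracketSpace E, bracketForm (E := E) (T x) y = bracketForm (E := E) x (T y))
    {μ : BracketSpace E} (hμ : μ ∈ Submodule.span ℝ {ν | ∃ r : ℝ, 0 ≤ r ∧ T ν = r • ν})
    (h : bracketInner (T μ) μ = 0) : T μ = 0 := by
  have key := apply_eq_zero_of_form_apply_self_eq_zero (U := BracketSpace E) (bracketForm (E := E))
    bracketForm_pos hT (x := μ)
  exact key hμ h

theorem rep_eq_zero_of_bracketInner_eq_zero {A : E →L[ℝ] E} (hA : Aᵗ = A) {μ : BracketSpace E}
    (hμ : μ ∈ Submodule.span ℝ {ν | ∃ r : ℝ, 0 ≤ r ∧ rep A ν = r • ν})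
    (h : bracketInner (rep A μ) μ = 0) : rep A μ = 0 := by
  have hs := bracketInner_rep_of_adjoint_eq hA
  exact apply_eq_zero_of_bracketInner_eq_zero (T := rep A) hs hμ h

/-- Pairing the soliton equation with `β`, which is orthogonal to derivations and has trace `-1`,
gives `c = -‖β‖²`. Thus `β⁺` is `D` plus the symmetric part of `ad H`, to which both `β` and the
Killing endomorphism are orthogonal; hence so is the moment part `β + ½ B`. -/
theorem bracketInner_rep_betaPlus_eq_zero {β : E →L[ℝ] E} (hβ : IsStratumLabel β)
    {μ : BracketSpace E} (hlie : IsLie μ) {c : ℝ} {D : E →L[ℝ] E} (hD : IsDerivation μ D)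
    (hc : ric μ = c • (1 : E →L[ℝ] E) + D) (hric : ricMod μ = β) :
    bracketInner (rep (betaPlus β) μ) μ = 0 := by
  set A := ad μ (meanCurvature μ) with hA
  have hAder : IsDerivation μ A := isDerivation_ad hlie _
  have hβeq : β = c • (1 : E →L[ℝ] E) + D + (1 / 2 : ℝ) • (A + Aᵗ) := by
    rw [← hc, ric, ← hric, ricMod, ← hA]
    abel
  have hβ0 : ∀ X : E →L[ℝ] E, IsDerivation μ X → glInner β X = 0 := fun X hX => by
    rw [← hric]
    exact glInner_ricMod_derivation hX
  have hβA : glInner β Aᵗ = 0 := by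
    rw [← hβ.adjoint_eq, glInner_adjoint, hβ0 A hAder]
  have hBA : glInner (killing μ) Aᵗ = 0 := by
    rw [← adjoint_killing, glInner_adjoint, glInner_killing_derivation hAder]
  have hcval : glInner β β = -c := by
    have h := congrArg (glInner β) hβeq
    rw [h, glInner_add_right, glInner_add_right, glInner_smul_right,
      glInner_smul_right, glInner_add_right, hβA, hβ0 D hD, hβ0 A hAder, glInner_one_right,
      hβ.tr_eq]
    ring
  have hM : momentPart μ = β + (1 / 2 : ℝ) • killing μ := by
    rw [← hric, ricMod, sub_add_cancel]
  have h1 : glInner β (betaPlus β) = 0 := by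
    rw [betaPlus, glInner_add_right, glInner_smul_right, glInner_one_right, hβ.tr_eq]
    ring
  have h2 : glInner (killing μ) (betaPlus β) = 0 := by
    have : betaPlus β = D + (1 / 2 : ℝ) • (A + Aᵗ) := by
      rw [betaPlus, hcval]
      nth_rewrite 1 [hβeq]
      module
    rw [this, glInner_add_right, glInner_smul_right, glInner_add_right, hBA,
      glInner_killing_derivation hD, glInner_killing_derivation hAder]
    ring
  have h4 := glInner_momentPart μ (betaPlus β)
  rw [hM, glInner_add_left, glInner_smul_left, h1, h2] at h4
  linarith

/-- For a soliton with `Ric* = β` in `V^{≥ 0}`, the endomorphism `β⁺` is a derivation. -/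
theorem isDerivation_betaPlus {β : E →L[ℝ] E} (hβ : IsStratumLabel β) {μ : BracketSpace E}
    (hμ : μ ∈ vNonneg β) (hlie : IsLie μ) {c : ℝ} {D : E →L[ℝ] E} (hD : IsDerivation μ D)
    (hc : ric μ = c • (1 : E →L[ℝ] E) + D) (hric : ricMod μ = β) :
    IsDerivation μ (betaPlus β) :=
  isDerivation_iff.2 (rep_eq_zero_of_bracketInner_eq_zero (adjoint_betaPlus hβ.adjoint_eq)
    (mem_span_of_mem_vNonneg hμ) (bracketInner_rep_betaPlus_eq_zero hβ hlie hD hc hric))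

theorem exists_flag_of_isSolvableLie {μ : BracketSpace E} (hμ : IsSolvableLie μ)
    {D : E →L[ℝ] E} (hD : IsDerivation μ D) :
    ∃ (F : ℕ → Submodule ℝ E) (N : ℕ), F 0 = ⊥ ∧ F N = ⊤ ∧
      (∀ i x, ∀ v ∈ F i, μ.1 x v ∈ F i) ∧
      (∀ i x y, ∀ v ∈ F (i + 1), μ.1 (μ.1 x y) v ∈ F i) ∧
      (∀ i x, ∀ v ∈ F (i + 1), μ.1 (D x) v ∈ F i) := by
  obtain ⟨h, hs⟩ := hμ
  let _ : LieRing E := lieRing μ h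
  let _ : LieAlgebra ℝ E := { lie_smul := fun t x y => map_smul (μ.1 x) t y }
  let D' : LieDerivation ℝ E E :=
    { (D : E →ₗ[ℝ] E) with
      leibniz' := by
        intro x y
        have h1 : D (μ.1 x y) = μ.1 x (D y) - μ.1 y (D x) := by
          rw [hD, bracket_skew μ y (D x)]
          abel
        exact h1 }
  exact exists_flag_of_derivation D'

theorem isNilpotent_of_flag {F : ℕ → Submodule ℝ E} {N : ℕ} (h0 : F 0 = ⊥) (hN : F N = ⊤)
    {A : E →L[ℝ] E} (hA : ∀ i, ∀ v ∈ F (i + 1), A v ∈ F i) : IsNilpotent A := by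
  have h : ∀ k i, ∀ v ∈ F (i + k), (A ^ k) v ∈ F i := by
    intro k
    induction k with
    | zero => intro i v hv; simpa using hv
    | succ k ih =>
      intro i v hv
      rw [pow_succ']
      exact hA i _ (ih (i + 1) v (by rwa [add_right_comm, add_assoc]))
  refine ⟨N, ?_⟩
  ext v
  have := h N 0 v (by rw [zero_add, hN]; trivial)
  rw [h0] at this
  simpa using this

theorem tr_eq_zero_of_isNilpotent {A : E →L[ℝ] E} (h : IsNilpotent A) : tr A = 0 := by
  obtain ⟨k, hk⟩ := h
  have h1 : IsNilpotent (A : E →ₗ[ℝ] E) := by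
    refine ⟨k, ?_⟩
    ext x
    have : (A ^ k) x = 0 := by rw [hk]; rfl
    rw [LinearMap.zero_apply, ← this, ← ContinuousLinearMap.toLinearMap_pow]
    rfl
  exact (LinearMap.isNilpotent_trace_of_isNilpotent h1).eq_zero

/-- The properties of the nilpotent ideal `n` of a solvable Lie algebra `μ` with a symmetric
derivation `β⁺` and `Ric* = β`. -/
structure NilpotentIdeal (β : E →L[ℝ] E) (μ : BracketSpace E) (n : Submodule ℝ E) : Prop where
  isLie : IsLie μ
  adjoint_eq : βᵗ = β
  glInner_pos : 0 < glInner β β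
  isDerivation : IsDerivation μ (betaPlus β)
  ricMod_eq : ricMod μ = β
  bracket_mem : ∀ x y, μ.1 x y ∈ n
  betaPlus_mem : ∀ x, betaPlus β x ∈ n
  killing_eq : ∀ x ∈ n, killing μ x = 0
  isNilpotent : ∀ x ∈ n, IsNilpotent (ad μ x)
  exists_central : ∀ c : Submodule ℝ E, c ≤ n → c ≠ ⊥ → (∀ x ∈ c, ∀ y ∈ c, μ.1 x y ∈ c) →
    ∃ z ∈ c, z ≠ 0 ∧ ∀ x ∈ c, μ.1 x z = 0

theorem exists_nilpotentIdeal {β : E →L[ℝ] E} (hβ : IsStratumLabel β) {μ : BracketSpace E}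
    (hμ : μ ∈ vNonneg β) (hsol : IsSolvsoliton μ) (hric : ricMod μ = β) :
    ∃ n, NilpotentIdeal β μ n := by
  obtain ⟨hsolv, c, D, hD, hc⟩ := hsol
  have hlie : IsLie μ := hsolv.1
  have hder := isDerivation_betaPlus hβ hμ hlie hD hc hric
  obtain ⟨F, N, h0, hN, hF1, hF2, hF3⟩ := exists_flag_of_isSolvableLie hsolv hder
  -- The elements whose adjoint map shifts the flag by one. Composed with any `ad y`, which
  -- preserves the flag, such a map is still nilpotent, so the Killing form vanishes on `n`.
  let n : Submodule ℝ E :=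
    { carrier := {x | ∀ i, ∀ v ∈ F (i + 1), μ.1 x v ∈ F i}
      add_mem' := fun {a b} ha hb i v hv => by
        rw [map_add]
        exact add_mem (ha i v hv) (hb i v hv)
      zero_mem' := fun i v _ => by simp
      smul_mem' := fun t a ha i v hv => by
        rw [map_smul]
        exact (F i).smul_mem t (ha i v hv) }
  refine ⟨n, hlie, hβ.adjoint_eq, hβ.glInner_self_pos, hder, hric, fun x y i v hv => hF2 i x y v hv,
    fun x i v hv => hF3 i x v hv, ?_, fun x hx => isNilpotent_of_flag h0 hN hx, ?_⟩
  · intro x hx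
    refine ext_inner_right ℝ fun y => ?_
    rw [inner_killing, inner_zero_left]
    exact tr_eq_zero_of_isNilpotent
      (isNilpotent_of_flag h0 hN fun i v hv => hx i _ (hF1 (i + 1) y v hv))
  · intro c hcn hc0 hcc
    classical
    -- At the first level where the flag meets `c`, bracketing with `c` drops one level while
    -- staying in `c`, hence gives zero.
    have hex : ∃ i, F i ⊓ c ≠ ⊥ := ⟨N, by rwa [hN, top_inf_eq]⟩
    obtain ⟨j, hj⟩ : ∃ j, Nat.find hex = j + 1 := by
      refine Nat.exists_eq_succ_of_ne_zero fun h => ?_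
      have := Nat.find_spec hex
      rw [h, h0, bot_inf_eq] at this
      exact this rfl
    have h1 := Nat.find_spec hex
    have h2 : F j ⊓ c = ⊥ := not_not.1 (Nat.find_min hex (m := j) (by omega))
    rw [hj] at h1
    obtain ⟨z, hz, hz0⟩ := Submodule.exists_mem_ne_zero_of_ne_bot h1
    refine ⟨z, hz.2, hz0, fun x hx => ?_⟩
    have : μ.1 x z ∈ F j ⊓ c := ⟨hcn hx j z hz.1, hcc x hx z hz.2⟩
    rwa [h2] at this

end Structure

/-! ### Orthogonal splitting along `n`, and central eigenvectors of `β⁺` -/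

section Structure

variable {E : Type*} [NormedAddCommGroup E] [InnerProductSpace ℝ E] [FiniteDimensional ℝ E]

theorem exists_adapted_basis (n : Submodule ℝ E) :
    ∃ (p q : ℕ) (b : OrthonormalBasis (Fin p ⊕ Fin q) ℝ E),
      (∀ j, b (Sum.inl j) ∈ nᗮ) ∧ ∀ i, b (Sum.inr i) ∈ n := by
  let Y := stdOrthonormalBasis ℝ nᗮ
  let W := stdOrthonormalBasis ℝ n
  let v : Fin (Module.finrank ℝ nᗮ) ⊕ Fin (Module.finrank ℝ n) → E :=
    Sum.elim (fun j => (Y j : E)) (fun i => (W i : E))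
  have hv : Orthonormal ℝ v := by
    rw [orthonormal_iff_ite]
    rintro (j | i) (j' | i')
    · have := Y.inner_eq_ite j j'
      rw [Submodule.coe_inner] at this
      simpa [v] using this
    · simpa [v] using Submodule.inner_left_of_mem_orthogonal (W i').2 (Y j).2
    · simpa [v] using Submodule.inner_right_of_mem_orthogonal (W i).2 (Y j').2
    · have := W.inner_eq_ite i i'
      rw [Submodule.coe_inner] at this
      simpa [v] using this
  have hspan : ⊤ ≤ Submodule.span ℝ (Set.range v) := by
    rw [← Submodule.sup_orthogonal_of_hasOrthogonalProjection (K := n)]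
    refine sup_le ?_ ?_
    · intro x hx
      have := congrArg Subtype.val (W.sum_repr ⟨x, hx⟩)
      rw [← show _ = x from this, Submodule.coe_sum]
      exact sum_mem fun i _ => Submodule.smul_mem _ _ (Submodule.subset_span ⟨Sum.inr i, rfl⟩)
    · intro x hx
      have := congrArg Subtype.val (Y.sum_repr ⟨x, hx⟩)
      rw [← show _ = x from this, Submodule.coe_sum]
      exact sum_mem fun i _ => Submodule.smul_mem _ _ (Submodule.subset_span ⟨Sum.inl i, rfl⟩)
  refine ⟨_, _, OrthonormalBasis.mk hv hspan, fun j => ?_, fun i => ?_⟩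
  · rw [OrthonormalBasis.coe_mk]
    exact (Y j).2
  · rw [OrthonormalBasis.coe_mk]
    exact (W i).2

theorem ext_of_mem_orthogonal (n : Submodule ℝ E) {A C : E →L[ℝ] E} (h1 : ∀ w ∈ n, A w = C w)
    (h2 : ∀ y ∈ nᗮ, A y = C y) : A = C := by
  ext x
  obtain ⟨w, hw, y, hy, rfl⟩ := n.exists_add_mem_mem_orthogonal x
  rw [map_add, map_add, h1 w hw, h2 y hy]

variable {κ ι : Type*} [Fintype κ] [Fintype ι]

theorem bracketInner_self_eq_blocks (b : OrthonormalBasis (κ ⊕ ι) ℝ E) (ν : BracketSpace E) :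
    bracketInner ν ν =
      ∑ j, ∑ j', ⟪ν.1 (b (Sum.inl j)) (b (Sum.inl j')), ν.1 (b (Sum.inl j)) (b (Sum.inl j'))⟫_ℝ
      + 2 * ∑ j, ∑ i, ⟪ν.1 (b (Sum.inl j)) (b (Sum.inr i)), ν.1 (b (Sum.inl j)) (b (Sum.inr i))⟫_ℝ
      + ∑ i, ∑ i', ⟪ν.1 (b (Sum.inr i)) (b (Sum.inr i')),
          ν.1 (b (Sum.inr i)) (b (Sum.inr i'))⟫_ℝ := by
  rw [bracketInner_eq_sum b]
  simp only [Fintype.sum_sum_type, Finset.sum_add_distrib]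
  have : ∑ i, ∑ j, ⟪ν.1 (b (Sum.inr i)) (b (Sum.inl j)), ν.1 (b (Sum.inr i)) (b (Sum.inl j))⟫_ℝ
      = ∑ j, ∑ i, ⟪ν.1 (b (Sum.inl j)) (b (Sum.inr i)),
          ν.1 (b (Sum.inl j)) (b (Sum.inr i))⟫_ℝ := by
    rw [Finset.sum_comm]
    refine Finset.sum_congr rfl fun j _ => Finset.sum_congr rfl fun i _ => ?_
    rw [bracket_skew ν (b (Sum.inr i)), inner_neg_neg]
  rw [this]
  ring

theorem glInner_eq_sum_inr (b : OrthonormalBasis (κ ⊕ ι) ℝ E) {A : E →L[ℝ] E}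
    (hA : ∀ j, A (b (Sum.inl j)) = 0) (C : E →L[ℝ] E) :
    glInner A C = ∑ i, ⟪A (b (Sum.inr i)), C (b (Sum.inr i))⟫_ℝ := by
  rw [glInner_eq_sum b, Fintype.sum_sum_type]
  simp [hA]

theorem inner_adjoint_self_eq_sum (b : OrthonormalBasis ι ℝ E) (A : E →L[ℝ] E) (x : E) :
    ⟪Aᵗ x, Aᵗ x⟫_ℝ = ∑ i, ⟪A (b i), x⟫_ℝ ^ 2 := by
  rw [← b.sum_inner_mul_inner]
  refine Finset.sum_congr rfl fun i _ => ?_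
  rw [ContinuousLinearMap.adjoint_inner_left, ContinuousLinearMap.adjoint_inner_right,
    real_inner_comm, sq]

/-- The adjoint map of `μ` truncated to the subspace `n`. -/
noncomputable def adTrunc (μ : BracketSpace E) (n : Submodule ℝ E) (x : E) : E →L[ℝ] E :=
  ad μ x * n.starProjection

theorem adTrunc_apply_mem (μ : BracketSpace E) {n : Submodule ℝ E} (x : E) {w : E} (hw : w ∈ n) :
    adTrunc μ n x w = μ.1 x w := by
  rw [adTrunc, mul_apply_eq_comp, Submodule.starProjection_eq_self_iff.2 hw]

theorem adTrunc_apply_orthogonal (μ : BracketSpace E) {n : Submodule ℝ E} (x : E) {y : E}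
    (hy : y ∈ nᗮ) : adTrunc μ n x y = 0 := by
  rw [adTrunc, mul_apply_eq_comp, (Submodule.starProjection_apply_eq_zero_iff _).2 hy, map_zero]

theorem commutator_adjoint (A N : E →L[ℝ] E) :
    (N * A - A * N)ᵗ = Aᵗ * Nᵗ - Nᵗ * Aᵗ := by
  rw [map_sub, adjoint_mul, adjoint_mul]

theorem eq_zero_of_isNilpotent_of_adjoint_eq {A : E →L[ℝ] E} (h : Aᵗ = A) (hA : IsNilpotent A) :
    A = 0 := by
  have hsq : ∀ X : E →L[ℝ] E, Xᵗ = X → X * X = 0 → X = 0 := fun X hX hX2 => by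
    refine glInner_self_eq_zero ?_
    rw [glInner_eq_tr, hX, hX2]
    simp [tr]
  have hpow : ∀ m : ℕ, (A ^ m)ᵗ = A ^ m := by
    intro m
    rw [← ContinuousLinearMap.star_eq_adjoint, star_pow, ContinuousLinearMap.star_eq_adjoint, h]
  have h2 : ∀ k : ℕ, A ^ (2 ^ k) = 0 → A = 0 := by
    intro k
    induction k with
    | zero => intro hk; simpa using hk
    | succ k ih =>
      intro hk
      rw [pow_succ, mul_two, pow_add] at hk
      exact ih (hsq _ (hpow _) hk)
  obtain ⟨m, hm⟩ := hA
  exact h2 m (pow_eq_zero_of_le (Nat.lt_two_pow_self).le hm)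

/-- For normal nilpotent `A`, the symmetric map `Aᵗ A` is nilpotent, hence zero. -/
theorem eq_zero_of_isNilpotent_of_commute {A : E →L[ℝ] E} (h : Aᵗ * A = A * Aᵗ)
    (hA : IsNilpotent A) : A = 0 := by
  have h1 : Aᵗ * A = 0 := by
    refine eq_zero_of_isNilpotent_of_adjoint_eq ?_ (Commute.isNilpotent_mul_left h hA)
    rw [adjoint_mul, ContinuousLinearMap.adjoint_adjoint]
  refine glInner_self_eq_zero ?_
  rw [glInner_eq_tr, h1]
  simp [tr]

namespace NilpotentIdeal

variable {β : E →L[ℝ] E} {μ : BracketSpace E} {n : Submodule ℝ E}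

theorem betaPlus_orthogonal (h : NilpotentIdeal β μ n) {y : E} (hy : y ∈ nᗮ) :
    betaPlus β y = 0 := by
  refine ext_inner_right ℝ fun x => ?_
  rw [← adjoint_betaPlus h.adjoint_eq, ContinuousLinearMap.adjoint_inner_left, inner_zero_left]
  exact Submodule.inner_left_of_mem_orthogonal (h.betaPlus_mem x) hy

theorem killing_mul (h : NilpotentIdeal β μ n) {A : E →L[ℝ] E} (hA : ∀ x, A x ∈ n) :
    killing μ * A = 0 := by
  ext x
  exact h.killing_eq _ (hA x)

theorem killing_mem (h : NilpotentIdeal β μ n) (x : E) : killing μ x ∈ nᗮ := by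
  intro w hw
  rw [← adjoint_killing, ContinuousLinearMap.adjoint_inner_right, h.killing_eq w hw,
    inner_zero_left]

theorem mul_killing (h : NilpotentIdeal β μ n) {A : E →L[ℝ] E} (hA : ∀ y ∈ nᗮ, A y = 0) :
    A * killing μ = 0 := by
  ext x
  exact hA _ (h.killing_mem x)

theorem adjoint_apply_orthogonal {A : E →L[ℝ] E} (hA : ∀ x, A x ∈ n) {y : E} (hy : y ∈ nᗮ) :
    Aᵗ y = 0 := by
  refine ext_inner_right ℝ fun x => ?_
  rw [ContinuousLinearMap.adjoint_inner_left, inner_zero_left]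
  exact Submodule.inner_left_of_mem_orthogonal (hA x) hy

theorem glInner_beta (h : NilpotentIdeal β μ n) (X : E →L[ℝ] E) :
    glInner β X = 1 / 4 * bracketInner (rep X μ) μ - 1 / 2 * glInner (killing μ) X := by
  rw [← glInner_momentPart, ← glInner_smul_left, ← glInner_sub_left]
  conv_lhs => rw [← h.ricMod_eq]
  rfl

/-- Rewrite `⟨[β, A], A⟩` as `⟨β, [A, Aᵗ]⟩` and insert `β = Ric*`. The two conditions on `A` remove
the Killing contribution, leaving the moment map identity for `[A, Aᵗ]`. -/
theorem glInner_commutator (h : NilpotentIdeal β μ n) {A : E →L[ℝ] E} (hA : ∀ x, A x ∈ n)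
    (hA' : ∀ y ∈ nᗮ, A y = 0) :
    4 * glInner (β * A - A * β) A =
      bracketInner (rep Aᵗ μ) (rep Aᵗ μ) - bracketInner (rep A μ) (rep A μ) := by
  have h1 : glInner (β * A - A * β) A = glInner β (A * Aᵗ - Aᵗ * A) := by
    rw [glInner_sub_left, glInner_sub_right, glInner_mul_right, glInner_mul_left]
  have h2 : glInner (killing μ) (A * Aᵗ - Aᵗ * A) = 0 := by
    rw [glInner_sub_right, ← glInner_mul_right, ← glInner_mul_left, h.killing_mul hA,
      h.mul_killing hA']
    simp
  rw [h1, h.glInner_beta, h2, bracketInner_rep_commutator_adjoint]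
  ring

/-- All such `z` form a subspace `S` invariant under `ad y` for `y ∈ nᗮ`. On `S` the form of `β` is
`c - ‖β‖² < 0` on unit vectors, whereas `Ric* = β` bounds its trace over `S` below by `½ ∑ (|Tⱼᵗ
aₖ|² - |Tⱼ aₖ|²) ≥ 0`. So `S` has dimension zero. -/
theorem eq_zero_of_central (h : NilpotentIdeal β μ n) {c : ℝ} (hc : c < glInner β β) {z : E}
    (hz : z ∈ n) (hzc : betaPlus β z = c • z) (hcen : ∀ w ∈ n, μ.1 z w = 0) : z = 0 := by
  classical
  obtain ⟨p, q, b, hbY, hbW⟩ := exists_adapted_basis n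
  let S : Submodule ℝ E :=
    { carrier := {z | z ∈ n ∧ betaPlus β z = c • z ∧ ∀ w ∈ n, μ.1 z w = 0}
      add_mem' := by
        rintro x y ⟨hx, hx', hx''⟩ ⟨hy, hy', hy''⟩
        refine ⟨add_mem hx hy, by rw [map_add, hx', hy', smul_add], fun w hw => ?_⟩
        rw [map_add, add_apply, hx'' w hw, hy'' w hw, add_zero]
      zero_mem' := ⟨zero_mem _, by simp, fun w _ => by simp⟩
      smul_mem' := by
        rintro t x ⟨hx, hx', hx''⟩
        refine ⟨n.smul_mem t hx, by rw [map_smul, hx', smul_comm], fun w hw => ?_⟩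
        rw [map_smul, smul_apply, hx'' w hw, smul_zero] }
  have hzS : z ∈ S := ⟨hz, hzc, hcen⟩
  have hs : ∀ x y : E, innerₗ E x y = innerₗ E y x := fun x y => real_inner_comm y x
  have hp : ∀ x : E, x ≠ 0 → 0 < innerₗ E x x := fun x hx => real_inner_self_pos.2 hx
  obtain ⟨a, haS, hao, hspan⟩ := exists_orthonormal_family (innerₗ E) hs hp S
  set T : Fin p → (E →L[ℝ] E) := fun j => adTrunc μ n (b (Sum.inl j)) with hT
  have hTS : ∀ j, ∀ x ∈ S, T j x ∈ S := by
    rintro j x ⟨hx, hx', hx''⟩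
    have e : T j x = μ.1 (b (Sum.inl j)) x := adTrunc_apply_mem μ _ hx
    refine ⟨e ▸ h.bracket_mem _ _, ?_, fun w hw => ?_⟩
    · rw [e, h.isDerivation, h.betaPlus_orthogonal (hbY j), hx']
      simp
    · rw [e]
      have := h.isLie (b (Sum.inl j)) x w
      rw [hx'' w hw, hx'' _ (h.bracket_mem _ _), map_zero, add_zero] at this
      exact this.symm
  have hTle : ∀ j, ∑ k, ⟪T j (a k), T j (a k)⟫_ℝ ≤ ∑ k, ⟪(T j)ᵗ (a k), (T j)ᵗ (a k)⟫_ℝ :=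
    fun j => sum_form_le_sum_form_adjoint (innerₗ E) hs hp a haS hao hspan (T j) (T j)ᵗ (hTS j)
      fun x y => (ContinuousLinearMap.adjoint_inner_right (T j) x y).symm
  -- The Killing term vanishes on `n`. Of the three blocks of the positive part of the moment map
  -- only the mixed one is kept, counted twice by skew-symmetry; the other two are discarded as
  -- nonnegative.
  have hk : ∀ k, 1 / 2 * ∑ j, (⟪(T j)ᵗ (a k), (T j)ᵗ (a k)⟫_ℝ - ⟪T j (a k), T j (a k)⟫_ℝ)
      ≤ c - glInner β β := by
    intro k
    obtain ⟨hx, hx', hx''⟩ := haS k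
    have hnorm : ⟪a k, a k⟫_ℝ = 1 := by simpa using hao k k
    have e1 : ⟪β (a k), a k⟫_ℝ = c - glInner β β := by
      have : β (a k) = c • a k - glInner β β • a k := by
        rw [← hx', betaPlus_apply, add_sub_cancel_right]
      rw [this, inner_sub_left, real_inner_smul_left, real_inner_smul_left, hnorm]
      ring
    have e2 : ⟪β (a k), a k⟫_ℝ = ⟪momentPart μ (a k), a k⟫_ℝ := by
      conv_lhs => rw [← h.ricMod_eq]
      rw [ricMod, sub_apply, smul_apply, h.killing_eq _ hx, smul_zero, sub_zero]
    have e3 : glInner (ad μ (a k)) (ad μ (a k)) = ∑ j, ⟪T j (a k), T j (a k)⟫_ℝ := by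
      rw [glInner_eq_sum b, Fintype.sum_sum_type]
      have : ∀ i, μ.1 (a k) (b (Sum.inr i)) = 0 := fun i => hx'' _ (hbW i)
      simp only [this, inner_zero_left, Finset.sum_const_zero, add_zero]
      refine Finset.sum_congr rfl fun j _ => ?_
      rw [hT, adTrunc_apply_mem μ _ hx, bracket_skew μ (b (Sum.inl j)), inner_neg_neg]
    have e4 : ∀ j, ⟪(T j)ᵗ (a k), (T j)ᵗ (a k)⟫_ℝ
        = ∑ i, ⟪μ.1 (b (Sum.inl j)) (b (Sum.inr i)), a k⟫_ℝ ^ 2 := by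
      intro j
      rw [inner_adjoint_self_eq_sum b, Fintype.sum_sum_type]
      have e5 : ∀ j', T j (b (Sum.inl j')) = 0 := fun j' => adTrunc_apply_orthogonal μ _ (hbY j')
      have e6 : ∀ i, T j (b (Sum.inr i)) = μ.1 (b (Sum.inl j)) (b (Sum.inr i)) :=
        fun i => adTrunc_apply_mem μ _ (hbW i)
      simp [e5, e6]
    rw [← e1, e2, inner_momentPart b, e3, Finset.sum_sub_distrib]
    simp only [Fintype.sum_sum_type, Finset.sum_add_distrib, e4]
    have e7 : ∑ i, ∑ j, ⟪μ.1 (b (Sum.inr i)) (b (Sum.inl j)), a k⟫_ℝ ^ 2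
        = ∑ j, ∑ i, ⟪μ.1 (b (Sum.inl j)) (b (Sum.inr i)), a k⟫_ℝ ^ 2 := by
      rw [Finset.sum_comm]
      refine Finset.sum_congr rfl fun j _ => Finset.sum_congr rfl fun i _ => ?_
      rw [bracket_skew μ (b (Sum.inr i)), inner_neg_left, neg_sq]
    have e8 : 0 ≤ ∑ j, ∑ j', ⟪μ.1 (b (Sum.inl j)) (b (Sum.inl j')), a k⟫_ℝ ^ 2 :=
      Finset.sum_nonneg fun _ _ => Finset.sum_nonneg fun _ _ => sq_nonneg _
    have e9 : 0 ≤ ∑ i, ∑ i', ⟪μ.1 (b (Sum.inr i)) (b (Sum.inr i')), a k⟫_ℝ ^ 2 :=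
      Finset.sum_nonneg fun _ _ => Finset.sum_nonneg fun _ _ => sq_nonneg _
    rw [e7]
    linarith
  have hsum := Finset.sum_le_sum fun k (_ : k ∈ Finset.univ) => hk k
  rw [← Finset.mul_sum, Finset.sum_comm] at hsum
  have hnn : 0 ≤ ∑ j, ∑ k, (⟪(T j)ᵗ (a k), (T j)ᵗ (a k)⟫_ℝ - ⟪T j (a k), T j (a k)⟫_ℝ) :=
    Finset.sum_nonneg fun j _ => by
      rw [Finset.sum_sub_distrib]
      exact sub_nonneg.2 (hTle j)
  rw [Finset.sum_const, nsmul_eq_mul, Finset.card_univ, Fintype.card_fin] at hsum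
  have hd : Module.finrank ℝ S = 0 := by
    by_contra hne
    have : (0 : ℝ) < Module.finrank ℝ S := by exact_mod_cast Nat.pos_of_ne_zero hne
    nlinarith
  have hS : S = ⊥ := Submodule.finrank_eq_zero.1 hd
  rw [hS] at hzS
  exact hzS

end NilpotentIdeal

end Structure

/-! ### Truncated adjoint maps and positivity of `β⁺` on `n` -/

section Structure

variable {E : Type*} [NormedAddCommGroup E] [InnerProductSpace ℝ E] [FiniteDimensional ℝ E]

variable {κ ι : Type*} [Fintype κ] [Fintype ι]

theorem glInner_neg_neg (A C : E →L[ℝ] E) : glInner (-A) (-C) = glInner A C := by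
  rw [glInner_neg_left, glInner_neg_right, neg_neg]

theorem adjoint_mem_of_apply_orthogonal {n : Submodule ℝ E} {A : E →L[ℝ] E}
    (hA : ∀ y ∈ nᗮ, A y = 0) (x : E) : Aᵗ x ∈ n := by
  rw [← n.orthogonal_orthogonal]
  intro y hy
  rw [ContinuousLinearMap.adjoint_inner_right, hA y hy, inner_zero_left]

theorem glInner_commutator_adjoint_self (A N : E →L[ℝ] E) :
    glInner (Aᵗ * N - N * Aᵗ) (Aᵗ * N - N * Aᵗ) =
      glInner (Nᵗ * A - A * Nᵗ) (Nᵗ * A - A * Nᵗ) := by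
  rw [← glInner_adjoint, commutator_adjoint, ContinuousLinearMap.adjoint_adjoint]

theorem adTrunc_add (μ : BracketSpace E) (n : Submodule ℝ E) (x y : E) :
    adTrunc μ n (x + y) = adTrunc μ n x + adTrunc μ n y := by
  simp [adTrunc, add_mul]

theorem adTrunc_smul (μ : BracketSpace E) (n : Submodule ℝ E) (t : ℝ) (x : E) :
    adTrunc μ n (t • x) = t • adTrunc μ n x := by
  simp [adTrunc]

theorem bracketInner_rep_self_eq_blocks {μ : BracketSpace E} {n : Submodule ℝ E}
    (b : OrthonormalBasis (κ ⊕ ι) ℝ E) (hbY : ∀ j, b (Sum.inl j) ∈ nᗮ)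
    (hbW : ∀ i, b (Sum.inr i) ∈ n) {A : E →L[ℝ] E} (hA : ∀ w ∈ n, A w ∈ n)
    (hA' : ∀ y ∈ nᗮ, A y ∈ nᗮ) :
    bracketInner (rep A μ) (rep A μ) =
      ∑ j, ∑ j', ⟪(rep A μ).1 (b (Sum.inl j)) (b (Sum.inl j')),
          (rep A μ).1 (b (Sum.inl j)) (b (Sum.inl j'))⟫_ℝ
      + 2 * ∑ j, glInner (A * adTrunc μ n (b (Sum.inl j)) - adTrunc μ n (b (Sum.inl j)) * A
            - adTrunc μ n (A (b (Sum.inl j))))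
          (A * adTrunc μ n (b (Sum.inl j)) - adTrunc μ n (b (Sum.inl j)) * A
            - adTrunc μ n (A (b (Sum.inl j))))
      + ∑ i, ∑ i', ⟪(rep A μ).1 (b (Sum.inr i)) (b (Sum.inr i')),
          (rep A μ).1 (b (Sum.inr i)) (b (Sum.inr i'))⟫_ℝ := by
  rw [bracketInner_self_eq_blocks b]
  congr 3
  refine Finset.sum_congr rfl fun j _ => ?_
  rw [glInner_eq_sum_inr b]
  · refine Finset.sum_congr rfl fun i _ => ?_
    simp only [sub_apply, mul_apply_eq_comp, rep_apply, adTrunc_apply_mem μ _ (hbW i),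
      adTrunc_apply_mem μ _ (hA _ (hbW i))]
    rw [sub_right_comm]
  · intro j'
    simp only [sub_apply, mul_apply_eq_comp, adTrunc_apply_orthogonal μ _ (hbY j'),
      adTrunc_apply_orthogonal μ _ (hA' _ (hbY j')), map_zero, sub_zero]

theorem bracketInner_rep_self_eq_blocks_of_apply_orthogonal {μ : BracketSpace E}
    {n : Submodule ℝ E} (b : OrthonormalBasis (κ ⊕ ι) ℝ E)
    (hbY : ∀ j, b (Sum.inl j) ∈ nᗮ) (hbW : ∀ i, b (Sum.inr i) ∈ n) {A : E →L[ℝ] E}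
    (hA : ∀ w ∈ n, A w ∈ n) (hA' : ∀ y ∈ nᗮ, A y = 0) :
    bracketInner (rep A μ) (rep A μ) =
      ∑ j, ∑ j', ⟪(rep A μ).1 (b (Sum.inl j)) (b (Sum.inl j')),
          (rep A μ).1 (b (Sum.inl j)) (b (Sum.inl j'))⟫_ℝ
      + 2 * ∑ j, glInner (A * adTrunc μ n (b (Sum.inl j)) - adTrunc μ n (b (Sum.inl j)) * A)
          (A * adTrunc μ n (b (Sum.inl j)) - adTrunc μ n (b (Sum.inl j)) * A)
      + ∑ i, ∑ i', ⟪(rep A μ).1 (b (Sum.inr i)) (b (Sum.inr i')),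
          (rep A μ).1 (b (Sum.inr i)) (b (Sum.inr i'))⟫_ℝ := by
  have h0 : adTrunc μ n 0 = 0 := by simp [adTrunc]
  rw [bracketInner_rep_self_eq_blocks b hbY hbW hA fun y hy => by
    rw [hA' y hy]; exact zero_mem _]
  simp only [hA' _ (hbY _), h0, sub_zero]

namespace NilpotentIdeal

variable {β : E →L[ℝ] E} {μ : BracketSpace E} {n : Submodule ℝ E}

theorem adTrunc_mem (h : NilpotentIdeal β μ n) (x y : E) : adTrunc μ n x y ∈ n :=
  h.bracket_mem _ _

theorem commutator_adTrunc (h : NilpotentIdeal β μ n) (x y : E) :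
    adTrunc μ n x * adTrunc μ n y - adTrunc μ n y * adTrunc μ n x = adTrunc μ n (μ.1 x y) := by
  refine ext_of_mem_orthogonal n (fun w hw => ?_) fun v hv => ?_
  · simp only [sub_apply, mul_apply_eq_comp, adTrunc_apply_mem μ _ hw,
      adTrunc_apply_mem μ _ (h.bracket_mem _ _)]
    rw [h.isLie x y w, add_sub_cancel_right]
  · simp only [sub_apply, mul_apply_eq_comp, adTrunc_apply_orthogonal μ _ hv, map_zero, sub_zero]

theorem commutator_beta_adTrunc (h : NilpotentIdeal β μ n) (x : E) :
    β * adTrunc μ n x - adTrunc μ n x * β = adTrunc μ n (betaPlus β x) := by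
  rw [← betaPlus_commutator]
  refine ext_of_mem_orthogonal n (fun w hw => ?_) fun v hv => ?_
  · simp only [sub_apply, mul_apply_eq_comp, adTrunc_apply_mem μ _ hw,
      adTrunc_apply_mem μ _ (h.betaPlus_mem _)]
    rw [h.isDerivation, add_sub_cancel_right]
  · simp only [sub_apply, mul_apply_eq_comp, adTrunc_apply_orthogonal μ _ hv,
      h.betaPlus_orthogonal hv, map_zero, sub_zero]

theorem rep_adTrunc_apply_mem (h : NilpotentIdeal β μ n) (z : E) {w w' : E} (hw : w ∈ n)
    (hw' : w' ∈ n) : (rep (adTrunc μ n z) μ).1 w w' = 0 := by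
  rw [rep_apply, adTrunc_apply_mem μ _ hw, adTrunc_apply_mem μ _ hw',
    adTrunc_apply_mem μ _ (h.bracket_mem _ _), h.isLie z w w']
  abel

theorem rep_adTrunc_apply_orthogonal (h : NilpotentIdeal β μ n) {z y y' : E} (hy : y ∈ nᗮ)
    (hy' : y' ∈ nᗮ) (hz : μ.1 z (μ.1 y y') = 0) : (rep (adTrunc μ n z) μ).1 y y' = 0 := by
  rw [rep_apply, adTrunc_apply_orthogonal μ _ hy, adTrunc_apply_orthogonal μ _ hy',
    adTrunc_apply_mem μ _ (h.bracket_mem _ _), hz]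
  simp

/-- For `A = adTrunc μ n z` one has `[β, A] = l A`, so `4 l |A|² = |π(Aᵗ)μ|² - |π(A)μ|²`. Decompose
both norms over `nᗮ × nᗮ`, `nᗮ × n` and `n × n`: `π(A)μ` survives only in the mixed block, and the
`nᗮ × nᗮ` block of `π(Aᵗ)μ` is dropped. -/
theorem sum_rep_adjoint_adTrunc_le (h : NilpotentIdeal β μ n) (b : OrthonormalBasis (κ ⊕ ι) ℝ E)
    (hbY : ∀ j, b (Sum.inl j) ∈ nᗮ) (hbW : ∀ i, b (Sum.inr i) ∈ n) {l : ℝ} {z : E}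
    (hz : betaPlus β z = l • z) (hzY : ∀ y ∈ nᗮ, ∀ y' ∈ nᗮ, μ.1 z (μ.1 y y') = 0) :
    ∑ i, ∑ i', ⟪(rep (adTrunc μ n z)ᵗ μ).1 (b (Sum.inr i)) (b (Sum.inr i')),
        (rep (adTrunc μ n z)ᵗ μ).1 (b (Sum.inr i)) (b (Sum.inr i'))⟫_ℝ
      ≤ 4 * l * glInner (adTrunc μ n z) (adTrunc μ n z)
        - 2 * ∑ j, (glInner
            ((adTrunc μ n (b (Sum.inl j)))ᵗ * adTrunc μ n z
              - adTrunc μ n z * (adTrunc μ n (b (Sum.inl j)))ᵗ)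
            ((adTrunc μ n (b (Sum.inl j)))ᵗ * adTrunc μ n z
              - adTrunc μ n z * (adTrunc μ n (b (Sum.inl j)))ᵗ)
          - glInner (adTrunc μ n (b (Sum.inl j)) * adTrunc μ n z
              - adTrunc μ n z * adTrunc μ n (b (Sum.inl j)))
            (adTrunc μ n (b (Sum.inl j)) * adTrunc μ n z
              - adTrunc μ n z * adTrunc μ n (b (Sum.inl j)))) := by
  set A := adTrunc μ n z with hA
  have hAn : ∀ x, A x ∈ n := h.adTrunc_mem z
  have hAo : ∀ y ∈ nᗮ, A y = 0 := fun y hy => adTrunc_apply_orthogonal μ _ hy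
  have h1 := h.glInner_commutator hAn hAo
  rw [hA, h.commutator_beta_adTrunc, hz, adTrunc_smul, glInner_smul_left, ← hA,
    bracketInner_rep_self_eq_blocks_of_apply_orthogonal b hbY hbW
      (fun w _ => hAn w) hAo,
    bracketInner_rep_self_eq_blocks_of_apply_orthogonal b hbY hbW
      (fun w _ => adjoint_mem_of_apply_orthogonal hAo w)
      (fun y hy => adjoint_apply_orthogonal hAn hy)] at h1
  have h2 : ∀ j j', (rep A μ).1 (b (Sum.inl j)) (b (Sum.inl j')) = 0 := fun j j' =>
    h.rep_adTrunc_apply_orthogonal (hbY j) (hbY j') (hzY _ (hbY j) _ (hbY j'))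
  have h3 : ∀ i i', (rep A μ).1 (b (Sum.inr i)) (b (Sum.inr i')) = 0 := fun i i' =>
    h.rep_adTrunc_apply_mem z (hbW i) (hbW i')
  have h4 : ∀ N : E →L[ℝ] E, glInner (A * N - N * A) (A * N - N * A)
      = glInner (N * A - A * N) (N * A - A * N) := fun N => by
    rw [← neg_sub (N * A), glInner_neg_neg]
  simp only [h2, h3, h4, fun N => glInner_commutator_adjoint_self A N, inner_zero_left,
    Finset.sum_const_zero, zero_add, add_zero] at h1
  have h5 : 0 ≤ ∑ j, ∑ j', ⟪(rep Aᵗ μ).1 (b (Sum.inl j)) (b (Sum.inl j')),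
      (rep Aᵗ μ).1 (b (Sum.inl j)) (b (Sum.inl j'))⟫_ℝ :=
    Finset.sum_nonneg fun _ _ => Finset.sum_nonneg fun _ _ => real_inner_self_nonneg
  rw [Finset.sum_sub_distrib]
  linarith

theorem eq_sum_inr_of_mem (b : OrthonormalBasis (κ ⊕ ι) ℝ E) (hbY : ∀ j, b (Sum.inl j) ∈ nᗮ)
    {w : E} (hw : w ∈ n) : w = ∑ i, ⟪b (Sum.inr i), w⟫_ℝ • b (Sum.inr i) := by
  have h1 := b.sum_repr' w
  rw [Fintype.sum_sum_type] at h1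
  have h2 : ∀ j, ⟪b (Sum.inl j), w⟫_ℝ = 0 := fun j =>
    Submodule.inner_left_of_mem_orthogonal hw (hbY j)
  simp only [h2, zero_smul, Finset.sum_const_zero, zero_add] at h1
  exact h1.symm

theorem apply_eq_zero_of_forall_inr (b : OrthonormalBasis (κ ⊕ ι) ℝ E)
    (hbY : ∀ j, b (Sum.inl j) ∈ nᗮ) {ν : BracketSpace E}
    (hν : ∀ i i', ν.1 (b (Sum.inr i)) (b (Sum.inr i')) = 0) {w w' : E} (hw : w ∈ n)
    (hw' : w' ∈ n) : ν.1 w w' = 0 := by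
  rw [eq_sum_inr_of_mem b hbY hw, eq_sum_inr_of_mem b hbY hw']
  simp [hν]

theorem sum_inner_eq_zero_iff {ν : BracketSpace E} (b : OrthonormalBasis (κ ⊕ ι) ℝ E)
    (h : ∑ i, ∑ i', ⟪ν.1 (b (Sum.inr i)) (b (Sum.inr i')),
        ν.1 (b (Sum.inr i)) (b (Sum.inr i'))⟫_ℝ ≤ 0) (i i' : ι) :
    ν.1 (b (Sum.inr i)) (b (Sum.inr i')) = 0 := by
  have h1 := le_antisymm h (Finset.sum_nonneg fun i _ =>
    Finset.sum_nonneg fun i' _ => real_inner_self_nonneg)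
  rw [Finset.sum_eq_zero_iff_of_nonneg fun i _ =>
    Finset.sum_nonneg fun i' _ => real_inner_self_nonneg] at h1
  have h2 := h1 i (Finset.mem_univ _)
  rw [Finset.sum_eq_zero_iff_of_nonneg fun i' _ => real_inner_self_nonneg] at h2
  exact inner_self_eq_zero.1 (h2 i' (Finset.mem_univ _))

/-- The linear map `x ↦ adTrunc μ n x`. -/
noncomputable def _root_.BracketFlow.adTruncHom (μ : BracketSpace E) (n : Submodule ℝ E) :
    E →ₗ[ℝ] (E →L[ℝ] E) where
  toFun := adTrunc μ n
  map_add' := adTrunc_add μ n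
  map_smul' := adTrunc_smul μ n

theorem eq_zero_of_le_of_sum_nonneg {m : ℕ} {l : ℝ} (hl : l ≤ 0) (f d : Fin m → ℝ)
    (hf : ∀ k, f k ≤ 4 * l - 2 * d k) (hd : 0 ≤ ∑ k, d k) (hf0 : ∀ k, 0 ≤ f k) :
    (l < 0 → m = 0) ∧ ∀ k, f k ≤ 0 := by
  have hsum := Finset.sum_le_sum fun k (_ : k ∈ Finset.univ) => hf k
  rw [Finset.sum_sub_distrib, Finset.sum_const, nsmul_eq_mul, Finset.card_univ, Fintype.card_fin,
    ← Finset.mul_sum] at hsum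
  have hsn := Finset.sum_nonneg fun k (_ : k ∈ Finset.univ) => hf0 k
  have hm0 : (m : ℝ) * (4 * l) = 0 :=
    le_antisymm (mul_nonpos_of_nonneg_of_nonpos (Nat.cast_nonneg _) (by linarith)) (by linarith)
  refine ⟨fun hl' => ?_, fun k =>
    (Finset.single_le_sum (fun k _ => hf0 k) (Finset.mem_univ k)).trans (by linarith)⟩
  rcases mul_eq_zero.1 hm0 with h0 | h0
  · exact_mod_cast h0
  · linarith

/-- Summing the block inequality over an orthonormal family makes the mixed terms nonnegative,
because `[ad y, ·]` preserves the span of the family. What remains forces the family to be empty if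
`l < 0`, and the `n × n` blocks of the transposes to vanish in any case. -/
theorem exists_family_of_eigenvalue_nonpos (h : NilpotentIdeal β μ n) {c : Submodule ℝ E}
    {l : ℝ} (hl : l ≤ 0) (hc : ∀ z ∈ c, betaPlus β z = l • z)
    (hcY : ∀ y ∈ nᗮ, ∀ z ∈ c, μ.1 y z ∈ c)
    (hcYY : ∀ z ∈ c, ∀ y ∈ nᗮ, ∀ y' ∈ nᗮ, μ.1 z (μ.1 y y') = 0) :
    ∃ (m : ℕ) (a : Fin m → E), (∀ k, a k ∈ c) ∧ (l < 0 → m = 0) ∧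
      (∀ z ∈ c, ∃ t : Fin m → ℝ, adTrunc μ n z = ∑ k, t k • adTrunc μ n (a k)) ∧
      ∀ k, ∀ w ∈ n, ∀ w' ∈ n, (rep (adTrunc μ n (a k))ᵗ μ).1 w w' = 0 := by
  classical
  obtain ⟨p, q, b, hbY, hbW⟩ := exists_adapted_basis n
  -- Orthonormality is taken in `gl(E)` between the truncated adjoint maps, not between vectors of
  -- `c`: the operator being averaged is the commutator with `N j`.
  set S := c.map (adTruncHom μ n) with hS
  obtain ⟨a, haS, hao, hspan⟩ := exists_orthonormal_family (glForm (E := E))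
    (fun x y => glInner_comm x y) glForm_pos S
  choose z hzc hz using haS
  have hz' : ∀ k, adTrunc μ n (z k) = a k := hz
  set N : Fin p → (E →L[ℝ] E) := fun j => adTrunc μ n (b (Sum.inl j)) with hN
  have hle : ∀ j, ∑ k, glInner (N j * a k - a k * N j) (N j * a k - a k * N j)
      ≤ ∑ k, glInner ((N j)ᵗ * a k - a k * (N j)ᵗ) ((N j)ᵗ * a k - a k * (N j)ᵗ) := by
    intro j
    refine sum_form_le_sum_form_adjoint (glForm (E := E)) (fun x y => glInner_comm x y) glForm_pos
      a (S := S) (fun k => ⟨z k, hzc k, hz k⟩) hao hspan (fun X => N j * X - X * N j)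
      (fun X => (N j)ᵗ * X - X * (N j)ᵗ) ?_ ?_
    · rintro _ ⟨x, hx, rfl⟩
      exact ⟨_, hcY _ (hbY j) x hx, (h.commutator_adTrunc _ _).symm⟩
    · intro X Y
      rw [glForm_apply, glForm_apply, glInner_sub_left, glInner_sub_right,
        glInner_mul_left (N j), glInner_mul_right X (N j)]
  have hk := fun k => h.sum_rep_adjoint_adTrunc_le b hbY hbW (hc _ (hzc k)) (hcYY _ (hzc k))
  have hnorm : ∀ k, glInner (a k) (a k) = 1 := fun k => by simpa using hao k k
  simp only [hz', hnorm, mul_one] at hk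
  have hnn : ∀ k, 0 ≤ ∑ i, ∑ i', ⟪(rep (a k)ᵗ μ).1 (b (Sum.inr i)) (b (Sum.inr i')),
      (rep (a k)ᵗ μ).1 (b (Sum.inr i)) (b (Sum.inr i'))⟫_ℝ := fun k =>
    Finset.sum_nonneg fun _ _ => Finset.sum_nonneg fun _ _ => real_inner_self_nonneg
  have hd : 0 ≤ ∑ j, ∑ k, (glInner ((N j)ᵗ * a k - a k * (N j)ᵗ) ((N j)ᵗ * a k - a k * (N j)ᵗ)
      - glInner (N j * a k - a k * N j) (N j * a k - a k * N j)) :=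
    Finset.sum_nonneg fun j _ => by
      rw [Finset.sum_sub_distrib]
      exact sub_nonneg.2 (hle j)
  rw [Finset.sum_comm] at hd
  obtain ⟨hm, hzero⟩ := eq_zero_of_le_of_sum_nonneg hl _ _ hk hd hnn
  refine ⟨_, z, hzc, hm, fun x hx => ?_, fun k w hw w' hw' => ?_⟩
  · simp only [hz']
    exact ⟨_, hspan _ ⟨x, hx, rfl⟩⟩
  · rw [hz']
    exact apply_eq_zero_of_forall_inr b hbY (sum_inner_eq_zero_iff b (hzero k)) hw hw'

theorem adTrunc_eq_zero_of_eigenvalue_neg (h : NilpotentIdeal β μ n) {c : Submodule ℝ E}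
    {l : ℝ} (hl : l < 0) (hc : ∀ z ∈ c, betaPlus β z = l • z)
    (hcY : ∀ y ∈ nᗮ, ∀ z ∈ c, μ.1 y z ∈ c)
    (hcYY : ∀ z ∈ c, ∀ y ∈ nᗮ, ∀ y' ∈ nᗮ, μ.1 z (μ.1 y y') = 0) {z : E} (hz : z ∈ c) :
    adTrunc μ n z = 0 := by
  obtain ⟨m, a, -, hm, hspan, -⟩ := h.exists_family_of_eigenvalue_nonpos hl.le hc hcY hcYY
  obtain rfl := hm hl
  obtain ⟨t, ht⟩ := hspan z hz
  simpa using ht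

theorem rep_adjoint_adTrunc_apply (h : NilpotentIdeal β μ n) {c : Submodule ℝ E}
    (hc : ∀ z ∈ c, betaPlus β z = 0)
    (hcY : ∀ y ∈ nᗮ, ∀ z ∈ c, μ.1 y z ∈ c)
    (hcYY : ∀ z ∈ c, ∀ y ∈ nᗮ, ∀ y' ∈ nᗮ, μ.1 z (μ.1 y y') = 0) {z : E} (hz : z ∈ c)
    {w w' : E} (hw : w ∈ n) (hw' : w' ∈ n) : (rep (adTrunc μ n z)ᵗ μ).1 w w' = 0 := by
  obtain ⟨m, a, -, -, hspan, hrep⟩ := h.exists_family_of_eigenvalue_nonpos le_rfl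
    (fun z hz => by rw [hc z hz, zero_smul]) hcY hcYY
  obtain ⟨t, ht⟩ := hspan z hz
  have h1 : (adTrunc μ n z)ᵗ = ∑ k, t k • (adTrunc μ n (a k))ᵗ := by
    rw [ht, map_sum]
    simp
  have h2 : rep (adTrunc μ n z)ᵗ μ = ∑ k, t k • rep (adTrunc μ n (a k))ᵗ μ := by
    rw [h1, map_sum, LinearMap.sum_apply]
    simp only [map_smul, LinearMap.smul_apply]
  have h3 : (∑ k, t k • rep (adTrunc μ n (a k))ᵗ μ).1 w w' =
      ∑ k, t k • (rep (adTrunc μ n (a k))ᵗ μ).1 w w' := by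
    rw [Submodule.coe_sum]
    simp only [sum_apply, Submodule.coe_smul, smul_apply]
  rw [h2, h3]
  exact Finset.sum_eq_zero fun k _ => by rw [hrep k w hw w' hw', smul_zero]

theorem isNilpotent_adTrunc (h : NilpotentIdeal β μ n) {z : E} (hz : z ∈ n) :
    IsNilpotent (adTrunc μ n z) := by
  obtain ⟨k, hk⟩ := h.isNilpotent z hz
  have hp : ∀ m : ℕ, (adTrunc μ n z) ^ (m + 1) = ad μ z ^ (m + 1) * n.starProjection := by
    intro m
    induction m with
    | zero => rw [zero_add, pow_one, pow_one, adTrunc]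
    | succ m ih =>
      rw [pow_succ', ih]
      refine ext_of_mem_orthogonal n (fun w hw => ?_) fun v hv => ?_
      · have : (ad μ z ^ (m + 1)) w ∈ n := by
          rw [pow_succ']
          exact h.bracket_mem _ _
        simp only [mul_apply_eq_comp, Submodule.starProjection_eq_self_iff.2 hw]
        rw [adTrunc_apply_mem μ _ this, pow_succ' _ (m + 1)]
        rfl
      · simp only [mul_apply_eq_comp, (Submodule.starProjection_apply_eq_zero_iff _).2 hv, map_zero]
  exact ⟨k + 1, by rw [hp, pow_succ, hk, zero_mul, zero_mul]⟩

/-- If the zero eigenspace of `β⁺` in `n` were non-zero, it would contain a non-zero element `v` of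
its own centre. The averaging result with `l = 0` makes the truncated `ad v` normal; being nilpotent
it vanishes, and `eq_zero_of_central` gives `v = 0`. -/
theorem eq_zero_of_betaPlus_eq_zero (h : NilpotentIdeal β μ n) {z : E} (hz : z ∈ n)
    (hz0 : betaPlus β z = 0) : z = 0 := by
  let n₀ : Submodule ℝ E := n ⊓ LinearMap.ker (betaPlus β : E →ₗ[ℝ] E)
  have hn₀ : ∀ x, x ∈ n₀ ↔ x ∈ n ∧ betaPlus β x = 0 := fun x => Iff.rfl
  have hbr : ∀ x y, betaPlus β x = 0 → betaPlus β y = 0 → μ.1 x y ∈ n₀ := fun x y hx hy => by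
    refine (hn₀ _).2 ⟨h.bracket_mem x y, ?_⟩
    rw [h.isDerivation, hx, hy]
    simp
  by_contra hne
  obtain ⟨v, hv, hv0, hvc⟩ := h.exists_central n₀ inf_le_left
    (fun h0 => hne (by
      have : z ∈ n₀ := ⟨hz, hz0⟩
      rw [h0] at this
      exact this))
    fun x hx y hy => hbr x y hx.2 hy.2
  -- The centre of `n₀`. Brackets of elements of `nᗮ` fall into `n₀`, so this choice supplies the
  -- vanishing on `nᗮ × nᗮ` before `nᗮ` is known to be abelian.
  let c : Submodule ℝ E :=
    { carrier := {z | z ∈ n₀ ∧ ∀ x ∈ n₀, μ.1 x z = 0}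
      add_mem' := by
        rintro x y ⟨hx, hx'⟩ ⟨hy, hy'⟩
        exact ⟨add_mem hx hy, fun w hw => by rw [map_add, hx' w hw, hy' w hw, add_zero]⟩
      zero_mem' := ⟨zero_mem _, fun w _ => by simp⟩
      smul_mem' := by
        rintro t x ⟨hx, hx'⟩
        exact ⟨n₀.smul_mem t hx, fun w hw => by rw [map_smul, hx' w hw, smul_zero]⟩ }
  have hcY : ∀ y ∈ nᗮ, ∀ z ∈ c, μ.1 y z ∈ c := by
    rintro y hy z ⟨hz, hz'⟩
    have hy0 := h.betaPlus_orthogonal hy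
    refine ⟨hbr y z hy0 hz.2, fun x hx => ?_⟩
    have := h.isLie x y z
    rwa [hz' x hx, map_zero, add_zero, hz' _ (hbr x y hx.2 hy0)] at this
  have hcYY : ∀ z ∈ c, ∀ y ∈ nᗮ, ∀ y' ∈ nᗮ, μ.1 z (μ.1 y y') = 0 := by
    rintro z ⟨hz, hz'⟩ y hy y' hy'
    rw [bracket_skew, hz' _ (hbr y y' (h.betaPlus_orthogonal hy) (h.betaPlus_orthogonal hy')),
      neg_zero]
  have hvn : v ∈ n := hv.1
  have hrep := fun {w w' : E} (hw : w ∈ n) (hw' : w' ∈ n) =>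
    h.rep_adjoint_adTrunc_apply (c := c) (fun z hz => hz.1.2) hcY hcYY (z := v) ⟨hv, hvc⟩ hw hw'
  set A := adTrunc μ n v with hA
  have hAo : ∀ y ∈ nᗮ, A y = 0 := fun y hy => adTrunc_apply_orthogonal μ _ hy
  have hcomm : Aᵗ * A - A * Aᵗ = adTrunc μ n (Aᵗ v) := by
    refine ext_of_mem_orthogonal n (fun w hw => ?_) fun y hy => ?_
    · have h1 := hrep hvn hw
      rw [rep_apply] at h1
      rw [sub_apply, mul_apply_eq_comp, mul_apply_eq_comp, adTrunc_apply_mem μ _ hw,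
        hA, adTrunc_apply_mem μ _ hw, ← hA,
        adTrunc_apply_mem μ _ (adjoint_mem_of_apply_orthogonal hAo w)]
      rw [sub_right_comm] at h1
      exact sub_eq_zero.1 h1
    · have h0 : Aᵗ y = 0 := adjoint_apply_orthogonal (h.adTrunc_mem v) hy
      simp only [sub_apply, mul_apply_eq_comp, hAo y hy, adTrunc_apply_orthogonal μ _ hy,
        h0, map_zero, sub_zero]
  -- The commutator is symmetric, and it is nilpotent as the truncated adjoint map of an element of
  -- `n`.
  have hz1 : Aᵗ * A - A * Aᵗ = 0 := by
    refine eq_zero_of_isNilpotent_of_adjoint_eq ?_ ?_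
    · rw [map_sub, adjoint_mul, adjoint_mul, ContinuousLinearMap.adjoint_adjoint]
    · rw [hcomm]
      exact h.isNilpotent_adTrunc (adjoint_mem_of_apply_orthogonal hAo v)
  have hA0 : A = 0 := eq_zero_of_isNilpotent_of_commute (sub_eq_zero.1 hz1)
    (h.isNilpotent_adTrunc hvn)
  refine hv0 (h.eq_zero_of_central h.glInner_pos hvn (by rw [zero_smul]; exact hv.2) ?_)
  intro w hw
  rw [← adTrunc_apply_mem μ v hw, ← hA, hA0]
  rfl

theorem bracket_orthogonal (h : NilpotentIdeal β μ n) {y y' : E} (hy : y ∈ nᗮ) (hy' : y' ∈ nᗮ) :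
    μ.1 y y' = 0 := by
  refine h.eq_zero_of_betaPlus_eq_zero (h.bracket_mem _ _) ?_
  rw [h.isDerivation, h.betaPlus_orthogonal hy, h.betaPlus_orthogonal hy']
  simp

/-- Now that `nᗮ` is abelian, the averaging result applies to a whole negative eigenspace. Its
elements centralize `n`, which `eq_zero_of_central` excludes. -/
theorem eq_zero_of_eigenvalue_nonpos (h : NilpotentIdeal β μ n) {l : ℝ} (hl : l ≤ 0) {z : E}
    (hz : z ∈ n) (hzl : betaPlus β z = l • z) : z = 0 := by
  rcases hl.lt_or_eq with hl | rfl
  · let c : Submodule ℝ E := n ⊓ LinearMap.ker ((betaPlus β : E →ₗ[ℝ] E) - l • LinearMap.id)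
    have hc : ∀ x, x ∈ c ↔ x ∈ n ∧ betaPlus β x = l • x := fun x => by
      rw [← sub_eq_zero]
      exact Iff.rfl
    refine h.eq_zero_of_central (hl.trans h.glInner_pos) hz hzl fun w hw => ?_
    rw [← adTrunc_apply_mem μ z hw, h.adTrunc_eq_zero_of_eigenvalue_neg (c := c) hl
      (fun x hx => ((hc x).1 hx).2) (fun y hy x hx => (hc _).2 ⟨h.bracket_mem _ _, ?_⟩)
      (fun x _ y hy y' hy' => by rw [h.bracket_orthogonal hy hy', map_zero])
      ((hc z).2 ⟨hz, hzl⟩)]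
    · rfl
    · rw [h.isDerivation, h.betaPlus_orthogonal hy, ((hc x).1 hx).2]
      simp
  · exact h.eq_zero_of_betaPlus_eq_zero hz (by rw [hzl, zero_smul])

end NilpotentIdeal

end Structure

/-! ### The action of `nᗮ`, the Killing form, and the Hessian as a sum of squares -/

section Structure

variable {E : Type*} [NormedAddCommGroup E] [InnerProductSpace ℝ E] [FiniteDimensional ℝ E]

namespace NilpotentIdeal

variable {β : E →L[ℝ] E} {μ : BracketSpace E} {n : Submodule ℝ E}

/-- Truncation discards only brackets within `nᗮ`, which have been shown to vanish. -/
theorem adTrunc_eq_ad (h : NilpotentIdeal β μ n) {y : E} (hy : y ∈ nᗮ) :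
    adTrunc μ n y = ad μ y := by
  refine ext_of_mem_orthogonal n (fun w hw => adTrunc_apply_mem μ y hw) fun v hv => ?_
  rw [adTrunc_apply_orthogonal μ y hv]
  exact (h.bracket_orthogonal hy hv).symm

/-- The transposes of the `ad y`, `y ∈ nᗮ`, are derivations. -/
theorem rep_adjoint_ad (h : NilpotentIdeal β μ n) {y : E} (hy : y ∈ nᗮ) :
    rep (ad μ y)ᵗ μ = 0 := by
  -- Here `[β, ad y] = ad (β⁺ y) = 0` and `π(ad y)μ = 0`, so the identity leaves only `|π((ad
  -- y)ᵗ)μ|²`.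
  have h1 := h.glInner_commutator (A := ad μ y) (fun x => h.bracket_mem y x)
    fun v hv => h.bracket_orthogonal hy hv
  rw [← betaPlus_commutator, ← h.isDerivation.ad_apply, h.betaPlus_orthogonal hy,
    isDerivation_iff.1 (isDerivation_ad h.isLie y)] at h1
  refine bracketInner_self_eq_zero ?_
  simpa using h1.symm

theorem adjoint_ad_commute (h : NilpotentIdeal β μ n) {y y' : E} (hy : y ∈ nᗮ) (hy' : y' ∈ nᗮ) :
    (ad μ y)ᵗ * ad μ y' = ad μ y' * (ad μ y)ᵗ := by
  have h1 := (isDerivation_iff.2 (h.rep_adjoint_ad hy)).ad_apply y'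
  rw [adjoint_apply_orthogonal (fun x => h.bracket_mem y x) hy',
    show ad μ 0 = 0 from map_zero μ.1] at h1
  exact sub_eq_zero.1 h1.symm

/-- On `nᗮ` one has `β = -‖β‖²`, and no bracket has a component along `y`, so the moment part
contributes only `-½ |ad y|²`; solve `Ric* = β` for the Killing term. -/
theorem inner_killing_orthogonal (h : NilpotentIdeal β μ n) {y : E} (hy : y ∈ nᗮ) :
    ⟪killing μ y, y⟫_ℝ = 2 * glInner β β * ⟪y, y⟫_ℝ - glInner (ad μ y) (ad μ y) := by
  have h1 : ⟪β y, y⟫_ℝ = -(glInner β β * ⟪y, y⟫_ℝ) := by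
    have := h.betaPlus_orthogonal hy
    rw [betaPlus_apply] at this
    rw [eq_neg_of_add_eq_zero_left this, inner_neg_left, real_inner_smul_left]
  have h2 : ⟪β y, y⟫_ℝ = ⟪momentPart μ y, y⟫_ℝ - 1 / 2 * ⟪killing μ y, y⟫_ℝ := by
    conv_lhs => rw [← h.ricMod_eq]
    rw [ricMod, sub_apply, smul_apply, inner_sub_left, real_inner_smul_left]
  have h3 : ∀ x x', ⟪μ.1 x x', y⟫_ℝ = 0 := fun x x' =>
    Submodule.inner_right_of_mem_orthogonal (h.bracket_mem x x') hy
  rw [inner_momentPart (stdOrthonormalBasis ℝ E)] at h2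
  simp only [h3] at h2
  norm_num at h2
  linarith

theorem mem_orthogonal_of_betaPlus_eq_zero (h : NilpotentIdeal β μ n) {x : E}
    (hx : betaPlus β x = 0) : x ∈ nᗮ := by
  obtain ⟨w, hw, y, hy, rfl⟩ := n.exists_add_mem_mem_orthogonal x
  rw [map_add, h.betaPlus_orthogonal hy, add_zero] at hx
  rwa [h.eq_zero_of_betaPlus_eq_zero hw hx, zero_add]

theorem apply_mem_orthogonal_of_commute (h : NilpotentIdeal β μ n) {A : E →L[ℝ] E}
    (hA : β * A = A * β) {y : E} (hy : y ∈ nᗮ) : A y ∈ nᗮ := by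
  refine h.mem_orthogonal_of_betaPlus_eq_zero ?_
  have h1 := betaPlus_commutator β A
  rw [hA, sub_self, sub_eq_zero] at h1
  have h2 : (betaPlus β * A) y = (A * betaPlus β) y := by rw [h1]
  rw [mul_apply_eq_comp, mul_apply_eq_comp, h.betaPlus_orthogonal hy, map_zero] at h2
  exact h2

theorem apply_mem_of_commute (h : NilpotentIdeal β μ n) {A : E →L[ℝ] E} (hA : Aᵗ = A)
    (hAβ : β * A = A * β) {w : E} (hw : w ∈ n) : A w ∈ n := by
  rw [← n.orthogonal_orthogonal]
  intro y hy
  rw [← hA, ContinuousLinearMap.adjoint_inner_right]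
  exact Submodule.inner_left_of_mem_orthogonal hw (h.apply_mem_orthogonal_of_commute hAβ hy)

/-- Since `B β⁺ = 0`, the image of `(B A)ᵗ` consists of eigenvectors of `β⁺` for `-r < 0`. These lie
in `n`, where no such eigenvalue occurs. -/
theorem killing_mul_eq_zero_of_eigenvalue_pos (h : NilpotentIdeal β μ n) {A : E →L[ℝ] E} {r : ℝ}
    (hr : 0 < r) (hA : β * A - A * β = r • A) : killing μ * A = 0 := by
  rw [← betaPlus_commutator] at hA
  have h1 : killing μ * A * betaPlus β = (-r) • (killing μ * A) := by
    have h2 := congrArg (killing μ * ·) hA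
    simp only [mul_sub] at h2
    rw [← mul_assoc, h.killing_mul h.betaPlus_mem, zero_mul, zero_sub, mul_smul_comm,
      ← mul_assoc] at h2
    rw [neg_smul, ← h2, neg_neg]
  have h3 : betaPlus β * (killing μ * A)ᵗ = (-r) • (killing μ * A)ᵗ := by
    have h4 := congrArg ContinuousLinearMap.adjoint h1
    rw [adjoint_mul _ (betaPlus β), adjoint_betaPlus h.adjoint_eq, map_smulₛₗ] at h4
    exact h4
  have h5 : (killing μ * A)ᵗ = 0 := by
    ext x
    have h6 : betaPlus β ((killing μ * A)ᵗ x) = (-r) • ((killing μ * A)ᵗ x) :=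
      congrArg (fun C : E →L[ℝ] E => C x) h3
    refine h.eq_zero_of_eigenvalue_nonpos (neg_nonpos.2 hr.le) ?_ h6
    have h7 : (killing μ * A)ᵗ x = (-r)⁻¹ • betaPlus β ((killing μ * A)ᵗ x) := by
      rw [h6, smul_smul, inv_mul_cancel₀ (neg_ne_zero.2 hr.ne'), one_smul]
    rw [h7]
    exact n.smul_mem _ (h.betaPlus_mem _)
  rw [← ContinuousLinearMap.adjoint_adjoint (killing μ * A), h5, map_zero]

theorem killing_mul_eq_zero_of_mem_uAlg (h : NilpotentIdeal β μ n) {A : E →L[ℝ] E}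
    (hA : A ∈ uAlg β) : killing μ * A = 0 := by
  have hle : uAlg β ≤ LinearMap.ker (LinearMap.mulLeft ℝ (killing μ)) :=
    iSup₂_le fun r hr X hX => h.killing_mul_eq_zero_of_eigenvalue_pos hr
      (Module.End.mem_eigenspace_iff.1 hX)
  exact hle hA

variable {κ ι : Type*} [Fintype κ] [Fintype ι]

theorem glInner_killing_mul_self (h : NilpotentIdeal β μ n) (b : OrthonormalBasis (κ ⊕ ι) ℝ E)
    (hbY : ∀ j, b (Sum.inl j) ∈ nᗮ) (hbW : ∀ i, b (Sum.inr i) ∈ n) {A : E →L[ℝ] E} (hA : Aᵗ = A)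
    (hAβ : β * A = A * β) :
    glInner (killing μ * A) A = ∑ j, (2 * glInner β β * ⟪A (b (Sum.inl j)), A (b (Sum.inl j))⟫_ℝ
      - glInner (ad μ (A (b (Sum.inl j)))) (ad μ (A (b (Sum.inl j))))) := by
  rw [glInner_eq_sum b, Fintype.sum_sum_type]
  have h1 : ∀ i, ⟪(killing μ * A) (b (Sum.inr i)), A (b (Sum.inr i))⟫_ℝ = 0 := fun i => by
    rw [mul_apply_eq_comp, h.killing_eq _ (h.apply_mem_of_commute hA hAβ (hbW i)), inner_zero_left]
  simp only [h1, Finset.sum_const_zero, add_zero]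
  refine Finset.sum_congr rfl fun j _ => ?_
  rw [mul_apply_eq_comp, h.inner_killing_orthogonal (h.apply_mem_orthogonal_of_commute hAβ (hbY j))]

/-- Pythagoras: `[A, ad y]` is orthogonal to `ad y'` because `(ad y)ᵗ` and `ad y'` commute. -/
theorem glInner_sub_ad_self (h : NilpotentIdeal β μ n) {y y' : E} (hy : y ∈ nᗮ) (hy' : y' ∈ nᗮ)
    (A : E →L[ℝ] E) :
    glInner (A * adTrunc μ n y - adTrunc μ n y * A - adTrunc μ n y')
        (A * adTrunc μ n y - adTrunc μ n y * A - adTrunc μ n y') =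
      glInner (A * adTrunc μ n y - adTrunc μ n y * A) (A * adTrunc μ n y - adTrunc μ n y * A)
        + glInner (ad μ y') (ad μ y') := by
  rw [h.adTrunc_eq_ad hy, h.adTrunc_eq_ad hy']
  have h1 : glInner (A * ad μ y - ad μ y * A) (ad μ y') = 0 := by
    rw [glInner_sub_left, glInner_mul_right, glInner_mul_left (ad μ y), h.adjoint_ad_commute hy hy',
      sub_self]
  generalize A * ad μ y - ad μ y * A = X at h1 ⊢
  rw [glInner_sub_left, glInner_sub_right, glInner_sub_right, glInner_comm (ad μ y') X, h1]
  ring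

/-- The mixed block of `½ |π(A)μ|²` contributes `∑ |ad (A yⱼ)|²`, which cancels the negative part of
the Killing term. Every remaining summand is nonnegative. -/
theorem hessian_eq (h : NilpotentIdeal β μ n) (b : OrthonormalBasis (κ ⊕ ι) ℝ E)
    (hbY : ∀ j, b (Sum.inl j) ∈ nᗮ) (hbW : ∀ i, b (Sum.inr i) ∈ n) {A : E →L[ℝ] E} (hA : Aᵗ = A)
    (hAβ : β * A = A * β) :
    1 / 2 * bracketInner (rep A μ) (rep A μ) + glInner (killing μ * A) A =
      1 / 2 * ∑ j, ∑ j', ⟪(rep A μ).1 (b (Sum.inl j)) (b (Sum.inl j')),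
          (rep A μ).1 (b (Sum.inl j)) (b (Sum.inl j'))⟫_ℝ
      + ∑ j, glInner (A * adTrunc μ n (b (Sum.inl j)) - adTrunc μ n (b (Sum.inl j)) * A)
            (A * adTrunc μ n (b (Sum.inl j)) - adTrunc μ n (b (Sum.inl j)) * A)
      + 2 * glInner β β * ∑ j, ⟪A (b (Sum.inl j)), A (b (Sum.inl j))⟫_ℝ
      + 1 / 2 * ∑ i, ∑ i', ⟪(rep A μ).1 (b (Sum.inr i)) (b (Sum.inr i')),
          (rep A μ).1 (b (Sum.inr i)) (b (Sum.inr i'))⟫_ℝ := by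
  have hAY : ∀ j, A (b (Sum.inl j)) ∈ nᗮ := fun j => h.apply_mem_orthogonal_of_commute hAβ (hbY j)
  rw [bracketInner_rep_self_eq_blocks b hbY hbW (fun w hw => h.apply_mem_of_commute hA hAβ hw)
    fun y hy => h.apply_mem_orthogonal_of_commute hAβ hy, h.glInner_killing_mul_self b hbY hbW hA hAβ]
  simp only [h.glInner_sub_ad_self (hbY _) (hAY _), Finset.sum_add_distrib,
    Finset.sum_sub_distrib]
  rw [← Finset.mul_sum]
  ring

/-- The quadratic form `½ |π(A)μ|² + tr(B A²)` is nonnegative on the symmetric endomorphisms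
commuting with `β`, and vanishes only on derivations. -/
theorem hessian_nonneg (h : NilpotentIdeal β μ n) {A : E →L[ℝ] E} (hA : Aᵗ = A)
    (hAβ : β * A = A * β) :
    0 ≤ 1 / 2 * bracketInner (rep A μ) (rep A μ) + glInner (killing μ * A) A ∧
      (1 / 2 * bracketInner (rep A μ) (rep A μ) + glInner (killing μ * A) A = 0 →
        rep A μ = 0) := by
  obtain ⟨p, q, b, hbY, hbW⟩ := exists_adapted_basis n
  have h1 : 0 ≤ ∑ j, ∑ j', ⟪(rep A μ).1 (b (Sum.inl j)) (b (Sum.inl j')),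
      (rep A μ).1 (b (Sum.inl j)) (b (Sum.inl j'))⟫_ℝ :=
    Finset.sum_nonneg fun _ _ => Finset.sum_nonneg fun _ _ => real_inner_self_nonneg
  have h2 : 0 ≤ ∑ j, glInner (A * adTrunc μ n (b (Sum.inl j)) - adTrunc μ n (b (Sum.inl j)) * A)
      (A * adTrunc μ n (b (Sum.inl j)) - adTrunc μ n (b (Sum.inl j)) * A) :=
    Finset.sum_nonneg fun _ _ => glInner_self_nonneg _
  have h3 : 0 ≤ ∑ j, ⟪A (b (Sum.inl j)), A (b (Sum.inl j))⟫_ℝ :=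
    Finset.sum_nonneg fun _ _ => real_inner_self_nonneg
  have h3' : 0 ≤ 2 * glInner β β * ∑ j, ⟪A (b (Sum.inl j)), A (b (Sum.inl j))⟫_ℝ :=
    mul_nonneg (by linarith [h.glInner_pos]) h3
  have h4 : 0 ≤ ∑ i, ∑ i', ⟪(rep A μ).1 (b (Sum.inr i)) (b (Sum.inr i')),
      (rep A μ).1 (b (Sum.inr i)) (b (Sum.inr i'))⟫_ℝ :=
    Finset.sum_nonneg fun _ _ => Finset.sum_nonneg fun _ _ => real_inner_self_nonneg
  rw [h.hessian_eq b hbY hbW hA hAβ]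
  refine ⟨by linarith, fun h0 => bracketInner_self_eq_zero ?_⟩
  -- Since `‖β‖² > 0`, the Killing square forces `A = 0` on `nᗮ`; the correction `ad (A y)` then
  -- drops out, and the other squares are exactly the blocks of `|π(A)μ|²`.
  have hY0 : ∑ j, ⟪A (b (Sum.inl j)), A (b (Sum.inl j))⟫_ℝ = 0 := by
    have : 2 * glInner β β * ∑ j, ⟪A (b (Sum.inl j)), A (b (Sum.inl j))⟫_ℝ = 0 := by linarith
    exact (mul_eq_zero.1 this).resolve_left (by linarith [h.glInner_pos])
  have hY : ∀ j, A (b (Sum.inl j)) = 0 := fun j => by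
    rw [Finset.sum_eq_zero_iff_of_nonneg fun j _ => real_inner_self_nonneg] at hY0
    exact inner_self_eq_zero.1 (hY0 j (Finset.mem_univ _))
  have h0' : adTrunc μ n 0 = 0 := by simp [adTrunc]
  rw [bracketInner_rep_self_eq_blocks b hbY hbW (fun w hw => h.apply_mem_of_commute hA hAβ hw)
    fun y hy => h.apply_mem_orthogonal_of_commute hAβ hy]
  simp only [hY, h0', sub_zero]
  linarith

end NilpotentIdeal

end Structure

/-! ### The derivative of the vector field of the flow -/

section Derivative

variable {E : Type*} [NormedAddCommGroup E] [InnerProductSpace ℝ E] [FiniteDimensional ℝ E]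

/-- The bilinear map with diagonal `momentForm`. -/
noncomputable def momentBilin :
    BracketSpace E →ₗ[ℝ] BracketSpace E →ₗ[ℝ] (E →L[ℝ] E) :=
  LinearMap.mk₂ ℝ (fun μ ν => (∑ i, ∑ j, InnerProductSpace.rankOne ℝ
      (μ.1 (stdOrthonormalBasis ℝ E i) (stdOrthonormalBasis ℝ E j))
      (ν.1 (stdOrthonormalBasis ℝ E i) (stdOrthonormalBasis ℝ E j)))
    - (2 : ℝ) • ∑ i, (ad μ (stdOrthonormalBasis ℝ E i))ᵗ * ad ν (stdOrthonormalBasis ℝ E i))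
    (by
      intro μ μ' ν
      simp only [ad, Submodule.coe_add, add_apply, map_add, Finset.sum_add_distrib, add_mul, smul_add]
      abel)
    (by
      intro c μ ν
      simp only [ad, Submodule.coe_smul, smul_apply, map_smul, ← Finset.smul_sum,
        smul_mul_assoc, smul_sub]
      rw [smul_comm c])
    (by
      intro μ ν ν'
      simp only [ad, Submodule.coe_add, add_apply, map_add, Finset.sum_add_distrib, mul_add, smul_add]
      abel)
    (by
      intro c μ ν
      simp only [ad, Submodule.coe_smul, smul_apply, map_smul, ← Finset.smul_sum,
        mul_smul_comm, smul_sub]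
      rw [smul_comm c])

/-- The bilinear map with diagonal `killing`. -/
noncomputable def killingBilin :
    BracketSpace E →ₗ[ℝ] BracketSpace E →ₗ[ℝ] (E →L[ℝ] E) :=
  LinearMap.mk₂ ℝ (fun μ ν => ∑ i, ∑ j,
      tr (ad μ (stdOrthonormalBasis ℝ E i) * ad ν (stdOrthonormalBasis ℝ E j)) •
        InnerProductSpace.rankOne ℝ (stdOrthonormalBasis ℝ E j) (stdOrthonormalBasis ℝ E i))
    (by
      intro μ μ' ν
      simp only [ad, Submodule.coe_add, add_apply, add_mul, tr_add, add_smul,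
        Finset.sum_add_distrib])
    (by
      intro c μ ν
      simp only [ad, Submodule.coe_smul, smul_apply, smul_mul_assoc, tr_smul, mul_smul,
        Finset.smul_sum])
    (by
      intro μ ν ν'
      simp only [ad, Submodule.coe_add, add_apply, mul_add, tr_add, add_smul,
        Finset.sum_add_distrib])
    (by
      intro c μ ν
      simp only [ad, Submodule.coe_smul, smul_apply, mul_smul_comm, tr_smul, mul_smul,
        Finset.smul_sum])

theorem momentBilin_self (μ : BracketSpace E) : momentBilin μ μ = momentForm μ := rfl

theorem killingBilin_self (μ : BracketSpace E) : killingBilin μ μ = killing μ := by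
  ext x
  have h : ∀ i, killing μ (stdOrthonormalBasis ℝ E i) = ∑ j,
      tr (ad μ (stdOrthonormalBasis ℝ E i) * ad μ (stdOrthonormalBasis ℝ E j)) •
        stdOrthonormalBasis ℝ E j := fun i => rfl
  have hx : killing μ x = ∑ i, ⟪stdOrthonormalBasis ℝ E i, x⟫_ℝ •
      killing μ (stdOrthonormalBasis ℝ E i) := by
    conv_lhs => rw [← (stdOrthonormalBasis ℝ E).sum_repr' x]
    simp only [map_sum, map_smul]
  rw [hx]
  simp only [killingBilin, LinearMap.mk₂_apply, sum_apply, smul_apply,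
    InnerProductSpace.rankOne_apply, h, Finset.smul_sum]
  exact Finset.sum_congr rfl fun i _ => Finset.sum_congr rfl fun j _ => smul_comm _ _ _

/-- The normed space structure of `V(E)`. -/
noncomputable abbrev normedSpaceBracketSpace : NormedSpace ℝ (BracketSpace E) :=
  { (inferInstance : Module ℝ (BracketSpace E)) with
    norm_smul_le := fun c x => ContinuousLinearMap.opNorm_smul_le c x.1 }

theorem hasFDerivAt_bilinear {V U W Z : Type*} [NormedAddCommGroup V] [NormedSpace ℝ V]
    [FiniteDimensional ℝ V] [NormedAddCommGroup W] [NormedSpace ℝ W] [FiniteDimensional ℝ W]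
    [NormedAddCommGroup U] [NormedSpace ℝ U] [FiniteDimensional ℝ U]
    [NormedAddCommGroup Z] [NormedSpace ℝ Z]
    (Q : U →ₗ[ℝ] W →ₗ[ℝ] Z) {f : V → U} {g : V → W} {f' : V →L[ℝ] U} {g' : V →L[ℝ] W} {μ : V}
    (hf : HasFDerivAt f f' μ) (hg : HasFDerivAt g g' μ) :
    ∃ D : V →L[ℝ] Z, HasFDerivAt (fun ν => Q (f ν) (g ν)) D μ ∧
      ∀ v, D v = Q (f μ) (g' v) + Q (f' v) (g μ) :=
  ⟨_, Q.toContinuousBilinearMap.hasFDerivAt_of_bilinear hf hg, fun _ => rfl⟩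

/-- As `ricMod` is the diagonal of a bilinear map, its derivative is the polarization. This form
makes the derivative computable by trace identities. -/
theorem exists_hasFDerivAt_ricMod (μ : BracketSpace E) :
    ∃ D : BracketSpace E →L[ℝ] (E →L[ℝ] E), HasFDerivAt ricMod D μ ∧
      ∀ v, D v = ricMod (μ + v) - ricMod μ - ricMod v := by
  let Q : BracketSpace E →ₗ[ℝ] BracketSpace E →ₗ[ℝ] (E →L[ℝ] E) :=
    (1 / 4 : ℝ) • momentBilin - (1 / 2 : ℝ) • killingBilin
  have hQ : ∀ ν : BracketSpace E, ricMod ν = Q ν ν := fun ν => by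
    rw [ricMod, momentPart_eq, ← momentBilin_self, ← killingBilin_self]
    rfl
  let _ : NormedSpace ℝ (BracketSpace E) := normedSpaceBracketSpace
  obtain ⟨D, hD, hDv⟩ := hasFDerivAt_bilinear (V := BracketSpace E)
    (U := BracketSpace E) (W := BracketSpace E) (Z := E →L[ℝ] E) Q (hasFDerivAt_id μ)
    (hasFDerivAt_id μ)
  refine ⟨D, ?_, fun v => ?_⟩
  · rw [funext hQ]
    exact hD
  · rw [hDv, hQ, hQ, hQ, map_add (Q (μ + v)), map_add Q, LinearMap.add_apply, LinearMap.add_apply]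
    change Q μ v + Q v μ = _
    abel

theorem exists_hasFDerivAt_flowField (β : E →L[ℝ] E) (μ : BracketSpace E) :
    ∃ X : BracketSpace E →L[ℝ] BracketSpace E, HasFDerivAt (flowField β) X μ ∧
      ∀ v, X v = -rep (qProj β (ricMod (μ + v) - ricMod μ - ricMod v) +
          (2 * glInner (ricMod μ) (ricMod (μ + v) - ricMod μ - ricMod v)) • (1 : E →L[ℝ] E)) μ
        - rep (qProj β (ricMod μ) + glInner (ricMod μ) (ricMod μ) • (1 : E →L[ℝ] E)) v := by
  let _ : NormedSpace ℝ (BracketSpace E) := normedSpaceBracketSpace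
  obtain ⟨D, hD, hDv⟩ := exists_hasFDerivAt_ricMod μ
  obtain ⟨D₁, hD₁, hDv₁⟩ := hasFDerivAt_bilinear (V := BracketSpace E)
    (U := E →L[ℝ] E) (W := E →L[ℝ] E) (Z := ℝ) (glForm (E := E)) hD hD
  have hq : HasFDerivAt (fun ν => qProj β (ricMod ν))
      ((LinearMap.toContinuousLinearMap (qProj β)).comp D) μ :=
    (LinearMap.toContinuousLinearMap (qProj β)).hasFDerivAt.comp μ hD
  have hf := hq.add (hD₁.smul_const (1 : E →L[ℝ] E))
  obtain ⟨X, hX, hXv⟩ := hasFDerivAt_bilinear (V := BracketSpace E)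
    (U := E →L[ℝ] E) (W := BracketSpace E) (Z := BracketSpace E) (rep (E := E)) hf
    (hasFDerivAt_id μ)
  refine ⟨-X, hX.neg, fun v => ?_⟩
  have h1 : ∀ C : E →L[ℝ] E, glForm C (ricMod μ) = glForm (ricMod μ) C := fun C =>
    glInner_comm _ _
  change -(X v) = _
  rw [hXv, ← hDv]
  change -(rep (qProj β (ricMod μ) + glInner (ricMod μ) (ricMod μ) • (1 : E →L[ℝ] E)) v +
    rep (qProj β (D v) + D₁ v • (1 : E →L[ℝ] E)) μ) = _
  rw [hDv₁, h1, ← two_mul, glForm_apply]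
  abel

end Derivative

section Linearization

variable {E : Type*} [NormedAddCommGroup E] [InnerProductSpace ℝ E] [FiniteDimensional ℝ E]

/-! ### The derivative of the modified Ricci curvature along orbits -/

theorem glInner_momentPart_polar (μ ν : BracketSpace E) (C : E →L[ℝ] E) :
    glInner (momentPart (μ + ν) - momentPart μ - momentPart ν) C =
      1 / 4 * (bracketInner (rep C μ) ν + bracketInner (rep C ν) μ) := by
  rw [glInner_sub_left, glInner_sub_left, glInner_momentPart, glInner_momentPart,
    glInner_momentPart, map_add, bracketInner_add_left, bracketInner_add_right,
    bracketInner_add_right]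
  ring

/-- The conjugation terms `A ad x - ad x A` cancel under the trace; only the changes of the
arguments, `ad (A x)` and `ad (A y)`, remain. -/
theorem killing_polar_rep (μ : BracketSpace E) (A : E →L[ℝ] E) :
    killing (μ + rep A μ) - killing μ - killing (rep A μ) = -(Aᵗ * killing μ + killing μ * A) := by
  ext x
  refine ext_inner_right ℝ fun y => ?_
  have e : ∀ v, ad (μ + rep A μ) v = ad μ v + (A * ad μ v - ad μ (A v) - ad μ v * A) :=
    fun v => rfl
  simp only [sub_apply, neg_apply, add_apply, mul_apply_eq_comp, inner_sub_left, inner_neg_left,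
    inner_add_left, ContinuousLinearMap.adjoint_inner_left, inner_killing, ad_rep, e]
  simp only [add_mul, mul_add, sub_mul, mul_sub, tr_add, tr_sub]
  have h1 : tr (A * ad μ x * ad μ y) = tr (ad μ x * (ad μ y * A)) := by
    rw [mul_assoc, tr_mul_comm, mul_assoc]
  have h2 : tr (ad μ x * A * ad μ y) = tr (ad μ x * (A * ad μ y)) := by rw [mul_assoc]
  rw [h1, h2]
  ring

theorem ricMod_polar (μ ν : BracketSpace E) :
    ricMod (μ + ν) - ricMod μ - ricMod ν = (momentPart (μ + ν) - momentPart μ - momentPart ν)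
      - (1 / 2 : ℝ) • (killing (μ + ν) - killing μ - killing ν) := by
  simp only [ricMod]
  module

theorem glInner_ricMod_polar_rep (μ : BracketSpace E) (A C : E →L[ℝ] E) :
    glInner (ricMod (μ + rep A μ) - ricMod μ - ricMod (rep A μ)) C =
      1 / 4 * (bracketInner (rep A μ) (rep C μ) + bracketInner (rep A μ) (rep Cᵗ μ))
        + 1 / 2 * glInner (Aᵗ * killing μ + killing μ * A) C := by
  have e := ricMod_polar μ (rep A μ)
  rw [e, killing_polar_rep, glInner_sub_left, glInner_momentPart_polar, glInner_smul_left,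
    glInner_neg_left, bracketInner_comm (rep C μ), bracketInner_rep_left C (rep A μ)]
  ring

/-! ### Orthogonality of the eigenspaces of `ad(β)` -/

theorem mem_gAlg_iff {β A : E →L[ℝ] E} : A ∈ gAlg β ↔ β * A = A * β := by
  rw [gAlg, Module.End.mem_eigenspace_iff, zero_smul]
  exact sub_eq_zero

theorem gAlg_le (β : E →L[ℝ] E) :
    gAlg β ≤ ⨆ r ∈ ({0} : Set ℝ), Module.End.eigenspace (adBeta β) r :=
  le_biSup (fun r => Module.End.eigenspace (adBeta β) r) (Set.mem_singleton (0 : ℝ))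

theorem adjoint_mem_of_mem_uAlg {β : E →L[ℝ] E} (hβ : βᵗ = β) {A : E →L[ℝ] E} (hA : A ∈ uAlg β) :
    Aᵗ ∈ ⨆ r ∈ Set.Iio (0 : ℝ), Module.End.eigenspace (adBeta β) r := by
  have hle : uAlg β ≤ (⨆ r ∈ Set.Iio (0 : ℝ), Module.End.eigenspace (adBeta β) r).comap
      (ContinuousLinearMap.adjoint (𝕜 := ℝ) (E := E) (F := E)).toLinearEquiv.toLinearMap := by
    refine iSup₂_le fun r hr X hX => ?_
    have hX' : β * X - X * β = r • X := Module.End.mem_eigenspace_iff.1 hX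
    refine Submodule.mem_iSup_of_mem (-r) (Submodule.mem_iSup_of_mem
      (neg_lt_zero.2 (Set.mem_Ioi.1 hr)) (Module.End.mem_eigenspace_iff.2 ?_))
    have h1 := congrArg ContinuousLinearMap.adjoint hX'
    rw [map_sub, adjoint_mul, adjoint_mul, hβ, map_smulₛₗ] at h1
    change β * Xᵗ - Xᵗ * β = -r • Xᵗ
    rw [neg_smul, ← neg_sub, h1]
    rfl
  exact hle hA

theorem form_gAlg_uAlg (b : LinearMap.BilinForm ℝ (E →L[ℝ] E)) {β : E →L[ℝ] E}
    (hb : ∀ X Y, b (adBeta β X) Y = b X (adBeta β Y)) {A U : E →L[ℝ] E} (hA : A ∈ gAlg β)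
    (hU : U ∈ uAlg β) : b A U = 0 :=
  form_iSup_eigenspace_eq_zero b (adBeta β) hb
    (Set.disjoint_singleton_left.2 (Set.self_notMem_Ioi (a := (0 : ℝ)))) (gAlg_le β hA) hU

theorem form_gAlg_adjoint_uAlg (b : LinearMap.BilinForm ℝ (E →L[ℝ] E)) {β : E →L[ℝ] E}
    (hβ : βᵗ = β) (hb : ∀ X Y, b (adBeta β X) Y = b X (adBeta β Y)) {A U : E →L[ℝ] E}
    (hA : A ∈ gAlg β) (hU : U ∈ uAlg β) : b A Uᵗ = 0 :=
  form_iSup_eigenspace_eq_zero b (adBeta β) hb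
    (Set.disjoint_singleton_left.2 (Set.self_notMem_Iio (a := (0 : ℝ)))) (gAlg_le β hA)
    (adjoint_mem_of_mem_uAlg hβ hU)

theorem form_uAlg_adjoint_uAlg (b : LinearMap.BilinForm ℝ (E →L[ℝ] E)) {β : E →L[ℝ] E}
    (hβ : βᵗ = β) (hb : ∀ X Y, b (adBeta β X) Y = b X (adBeta β Y)) {A U : E →L[ℝ] E}
    (hA : A ∈ uAlg β) (hU : U ∈ uAlg β) : b A Uᵗ = 0 :=
  form_iSup_eigenspace_eq_zero b (adBeta β) hb
    (Set.disjoint_left.2 fun _ h h' => lt_asymm (Set.mem_Ioi.1 h) (Set.mem_Iio.1 h')) hA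
    (adjoint_mem_of_mem_uAlg hβ hU)

theorem glInner_adBeta {β : E →L[ℝ] E} (hβ : βᵗ = β) (X Y : E →L[ℝ] E) :
    glForm (adBeta β X) Y = glForm X (adBeta β Y) := by
  change glInner (β * X - X * β) Y = glInner X (β * Y - Y * β)
  rw [glInner_sub_left, glInner_sub_right, glInner_mul_left, glInner_mul_right, hβ]

/-- The form `⟨π(A)μ, π(C)μ⟩` on `gl(E)`. -/
noncomputable def repForm (μ : BracketSpace E) : LinearMap.BilinForm ℝ (E →L[ℝ] E) :=
  LinearMap.mk₂ ℝ (fun A C => bracketInner (rep A μ) (rep C μ))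
    (fun A A' C => by rw [map_add, LinearMap.add_apply, bracketInner_add_left])
    (fun c A C => by rw [map_smul, LinearMap.smul_apply, bracketInner_smul_left, smul_eq_mul])
    (fun A C C' => by rw [map_add, LinearMap.add_apply, bracketInner_add_right])
    (fun c A C => by rw [map_smul, LinearMap.smul_apply, bracketInner_smul_right, smul_eq_mul])

theorem repForm_apply (μ : BracketSpace E) (A C : E →L[ℝ] E) :
    repForm μ A C = bracketInner (rep A μ) (rep C μ) := rfl

theorem rep_adBeta {β : E →L[ℝ] E} {μ : BracketSpace E} (h : rep (betaPlus β) μ = 0)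
    (A : E →L[ℝ] E) : rep (adBeta β A) μ = rep (betaPlus β) (rep A μ) := by
  change rep (β * A - A * β) μ = _
  rw [← betaPlus_commutator, rep_commutator, h, map_zero]
  exact sub_zero (rep (betaPlus β) (rep A μ))

/-- Because `β⁺` is a derivation, `ad β` on `A` becomes the symmetric operator `π(β⁺)` on `π(A)μ`.
Thus the spectral parts of `ad β` are orthogonal for this form too. -/
theorem repForm_adBeta {β : E →L[ℝ] E} (hβ : βᵗ = β) {μ : BracketSpace E}
    (h : rep (betaPlus β) μ = 0) (X Y : E →L[ℝ] E) :
    repForm μ (adBeta β X) Y = repForm μ X (adBeta β Y) := by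
  rw [repForm_apply, repForm_apply, rep_adBeta h, rep_adBeta h,
    bracketInner_rep_of_adjoint_eq (adjoint_betaPlus hβ)]

/-! ### The projection onto `𝔮_β` -/

theorem qProj_mem {β : E →L[ℝ] E} (hβ : IsSelfAdjoint β) (A : E →L[ℝ] E) :
    qProj β A ∈ qAlg β := by
  rw [qProj, dif_pos (isCompl_qAlg_kuAlg hβ)]
  exact Submodule.projection_apply_mem _ _

theorem sub_qProj_mem {β : E →L[ℝ] E} (hβ : IsSelfAdjoint β) (A : E →L[ℝ] E) :
    A - qProj β A ∈ kuAlg β := by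
  rw [qProj, dif_pos (isCompl_qAlg_kuAlg hβ)]
  exact Submodule.sub_projection_mem (isCompl_qAlg_kuAlg hβ) A

theorem qProj_eq_self {β : E →L[ℝ] E} (hβ : IsSelfAdjoint β) {A : E →L[ℝ] E} (hA : A ∈ qAlg β) :
    qProj β A = A := by
  rw [qProj, dif_pos (isCompl_qAlg_kuAlg hβ)]
  exact (Submodule.projection_eq_self_iff (isCompl_qAlg_kuAlg hβ) A).2 hA

end Linearization

section Linearization

variable {E : Type*} [NormedAddCommGroup E] [InnerProductSpace ℝ E] [FiniteDimensional ℝ E]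

/-! ### The operator on `𝔰𝔩_β` inducing the linearization -/

theorem rep_neg (A : E →L[ℝ] E) (μ : BracketSpace E) : rep (-A) μ = -rep A μ := by
  ext x y
  simp
  abel

theorem rep_sub (A C : E →L[ℝ] E) (μ : BracketSpace E) :
    rep (A - C) μ = rep A μ - rep C μ := by
  ext x y
  simp
  abel

theorem adBeta_apply (β A : E →L[ℝ] E) : adBeta β A = β * A - A * β := rfl

theorem adjoint_mem_gAlg {β : E →L[ℝ] E} (hβ : βᵗ = β) {A : E →L[ℝ] E} (hA : A ∈ gAlg β) :
    Aᵗ ∈ gAlg β := by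
  rw [mem_gAlg_iff] at hA ⊢
  have h := congrArg ContinuousLinearMap.adjoint hA
  rw [adjoint_mul, adjoint_mul, hβ] at h
  exact h.symm

theorem mul_mem_gAlg {β A C : E →L[ℝ] E} (hA : A ∈ gAlg β) (hC : C ∈ gAlg β) :
    A * C ∈ gAlg β := by
  rw [mem_gAlg_iff] at hA hC ⊢
  rw [← mul_assoc, hA, mul_assoc, hC, mul_assoc]

theorem adBeta_mem_uAlg {β U : E →L[ℝ] E} (hU : U ∈ uAlg β) : adBeta β U ∈ uAlg β := by
  have hle : uAlg β ≤ (uAlg β).comap (adBeta β) := by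
    refine iSup₂_le fun r hr X hX => ?_
    rw [Submodule.mem_comap, Module.End.mem_eigenspace_iff.1 hX]
    exact Submodule.smul_mem _ _ (Submodule.mem_iSup_of_mem r (Submodule.mem_iSup_of_mem hr hX))
  exact hle hU

theorem glInner_gAlg_uAlg {β : E →L[ℝ] E} (hβ : βᵗ = β) {A U : E →L[ℝ] E} (hA : A ∈ gAlg β)
    (hU : U ∈ uAlg β) : glInner A U = 0 :=
  form_gAlg_uAlg glForm (glInner_adBeta hβ) hA hU

theorem self_mem_gAlg (β : E →L[ℝ] E) : β ∈ gAlg β := mem_gAlg_iff.2 rfl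

theorem glInner_eq_zero_of_mem_slAlg {β : E →L[ℝ] E} (hβ : βᵗ = β) {A : E →L[ℝ] E}
    (hA : A ∈ slAlg β) : glInner A β = 0 := by
  obtain ⟨A₀, hA₀, U, hU, rfl⟩ := Submodule.mem_sup.1 hA
  rw [glInner_add_left, hA₀.2, glInner_comm, glInner_gAlg_uAlg hβ (self_mem_gAlg β) hU, add_zero]

theorem mem_slAlg_of_mem_qAlg {β : E →L[ℝ] E} (hβ : βᵗ = β) {A : E →L[ℝ] E}
    (hA : A ∈ qAlg β) (h : glInner A β = 0) : A ∈ slAlg β := by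
  obtain ⟨A₀, hA₀, U, hU, rfl⟩ := Submodule.mem_sup.1 hA
  rw [glInner_add_left, glInner_comm U, glInner_gAlg_uAlg hβ (self_mem_gAlg β) hU, add_zero] at h
  exact add_mem (Submodule.mem_sup_left ⟨hA₀, h⟩) (Submodule.mem_sup_right hU)

theorem exists_add_of_mem_slAlg {β A : E →L[ℝ] E} (hA : A ∈ slAlg β) :
    ∃ A₀ ∈ gAlg β, ∃ U ∈ uAlg β, A = A₀ + U := by
  obtain ⟨A₀, hA₀, U, hU, rfl⟩ := Submodule.mem_sup.1 hA
  exact ⟨A₀, hA₀.1, U, hU, rfl⟩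

theorem mem_kAlg_iff {β A : E →L[ℝ] E} : A ∈ kAlg β ↔ β * A = A * β ∧ Aᵗ = -A := by
  rw [kAlg, Submodule.mem_inf, mem_gAlg_iff, LinearMap.mem_ker]
  refine and_congr_right fun _ => ?_
  rw [eq_neg_iff_add_eq_zero, add_comm]
  rfl

theorem kAlg_le_slAlg {β : E →L[ℝ] E} (hβ : βᵗ = β) : kAlg β ≤ slAlg β := by
  intro A hA
  have h := (mem_kAlg_iff.1 hA).2
  refine Submodule.mem_sup_left ⟨hA.1, ?_⟩
  have h1 := glInner_adjoint A β
  rw [h, hβ, glInner_neg_left] at h1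
  linarith

theorem glInner_kuAlg {β Z C : E →L[ℝ] E} (hZ : Z ∈ kuAlg β) (hC : Cᵗ = C) : glInner Z C = 0 := by
  obtain ⟨U, -, rfl⟩ := hZ
  change glInner (U - Uᵗ) C = 0
  rw [glInner_sub_left, ← hC, glInner_adjoint, hC, sub_self]

theorem glInner_qProj {β : E →L[ℝ] E} (hβ : βᵗ = β) (R : E →L[ℝ] E) {C : E →L[ℝ] E}
    (hC : Cᵗ = C) : glInner (qProj β R) C = glInner R C := by
  have h := glInner_kuAlg (sub_qProj_mem (β := β) hβ R) hC
  rw [glInner_sub_left] at h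
  linarith

theorem glInner_qProj_gAlg {β : E →L[ℝ] E} (hβ : βᵗ = β) (R : E →L[ℝ] E) {C : E →L[ℝ] E}
    (hC : C ∈ gAlg β) : glInner (qProj β R) C = glInner R C := by
  have h : glInner (R - qProj β R) C = 0 := by
    obtain ⟨U, hU, h⟩ := sub_qProj_mem (β := β) hβ R
    rw [← h]
    change glInner (U - Uᵗ) C = 0
    have h1 : glInner C Uᵗ = 0 := form_gAlg_adjoint_uAlg glForm hβ (glInner_adBeta hβ) hC hU
    rw [glInner_comm, glInner_sub_right, glInner_gAlg_uAlg hβ hC hU, h1, sub_zero]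
  rw [glInner_sub_left] at h
  linarith

/-- The projection moves the lower triangular part of a symmetric endomorphism onto the upper one.
It preserves pairings with `V + Vᵗ` and kills those with `Vᵗ`, hence the factor `2`. -/
theorem glInner_qProj_uAlg {β : E →L[ℝ] E} (hβ : βᵗ = β) {R V : E →L[ℝ] E}
    (hR : glInner R Vᵗ = glInner R V) (hV : V ∈ uAlg β) :
    glInner (qProj β R) V = 2 * glInner R V := by
  have h1 : glInner (qProj β R) (V + Vᵗ) = glInner R (V + Vᵗ) :=
    glInner_qProj hβ R (by rw [map_add, ContinuousLinearMap.adjoint_adjoint, add_comm])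
  have h2 : glInner (qProj β R) Vᵗ = 0 := by
    obtain ⟨Q₀, hQ₀, U, hU, h⟩ := Submodule.mem_sup.1 (qProj_mem (β := β) hβ R)
    have h3 : glInner Q₀ Vᵗ = 0 := form_gAlg_adjoint_uAlg glForm hβ (glInner_adBeta hβ) hQ₀ hV
    have h4 : glInner U Vᵗ = 0 := form_uAlg_adjoint_uAlg glForm hβ (glInner_adBeta hβ) hU hV
    rw [← h, glInner_add_left, h3, h4, add_zero]
  rw [glInner_add_right, glInner_add_right, h2, hR] at h1
  linarith

theorem repForm_comm (μ : BracketSpace E) (A C : E →L[ℝ] E) : repForm μ A C = repForm μ C A :=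
  bracketInner_comm _ _

/-- The Hessian form `½ ⟨π(A)μ, π(C)μ⟩ + tr(B A C)`. -/
noncomputable def hessianForm (μ : BracketSpace E) (A C : E →L[ℝ] E) : ℝ :=
  1 / 2 * repForm μ A C + glInner (killing μ * A) C

theorem hessianForm_comm (μ : BracketSpace E) (A C : E →L[ℝ] E) :
    hessianForm μ A C = hessianForm μ C A := by
  rw [hessianForm, hessianForm, repForm_comm, glInner_mul_left, adjoint_killing,
    glInner_comm A]

/-- The symmetric part of an endomorphism. -/
noncomputable def symPart (A : E →L[ℝ] E) : E →L[ℝ] E := (1 / 2 : ℝ) • (A + Aᵗ)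

theorem adjoint_symPart (A : E →L[ℝ] E) : (symPart A)ᵗ = symPart A := by
  rw [symPart, map_smulₛₗ, map_add, ContinuousLinearMap.adjoint_adjoint, add_comm]
  rfl

theorem adjoint_sub_symPart (A : E →L[ℝ] E) : (A - symPart A)ᵗ = -(A - symPart A) := by
  rw [map_sub, adjoint_symPart, symPart]
  module

theorem symPart_mem_gAlg {β : E →L[ℝ] E} (hβ : βᵗ = β) {A : E →L[ℝ] E} (hA : A ∈ gAlg β) :
    symPart A ∈ gAlg β :=
  Submodule.smul_mem _ _ (add_mem hA (adjoint_mem_gAlg hβ hA))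

/-- `R` is the derivative of the modified Ricci curvature along the orbit of `μ`. -/
def IsOrbitRic (μ : BracketSpace E) (R : (E →L[ℝ] E) →ₗ[ℝ] (E →L[ℝ] E)) : Prop :=
  ∀ A C, glInner (R A) C = 1 / 4 * (repForm μ A C + repForm μ A Cᵗ)
    + 1 / 2 * glInner (Aᵗ * killing μ + killing μ * A) C

namespace IsOrbitRic

variable {μ : BracketSpace E} {R : (E →L[ℝ] E) →ₗ[ℝ] (E →L[ℝ] E)}

theorem glInner_adjoint_right (hR : IsOrbitRic μ R) (A C : E →L[ℝ] E) :
    glInner (R A) Cᵗ = glInner (R A) C := by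
  rw [hR, hR, ContinuousLinearMap.adjoint_adjoint,
    ← glInner_adjoint (Aᵗ * killing μ + killing μ * A) C, map_add, adjoint_mul, adjoint_mul,
    ContinuousLinearMap.adjoint_adjoint, adjoint_killing, add_comm (repForm μ A Cᵗ),
    add_comm (killing μ * A)]

theorem glInner_symPart (hR : IsOrbitRic μ R) (A C : E →L[ℝ] E) :
    glInner (R A) (symPart C) = glInner (R A) C := by
  rw [symPart, glInner_smul_right, glInner_add_right, hR.glInner_adjoint_right]
  ring

theorem glInner_of_adjoint_eq (hR : IsOrbitRic μ R) {A C : E →L[ℝ] E} (hA : Aᵗ = A)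
    (hC : Cᵗ = C) : glInner (R A) C = hessianForm μ A C := by
  have h1 : glInner (A * killing μ) C = glInner (killing μ * A) C := by
    rw [← glInner_adjoint, adjoint_mul, adjoint_killing, hA, hC]
  rw [hR, hC, hA, glInner_add_left, h1, hessianForm]
  ring

end IsOrbitRic

namespace NilpotentIdeal

variable {β : E →L[ℝ] E} {μ : BracketSpace E} {n : Submodule ℝ E}
  {R : (E →L[ℝ] E) →ₗ[ℝ] (E →L[ℝ] E)}

theorem killing_mul_betaPlus (h : NilpotentIdeal β μ n) : killing μ * betaPlus β = 0 :=
  h.killing_mul h.betaPlus_mem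

theorem betaPlus_mul_killing (h : NilpotentIdeal β μ n) : betaPlus β * killing μ = 0 :=
  h.mul_killing fun _ hy => h.betaPlus_orthogonal hy

theorem killing_mem_gAlg (h : NilpotentIdeal β μ n) : killing μ ∈ gAlg β := by
  rw [mem_gAlg_iff, ← sub_eq_zero, ← betaPlus_commutator, h.killing_mul_betaPlus,
    h.betaPlus_mul_killing, sub_self]

theorem rep_betaPlus (h : NilpotentIdeal β μ n) : rep (betaPlus β) μ = 0 :=
  isDerivation_iff.1 h.isDerivation

theorem rep_beta (h : NilpotentIdeal β μ n) : rep β μ = glInner β β • μ := by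
  have h1 := h.rep_betaPlus
  rw [betaPlus, map_add, LinearMap.add_apply, map_smul, LinearMap.smul_apply, rep_one] at h1
  ext x y
  have h2 : (rep β μ + glInner β β • -μ).1 x y = 0 := by rw [h1]; rfl
  exact sub_eq_zero.1 (by simpa [sub_eq_add_neg] using h2)

theorem bracketInner_rep_self (h : NilpotentIdeal β μ n) (A : E →L[ℝ] E) :
    bracketInner (rep A μ) μ = 4 * glInner β A + 2 * glInner (killing μ) A := by
  rw [h.glInner_beta]
  ring

theorem killing_mul_beta (h : NilpotentIdeal β μ n) :
    killing μ * β = -(glInner β β) • killing μ := by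
  have h1 := h.killing_mul_betaPlus
  rw [betaPlus, mul_add, mul_smul_comm, mul_one] at h1
  rw [neg_smul, eq_neg_of_add_eq_zero_left h1]

/-- From `π(β)μ = ‖β‖² μ` and `B β = -‖β‖² B`, the two contributions are opposite multiples of `⟨B,
A⟩`. So `‖Ric*‖²` is stationary along the orbit and the projected derivative stays in `𝔰𝔩_β`. -/
theorem glInner_orbitRic_beta (h : NilpotentIdeal β μ n) (hR : IsOrbitRic μ R) {A : E →L[ℝ] E}
    (hA : glInner A β = 0) : glInner (R A) β = 0 := by
  have hβ := h.adjoint_eq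
  have hc := mem_gAlg_iff.1 h.killing_mem_gAlg
  have h1 : repForm μ A β = glInner β β * (2 * glInner (killing μ) A) := by
    rw [repForm_apply, h.rep_beta, bracketInner_smul_right, h.bracketInner_rep_self,
      glInner_comm β A, hA]
    ring
  have h2 : glInner (killing μ * A) β = -(glInner β β) * glInner (killing μ) A := by
    rw [glInner_mul_left, adjoint_killing, h.killing_mul_beta, glInner_smul_right, glInner_comm A]
  have h3 : glInner (Aᵗ * killing μ) β = -(glInner β β) * glInner (killing μ) A := by
    rw [← h2, ← glInner_adjoint, adjoint_mul, adjoint_killing, ContinuousLinearMap.adjoint_adjoint,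
      hβ]
  rw [hR, hβ, glInner_add_left, h1, h2, h3]
  ring

/-- Orthogonal equivariance of `Ric*`: in a skew direction its derivative is a commutator with `β`,
which is orthogonal to everything commuting with `β`. The proof evaluates `⟨π([T, K])μ, μ⟩` in two
ways, with `T` the symmetric part of `C`. -/
theorem glInner_orbitRic_skew (h : NilpotentIdeal β μ n) (hR : IsOrbitRic μ R) {K C : E →L[ℝ] E}
    (hK : Kᵗ = -K) (hC : C ∈ gAlg β) : glInner (R K) C = 0 := by
  have hβ := h.adjoint_eq
  rw [← hR.glInner_symPart]
  have hT := adjoint_symPart C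
  have hTβ := mem_gAlg_iff.1 (symPart_mem_gAlg hβ hC)
  generalize symPart C = T at hT hTβ
  have h1 : bracketInner (rep (T * K - K * T) μ) μ = 2 * repForm μ K T := by
    have e1 : bracketInner (rep T (rep K μ)) μ = repForm μ K T := by
      rw [bracketInner_rep_left, hT]
      rfl
    have e2 : bracketInner (rep K (rep T μ)) μ = -repForm μ K T := by
      rw [bracketInner_rep_left, hK, rep_neg, bracketInner_neg_right, bracketInner_comm]
      rfl
    rw [rep_commutator, bracketInner_sub_left, e1, e2]
    ring
  have h2 : ∀ X : E →L[ℝ] E, glInner X (T * K - K * T) = glInner K (T * X - X * T) := by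
    intro X
    rw [glInner_comm X, glInner_sub_left, glInner_mul_left, glInner_mul_right, hT,
      glInner_sub_right]
  rw [h.bracketInner_rep_self, h2, h2, hTβ, sub_self, glInner_zero_right] at h1
  rw [hR, hT, hK, glInner_add_left, neg_mul, glInner_neg_left, glInner_mul_right K,
    glInner_mul_left (killing μ), adjoint_killing]
  rw [glInner_sub_right] at h1
  linarith

theorem repForm_adBeta (h : NilpotentIdeal β μ n) (X Y : E →L[ℝ] E) :
    repForm μ (adBeta β X) Y = repForm μ X (adBeta β Y) :=
  BracketFlow.repForm_adBeta h.adjoint_eq h.rep_betaPlus X Y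

/-- `U` drops out by spectral orthogonality and `B U = 0`, the skew part of `A` by equivariance. -/
theorem glInner_orbitRic_gAlg (h : NilpotentIdeal β μ n) (hR : IsOrbitRic μ R)
    {A U C : E →L[ℝ] E} (hU : U ∈ uAlg β) (hC : C ∈ gAlg β) :
    glInner (R (A + U)) C = hessianForm μ (symPart A) (symPart C) := by
  have hβ := h.adjoint_eq
  have hU0 : glInner (R U) C = 0 := by
    have hB := h.killing_mul_eq_zero_of_mem_uAlg hU
    have hB' : Uᵗ * killing μ = 0 := by
      have h1 := congrArg ContinuousLinearMap.adjoint hB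
      rwa [adjoint_mul, adjoint_killing, map_zero] at h1
    rw [hR, hB, hB', repForm_comm, repForm_comm μ U,
      form_gAlg_uAlg (repForm μ) h.repForm_adBeta hC hU,
      form_gAlg_uAlg (repForm μ) h.repForm_adBeta (adjoint_mem_gAlg hβ hC) hU]
    simp
  have hA0 : glInner (R A) C = glInner (R (symPart A)) C := by
    have h1 := h.glInner_orbitRic_skew hR (adjoint_sub_symPart A) hC
    rw [map_sub, glInner_sub_left] at h1
    linarith
  rw [map_add, glInner_add_left, hU0, add_zero, hA0, ← hR.glInner_symPart,
    hR.glInner_of_adjoint_eq (adjoint_symPart A) (adjoint_symPart C)]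

/-- Spectral orthogonality removes `A`, because `B` commutes with `β`, and also the pairing of `U`
with `Vᵗ`; the Killing terms vanish since `B U = 0`. -/
theorem glInner_orbitRic_uAlg (h : NilpotentIdeal β μ n) (hR : IsOrbitRic μ R)
    {A U V : E →L[ℝ] E} (hA : A ∈ gAlg β) (hU : U ∈ uAlg β) (hV : V ∈ uAlg β) :
    glInner (R (A + U)) V = 1 / 4 * repForm μ U V := by
  have hβ := h.adjoint_eq
  have hb := h.repForm_adBeta
  have hB := h.killing_mem_gAlg
  have hBU := h.killing_mul_eq_zero_of_mem_uAlg hU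
  have hBU' : Uᵗ * killing μ = 0 := by
    have h1 := congrArg ContinuousLinearMap.adjoint hBU
    rwa [adjoint_mul, adjoint_killing, map_zero] at h1
  have h1 : glInner (R A) V = 0 := by
    rw [hR, form_gAlg_uAlg (repForm μ) hb hA hV, form_gAlg_adjoint_uAlg (repForm μ) hβ hb hA hV,
      glInner_gAlg_uAlg hβ (add_mem (mul_mem_gAlg (adjoint_mem_gAlg hβ hA) hB)
        (mul_mem_gAlg hB hA)) hV]
    ring
  have h2 : glInner (R U) V = 1 / 4 * repForm μ U V := by
    rw [hR, form_uAlg_adjoint_uAlg (repForm μ) hβ hb hU hV, hBU, hBU']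
    simp
  rw [map_add, glInner_add_left, h1, h2, zero_add]

/-- The operator `A ↦ (d Ric*(π(A)μ))_{𝔮_β} + [β, A]`. -/
noncomputable def _root_.BracketFlow.linOp (β : E →L[ℝ] E)
    (R : (E →L[ℝ] E) →ₗ[ℝ] (E →L[ℝ] E)) : (E →L[ℝ] E) →ₗ[ℝ] (E →L[ℝ] E) :=
  qProj β ∘ₗ R + adBeta β

theorem _root_.BracketFlow.linOp_apply (β : E →L[ℝ] E) (R : (E →L[ℝ] E) →ₗ[ℝ] (E →L[ℝ] E))
    (A : E →L[ℝ] E) : linOp β R A = qProj β (R A) + adBeta β A := rfl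

theorem linOp_mem (h : NilpotentIdeal β μ n) (hR : IsOrbitRic μ R) {A : E →L[ℝ] E}
    (hA : A ∈ slAlg β) : linOp β R A ∈ slAlg β := by
  have hβ := h.adjoint_eq
  refine add_mem (mem_slAlg_of_mem_qAlg hβ (qProj_mem hβ _) ?_) ?_
  · change glInner (qProj β (R A)) β = 0
    rw [glInner_qProj hβ _ hβ,
      h.glInner_orbitRic_beta hR (glInner_eq_zero_of_mem_slAlg hβ hA)]
  · obtain ⟨A₀, hA₀, U, hU, rfl⟩ := exists_add_of_mem_slAlg hA
    rw [map_add, adBeta_apply β A₀, mem_gAlg_iff.1 hA₀, sub_self, zero_add]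
    exact Submodule.mem_sup_right (adBeta_mem_uAlg hU)

/-- The decisive normal form: `𝔤_β` and `𝔲_β` decouple, each summand is symmetric, and its sign is
visible once the Hessian is known to be nonnegative. -/
theorem glInner_linOp (h : NilpotentIdeal β μ n) (hR : IsOrbitRic μ R) {A U C V : E →L[ℝ] E}
    (hA : A ∈ gAlg β) (hU : U ∈ uAlg β) (hC : C ∈ gAlg β) (hV : V ∈ uAlg β) :
    glInner (linOp β R (A + U)) (C + V) =
      hessianForm μ (symPart A) (symPart C) + 1 / 2 * repForm μ U V + glInner (adBeta β U) V := by
  have hβ := h.adjoint_eq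
  have h1 : glInner (adBeta β U) C = 0 := by
    rw [glInner_comm, glInner_gAlg_uAlg hβ hC (adBeta_mem_uAlg hU)]
  rw [linOp_apply, glInner_add_left, glInner_add_right, glInner_qProj_gAlg hβ _ hC,
    glInner_qProj_uAlg hβ (hR.glInner_adjoint_right _ _) hV, h.glInner_orbitRic_gAlg hR hU hC,
    h.glInner_orbitRic_uAlg hR hA hU hV, map_add, adBeta_apply β A, mem_gAlg_iff.1 hA, sub_self,
    zero_add, glInner_add_right, h1]
  ring

theorem glInner_linOp_comm (h : NilpotentIdeal β μ n) (hR : IsOrbitRic μ R) {X Y : E →L[ℝ] E}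
    (hX : X ∈ slAlg β) (hY : Y ∈ slAlg β) :
    glInner (linOp β R X) Y = glInner X (linOp β R Y) := by
  obtain ⟨A, hA, U, hU, rfl⟩ := exists_add_of_mem_slAlg hX
  obtain ⟨C, hC, V, hV, rfl⟩ := exists_add_of_mem_slAlg hY
  have h1 : glInner (adBeta β U) V = glInner (adBeta β V) U := by
    rw [glInner_comm (adBeta β V)]
    exact glInner_adBeta h.adjoint_eq U V
  rw [glInner_comm (A + U), h.glInner_linOp hR hA hU hC hV, h.glInner_linOp hR hC hV hA hU,
    hessianForm_comm, repForm_comm, h1]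

/-- If the three nonnegative terms add to zero, definiteness of `⟨[β, U], U⟩` gives `U = 0`, and the
Hessian makes the symmetric part of `A` a derivation. So `X` acts on `μ` like the skew part of `A`.
-/
theorem glInner_linOp_self (h : NilpotentIdeal β μ n) (hR : IsOrbitRic μ R) {X : E →L[ℝ] E}
    (hX : X ∈ slAlg β) :
    0 ≤ glInner (linOp β R X) X ∧
      (glInner (linOp β R X) X = 0 → ∃ K ∈ kAlg β, rep X μ = rep K μ) := by
  have hβ := h.adjoint_eq
  obtain ⟨A, hA, U, hU, rfl⟩ := exists_add_of_mem_slAlg hX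
  rw [h.glInner_linOp hR hA hU hA hU]
  obtain ⟨h1, h1'⟩ := h.hessian_nonneg (adjoint_symPart A)
    (mem_gAlg_iff.1 (symPart_mem_gAlg hβ hA))
  obtain ⟨h2, h2'⟩ := form_apply_self_nonneg_of_mem glForm glForm_pos (glInner_adBeta hβ) hU
  rw [← repForm_apply] at h1 h1'
  change 0 ≤ hessianForm μ (symPart A) (symPart A) at h1
  change hessianForm μ (symPart A) (symPart A) = 0 → _ at h1'
  rw [glForm_apply] at h2 h2'
  have h3 : 0 ≤ repForm μ U U := bracketInner_self_nonneg _
  refine ⟨by linarith, fun h0 => ⟨A - symPart A, mem_kAlg_iff.2 ⟨mem_gAlg_iff.1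
    (sub_mem hA (symPart_mem_gAlg hβ hA)), adjoint_sub_symPart A⟩, ?_⟩⟩
  rw [h2' (by linarith), add_zero, rep_sub, h1' (by linarith)]
  exact (sub_zero (rep A μ)).symm

/-- The normal form sees only the symmetric part of `K`, which is zero. Since the operator preserves
`𝔰𝔩_β`, its value may be paired with itself. -/
theorem linOp_eq_zero_of_mem_kAlg (h : NilpotentIdeal β μ n) (hR : IsOrbitRic μ R)
    {K : E →L[ℝ] E} (hK : K ∈ kAlg β) : linOp β R K = 0 := by
  have hβ := h.adjoint_eq
  have hKsl := kAlg_le_slAlg hβ hK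
  obtain ⟨C, hC, V, hV, hCV⟩ := exists_add_of_mem_slAlg (h.linOp_mem hR hKsl)
  refine glInner_self_eq_zero ?_
  have h1 := h.glInner_linOp hR hK.1 (zero_mem (uAlg β)) hC hV
  have h2 : symPart K = 0 := by rw [symPart, (mem_kAlg_iff.1 hK).2, add_neg_cancel, smul_zero]
  rw [add_zero, ← hCV, h2, hessianForm] at h1
  rw [h1]
  simp

end NilpotentIdeal

end Linearization

/-! ### The linearization and its spectrum -/

section Main

variable {E : Type*} [NormedAddCommGroup E] [InnerProductSpace ℝ E] [FiniteDimensional ℝ E]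

/-- The derivative of the modified Ricci curvature along the orbit, as a linear map on `gl(E)`. -/
theorem exists_isOrbitRic (μ : BracketSpace E) :
    ∃ R : (E →L[ℝ] E) →ₗ[ℝ] (E →L[ℝ] E), IsOrbitRic μ R ∧
      ∀ A, R A = ricMod (μ + rep A μ) - ricMod μ - ricMod (rep A μ) := by
  obtain ⟨D, -, hD⟩ := exists_hasFDerivAt_ricMod μ
  let R : (E →L[ℝ] E) →ₗ[ℝ] (E →L[ℝ] E) :=
    { toFun := fun A => D (rep A μ)
      map_add' := fun A C => by rw [map_add, LinearMap.add_apply, map_add]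
      map_smul' := fun c A => by
        rw [map_smul, LinearMap.smul_apply, map_smul]
        rfl }
  have hR : ∀ A, R A = ricMod (μ + rep A μ) - ricMod μ - ricMod (rep A μ) := fun A => hD _
  refine ⟨R, fun A C => ?_, hR⟩
  rw [hR, glInner_ricMod_polar_rep]
  rfl

/-- At `μ` the endomorphism acting in the flow field is `β⁺`, a derivation. Differentiating,
`π(β⁺)π(A)μ = π([β, A])μ`, and the derivative of `‖Ric*‖²` vanishes along `𝔰𝔩_β`. -/
theorem exists_linearization (β : E →L[ℝ] E) (μ : BracketSpace E) (n : Submodule ℝ E)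
    (h : NilpotentIdeal β μ n) :
    flowField β μ = 0 ∧ ∃ X : BracketSpace E →L[ℝ] BracketSpace E,
      HasFDerivAt (flowField β) X μ ∧
      ∃ R, IsOrbitRic μ R ∧ ∀ A ∈ slAlg β, X (rep A μ) = -rep (linOp β R A) μ := by
  have hβ := h.adjoint_eq
  have hq : qProj β (ricMod μ) = β := by
    rw [h.ricMod_eq, qProj_eq_self hβ (Submodule.mem_sup_left (self_mem_gAlg β))]
  have hp : qProj β (ricMod μ) + glInner (ricMod μ) (ricMod μ) • (1 : E →L[ℝ] E) = betaPlus β := by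
    rw [hq, h.ricMod_eq, betaPlus]
  obtain ⟨X, hX, hXv⟩ := exists_hasFDerivAt_flowField β μ
  obtain ⟨R, hR, hRA⟩ := exists_isOrbitRic μ
  refine ⟨?_, X, hX, R, hR, fun A hA => ?_⟩
  · rw [flowField, hp, h.rep_betaPlus]
    exact neg_zero (G := BracketSpace E)
  · have h0 : glInner (ricMod μ) (R A) = 0 := by
      rw [h.ricMod_eq, glInner_comm,
        h.glInner_orbitRic_beta hR (glInner_eq_zero_of_mem_slAlg hβ hA)]
    have h1 : rep (betaPlus β) (rep A μ) = rep (adBeta β A) μ :=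
      (rep_adBeta h.rep_betaPlus A).symm
    have h2 : qProj β (R A) + (2 * (0 : ℝ)) • (1 : E →L[ℝ] E) = qProj β (R A) := by simp
    rw [hXv, ← hRA, h0, hp, h1, h2, linOp_apply, map_add, LinearMap.add_apply]
    abel

set_option maxHeartbeats 1000000 in
theorem linearization_spectrum (β : E →L[ℝ] E) (μ : BracketSpace E) (n : Submodule ℝ E)
    (h : NilpotentIdeal β μ n) (X : BracketSpace E →L[ℝ] BracketSpace E)
    (R : (E →L[ℝ] E) →ₗ[ℝ] (E →L[ℝ] E)) (hR : IsOrbitRic μ R)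
    (hX : ∀ A ∈ slAlg β, X (rep A μ) = -rep (linOp β R A) μ) :
    ∃ L : Module.End ℝ (orbitTangent β μ),
      (∀ v : orbitTangent β μ, (L v : BracketSpace E) = X v) ∧
      (LinearMap.ker L).map (orbitTangent β μ).subtype = repImage (kAlg β) μ ∧
      ∀ z : ℂ, Module.End.HasEigenvalue (LinearMap.baseChange ℂ L) z → z ≠ 0 →
        ∃ r : ℝ, r < 0 ∧ z = (r : ℂ) := by
  let _ : AddCommGroup (orbitTangent β μ) :=
    Submodule.addCommGroup (R := ℝ) (M := BracketSpace E) (orbitTangent β μ)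
  have hmaps : ∀ v ∈ orbitTangent β μ, X v ∈ orbitTangent β μ := by
    rintro _ ⟨A, hA, rfl⟩
    change X (rep A μ) ∈ _
    rw [hX A hA, ← rep_neg]
    exact ⟨_, neg_mem (h.linOp_mem hR hA), rfl⟩
  let L : Module.End ℝ (orbitTangent β μ) :=
    { toFun := fun v => ⟨X v, hmaps v v.2⟩
      map_add' := fun v w => Subtype.ext (map_add X (v : BracketSpace E) w)
      map_smul' := fun c v => Subtype.ext (map_smul X c (v : BracketSpace E)) }
  let f : slAlg β →ₗ[ℝ] orbitTangent β μ :=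
    { toFun := fun A => ⟨rep (A : E →L[ℝ] E) μ, A, A.2, rfl⟩
      map_add' := fun A C => Subtype.ext (by
        change rep ((A : E →L[ℝ] E) + (C : E →L[ℝ] E)) μ = rep (A : E →L[ℝ] E) μ + rep (C : E →L[ℝ] E) μ
        rw [map_add, LinearMap.add_apply])
      map_smul' := fun c A => Subtype.ext (by
        change rep (c • (A : E →L[ℝ] E)) μ = c • rep (A : E →L[ℝ] E) μ
        rw [map_smul, LinearMap.smul_apply]) }
  have hXK : ∀ K ∈ kAlg β, X (rep K μ) = 0 := fun K hK => by
    rw [hX K (kAlg_le_slAlg h.adjoint_eq hK), h.linOp_eq_zero_of_mem_kAlg hR hK, map_zero,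
      LinearMap.zero_apply]
    exact neg_zero (G := BracketSpace E)
  have hf : Function.Surjective f := by
    rintro ⟨_, A, hA, rfl⟩
    exact ⟨⟨A, hA⟩, rfl⟩
  have hfin : Module.Finite ℝ (orbitTangent β μ) := Module.Finite.of_surjective f hf
  let M : Module.End ℝ (slAlg β) := (linOp β R).restrict fun A hA => h.linOp_mem hR hA
  have hL : ∀ A, L (f A) = -f (M A) := fun A => Subtype.ext (hX A A.2)
  let b : LinearMap.BilinForm ℝ (slAlg β) := LinearMap.BilinForm.restrict (glForm (E := E)) (slAlg β)
  obtain ⟨hker, heig⟩ := ker_and_eigenvalue_of_intertwined b (fun A C => glInner_comm _ _)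
    (fun A hA => glForm_pos (A : E →L[ℝ] E) fun h0 => hA (Subtype.ext h0)) M
    (fun A C => h.glInner_linOp_comm hR A.2 C.2) (fun A => (h.glInner_linOp_self hR A.2).1) L f hf hL
  refine ⟨L, fun v => rfl, ?_, fun z hz hz0 => ?_⟩
  · apply le_antisymm
    · rintro _ ⟨v, hv, rfl⟩
      obtain ⟨A, rfl⟩ := hf v
      obtain ⟨C, hC, hCA⟩ := hker A hv
      have h1 : linOp β R C = 0 := congrArg Subtype.val hC
      obtain ⟨K, hK, hKC⟩ := (h.glInner_linOp_self hR C.2).2 (by rw [h1, glInner_zero_left])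
      rw [← hCA]
      exact ⟨K, hK, hKC.symm⟩
    · rintro _ ⟨K, hK, rfl⟩
      have hKs := kAlg_le_slAlg h.adjoint_eq hK
      exact ⟨f ⟨K, hKs⟩, Subtype.ext (hXK K hK), rfl⟩
  · obtain ⟨r, hr, rfl⟩ := heig z hz
    exact ⟨r, lt_of_le_of_ne hr fun h0 => hz0 (by rw [h0, Complex.ofReal_zero]), rfl⟩

end Main

end BracketFlow

theorem theorem8p1 {E : Type*} [NormedAddCommGroup E] [InnerProductSpace ℝ E]
    [FiniteDimensional ℝ E] (β : E →L[ℝ] E) (hβ : BracketFlow.IsStratumLabel β)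
    (μ : BracketFlow.BracketSpace E) (hμ : μ ∈ BracketFlow.vNonnegSS β)
    (hsol : BracketFlow.IsSolvsoliton μ) (hric : BracketFlow.ricMod μ = β) :
    BracketFlow.flowField β μ = 0 ∧
    ∃ X : BracketFlow.BracketSpace E →L[ℝ] BracketFlow.BracketSpace E,
      HasFDerivAt (BracketFlow.flowField β) X μ ∧
      ∃ L : Module.End ℝ (BracketFlow.orbitTangent β μ),
        (∀ v : BracketFlow.orbitTangent β μ, (L v : BracketFlow.BracketSpace E) = X v) ∧
        (LinearMap.ker L).map (BracketFlow.orbitTangent β μ).subtype =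
          BracketFlow.repImage (BracketFlow.kAlg β) μ ∧
        ∀ z : ℂ, Module.End.HasEigenvalue (LinearMap.baseChange ℂ L) z → z ≠ 0 →
          ∃ r : ℝ, r < 0 ∧ z = (r : ℂ) := by
  obtain ⟨n, h⟩ := BracketFlow.exists_nilpotentIdeal hβ hμ.1 hsol hric
  obtain ⟨h0, X, hX, R, hR, hXR⟩ := BracketFlow.exists_linearization β μ n h
  exact ⟨h0, X, hX, BracketFlow.linearization_spectrum β μ n h X R hR hXR⟩
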